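/- Let $N\ge 2$ and let $\varphi:\mathbb{R}^N\to\mathbb{R}$ be $C^\infty$, strictly positive, and decaying in the sense that for some $p>2N$ and $C$ one has $\varphi(v)\le C(1+|v|)^{-p}$ for all $v$. Let $u_s\in\mathbb{R}^N$, $V_1\in\mathbb{R}$ and $\rho_s>0$ be constants, and set $$\rho_n=\int_{\mathbb{R}^N}\varphi(v)\,dv,\qquad u_n=\frac1{\rho_n}\int_{\mathbb{R}^N}v\,\varphi(v)\,dv .$$ Write $\varphi,\varphi_*,\varphi',\varphi'_*$ for the values of $\varphi$ at $v,\ v_*,\ v'=v-[(v-v_*)\cdot n]n,\ v'_*=v_*+[(v-v_*)\cdot n]n$, let $dn$ be the surface measure on $S^{N-1}$, and define $$Q(\varphi)(v)=\int_{\mathbb{R}^N}\int_{S^{N-1}}\big(\varphi'\varphi'_*(1+\varphi)(1+\varphi_*)-\varphi\varphi_*(1+\varphi')(1+\varphi'_*)\big)\,dn\,dv_*,$$ $$Q_1(\varphi)(v)=\int_{C_1}\big[\varphi(v')\varphi(v'_*)-\varphi(v)(\varphi(v')+\varphi(v'_*)+1)\big]dv'dv'_*+2\int_{C_2}\big[\varphi(v'_*)(\varphi(v)+\varphi(v_*)+1)-\varphi(v)\varphi(v_*)\big]dv_*dv'_*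 .$$ Here $C_1=C_1(v)$ is the set of $(v',v'_*)$ with $u_s+v=v'+v'_*$ and $|u_s|^2-V_1+|v|^2=|v'|^2+|v'_*|^2$, and $C_2=C_2(v)$ is the set of $(v_*,v'_*)$ with $u_s+v'_*=v+v_*$ and $|u_s|^2-V_1+|v'_*|^2=|v|^2+|v_*|^2$. The integrals over $C_1$ and $C_2$ are taken with respect to the measures $\delta(u_s+v-v'-v'_*)\,\delta(|u_s|^2-V_1+|v|^2-|v'|^2-|v'_*|^2)\,dv'dv'_*$ and $\delta(u_s+v'_*-v-v_*)\,\delta(|u_s|^2-V_1+|v'_*|^2-|v|^2-|v_*|^2)\,dv_*dv'_*$ ($\delta$ being the Dirac mass at $0$). Then $$Q(\varphi)(v)+\rho_s\,Q_1(\varphi)(v)=0\quad\text{for almost every }v\in\mathbb{R}^N$$ if and only if there is a $T>0$ such that, for all $v\in\mathbb{R}^N$, $$\varphi(v)=\frac{M(v)}{1-M(v)},\qquad M(v)=\exp\Big(-\frac{|v-u_n|^2-|u_s-u_n|^2+V_1}{2T}\Big).$$ -/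

import Mathlib

open MeasureTheory
open scoped ContDiff

noncomputable section

namespace BoseGas

/-- The velocity space `ℝ^N` with its Euclidean norm. -/
abbrev Vel (N : ℕ) : Type := EuclideanSpace ℝ (Fin N)

variable {N : ℕ}

/-- Post-collisional velocity `v' = v - [(v - v_*)·n] n`. -/
def vPrime (v vs n : Vel N) : Vel N := v - (inner ℝ (v - vs) n) • n

/-- Post-collisional velocity `v_*' = v_* + [(v - v_*)·n] n`. -/
def vsPrime (v vs n : Vel N) : Vel N := vs + (inner ℝ (v - vs) n) • n

/-- The Boltzmann-Nordheim operator for bosons,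
`Q(φ)(v) = ∫_{ℝ^N} ∫_{S^{N-1}} (φ' φ_*' (1+φ)(1+φ_*) - φ φ_* (1+φ')(1+φ_*')) dn dv_*`,
where `dn` is the surface measure of the unit sphere. -/
def Q (φ : Vel N → ℝ) (v : Vel N) : ℝ :=
  ∫ vs : Vel N, ∫ n : Metric.sphere (0 : Vel N) 1,
    (φ (vPrime v vs n) * φ (vsPrime v vs n) * (1 + φ v) * (1 + φ vs)
      - φ v * φ vs * (1 + φ (vPrime v vs n)) * (1 + φ (vsPrime v vs n)))
    ∂((volume : Measure (Vel N)).toSphere)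

/-- The set of the pairs `(v', v_*')` with `u_s + v = v' + v_*'` and
`|u_s|² - V₁ + |v|² = |v'|² + |v_*'|²`. -/
def C1 (us : Vel N) (V1 : ℝ) (v : Vel N) : Set (Vel N × Vel N) :=
  {p | us + v = p.1 + p.2 ∧ ‖us‖ ^ 2 - V1 + ‖v‖ ^ 2 = ‖p.1‖ ^ 2 + ‖p.2‖ ^ 2}

/-- The set of the pairs `(v_*, v_*')` with `u_s + v_*' = v + v_*` and
`|u_s|² - V₁ + |v_*'|² = |v|² + |v_*|²`. -/
def C2 (us : Vel N) (V1 : ℝ) (v : Vel N) : Set (Vel N × Vel N) :=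
  {p | us + p.2 = v + p.1 ∧ ‖us‖ ^ 2 - V1 + ‖p.2‖ ^ 2 = ‖v‖ ^ 2 + ‖p.1‖ ^ 2}

/-- Radius of the sphere `C1 us V1 v`: `r² = |v - u_s|²/4 - V₁/2`. -/
def radius (us : Vel N) (V1 : ℝ) (v : Vel N) : ℝ :=
  Real.sqrt (‖v - us‖ ^ 2 / 4 - V1 / 2)

/-- Parametrization of `C1 us V1 v` by a unit vector `n`. -/
def paramC1 (us : Vel N) (V1 : ℝ) (v n : Vel N) : Vel N × Vel N :=
  ((1 / 2 : ℝ) • (us + v) + radius us V1 v • n, (1 / 2 : ℝ) • (us + v) - radius us V1 v • n)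

/-- Parametrization of `C2 us V1 v` by a vector `y` orthogonal to `v - u_s`. -/
def paramC2 (us : Vel N) (V1 : ℝ) (v y : Vel N) : Vel N × Vel N :=
  (us + (V1 / (2 * ‖v - us‖ ^ 2)) • (v - us) + y, v + (V1 / (2 * ‖v - us‖ ^ 2)) • (v - us) + y)

theorem C1_eq_range (us : Vel N) (V1 : ℝ) (v : Vel N) (h : 2 * V1 < ‖v - us‖ ^ 2) :
    C1 us V1 v = Set.range fun n : Metric.sphere (0 : Vel N) 1 => paramC1 us V1 v n := by
  have hr : 0 < radius us V1 v := Real.sqrt_pos.2 (by linarith)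
  have hr2 : radius us V1 v ^ 2 = ‖v - us‖ ^ 2 / 4 - V1 / 2 := Real.sq_sqrt (by linarith)
  have hw := norm_sub_sq_real v us
  have key : ∀ d : Vel N, ‖(1 / 2 : ℝ) • (us + v) + d‖ ^ 2 + ‖(1 / 2 : ℝ) • (us + v) - d‖ ^ 2
      = ‖us‖ ^ 2 + ‖v‖ ^ 2 - ‖v - us‖ ^ 2 / 2 + 2 * ‖d‖ ^ 2 := by
    intro d
    have h1 := parallelogram_law_with_norm ℝ ((1 / 2 : ℝ) • (us + v)) d
    have h2 : ‖(1 / 2 : ℝ) • (us + v)‖ ^ 2 = (1 / 4) * ‖us + v‖ ^ 2 := by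
      rw [norm_smul, mul_pow]; norm_num
    have h3 := norm_add_sq_real us v
    have h4 := real_inner_comm us v
    nlinarith
  ext p
  constructor
  · rintro ⟨h1, h2⟩
    set d := p.1 - (1 / 2 : ℝ) • (us + v) with hd
    have e1 : p.1 = (1 / 2 : ℝ) • (us + v) + d := by rw [hd]; abel
    have e2 : p.2 = (1 / 2 : ℝ) • (us + v) - d := by
      have : p.2 = (us + v) - p.1 := by rw [h1]; abel
      rw [this, hd]
      module
    have hk := key d
    rw [← e1, ← e2, ← h2] at hk
    have hdn : ‖d‖ = radius us V1 v := by
      have : ‖d‖ ^ 2 = radius us V1 v ^ 2 := by linarith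
      exact (pow_left_inj₀ (norm_nonneg d) hr.le two_ne_zero).1 this
    refine ⟨⟨(radius us V1 v)⁻¹ • d, ?_⟩, ?_⟩
    · rw [mem_sphere_zero_iff_norm, norm_smul, hdn, norm_inv, Real.norm_of_nonneg hr.le]
      exact inv_mul_cancel₀ hr.ne'
    · simp only [paramC1, smul_inv_smul₀ hr.ne']
      exact Prod.ext e1.symm e2.symm
  · rintro ⟨n, rfl⟩
    have hn : ‖(n : Vel N)‖ = 1 := mem_sphere_zero_iff_norm.1 n.2
    refine ⟨?_, ?_⟩
    · simp only [paramC1]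
      module
    · have hk := key (radius us V1 v • (n : Vel N))
      rw [norm_smul, hn, mul_one, Real.norm_of_nonneg hr.le] at hk
      simp only [paramC1]
      linarith

theorem C2_eq_range (us : Vel N) (V1 : ℝ) (v : Vel N) (h : v ≠ us) :
    C2 us V1 v = Set.range fun y : (Submodule.span ℝ {v - us})ᗮ => paramC2 us V1 v y := by
  have hw : ‖v - us‖ ≠ 0 := norm_ne_zero_iff.2 (sub_ne_zero.2 h)
  have hc : V1 / (2 * ‖v - us‖ ^ 2) * ‖v - us‖ ^ 2 = V1 / 2 := by field_simp
  have key : ∀ b : Vel N, ‖us‖ ^ 2 + ‖v + b‖ ^ 2 - ‖v‖ ^ 2 - ‖us + b‖ ^ 2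
      = 2 * inner ℝ (v - us) b := by
    intro b
    rw [norm_add_sq_real, norm_add_sq_real, inner_sub_left]
    ring
  ext p
  constructor
  · rintro ⟨h1, h2⟩
    set b := p.1 - us with hb
    have e1 : p.1 = us + b := by rw [hb]; abel
    have e2 : p.2 = v + b := by
      have : p.2 = v + p.1 - us := by rw [← h1]; abel
      rw [this, hb]; abel
    have hk := key b
    rw [← e1, ← e2] at hk
    refine ⟨⟨b - (V1 / (2 * ‖v - us‖ ^ 2)) • (v - us), ?_⟩, ?_⟩
    · rw [Submodule.mem_orthogonal_singleton_iff_inner_right, inner_sub_right,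
        inner_smul_right, real_inner_self_eq_norm_sq, hc]
      linarith
    · refine Prod.ext ?_ ?_
      · refine Eq.trans ?_ e1.symm; simp only [paramC2]; module
      · refine Eq.trans ?_ e2.symm; simp only [paramC2]; module
  · rintro ⟨y, rfl⟩
    have hy := Submodule.mem_orthogonal_singleton_iff_inner_right.1 y.2
    refine ⟨?_, ?_⟩
    · simp only [paramC2]; abel
    · have hk := key ((V1 / (2 * ‖v - us‖ ^ 2)) • (v - us) + y)
      rw [inner_add_right, hy, inner_smul_right, real_inner_self_eq_norm_sq, hc] at hk
      simp only [paramC2, add_assoc]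
      linarith

/-- The measure `δ(u_s + v - v' - v_*') δ(|u_s|² - V₁ + |v|² - |v'|² - |v_*'|²) dv' dv_*'`
on `C1 us V1 v`. With `v' = (u_s + v)/2 + d`, `v_*' = (u_s + v)/2 - d`, the argument of the second
Dirac mass is `|v - u_s|²/2 - V₁ - 2 |d|²`, whose gradient in `d` has norm `4 r` on the sphere
`|d| = r`; so the measure is `r^(N-1) / (4 r)` times the surface measure of the unit sphere.
If `|v - u_s|² ≤ 2 V₁` then `C1` has at most one point and the measure is `0`. -/
def measC1 (us : Vel N) (V1 : ℝ) (v : Vel N) : Measure (Vel N × Vel N) :=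
  open Classical in
  if 2 * V1 < ‖v - us‖ ^ 2 then
    ENNReal.ofReal (radius us V1 v ^ (N - 1) / (4 * radius us V1 v)) •
      Measure.map (fun n : Metric.sphere (0 : Vel N) 1 => paramC1 us V1 v n)
        ((volume : Measure (Vel N)).toSphere)
  else 0

/-- The measure `δ(u_s + v_*' - v - v_*) δ(|u_s|² - V₁ + |v_*'|² - |v|² - |v_*|²) dv_* dv_*'`
on `C2 us V1 v`. With `v_* = u_s + b`, `v_*' = v + b`, the argument of the second Dirac mass is
`2 (v - u_s)·b - V₁`, whose gradient in `b` has norm `2 |v - u_s|`; so the measure is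
`1 / (2 |v - u_s|)` times the Lebesgue measure of a hyperplane orthogonal to `v - u_s`.
(For the single velocity `v = u_s` it is `0` here.) The Lebesgue measure is that of the Euclidean
structure of the hyperplane, not the restriction of the one of `ℝ^N`. -/
def measC2 (us : Vel N) (V1 : ℝ) (v : Vel N) : Measure (Vel N × Vel N) :=
  ENNReal.ofReal (1 / (2 * ‖v - us‖)) •
    Measure.map (fun y : (Submodule.span ℝ {v - us})ᗮ => paramC2 us V1 v y)
      (measureSpaceOfInnerProductSpace (E := (Submodule.span ℝ {v - us})ᗮ)).volume

/-- The collision operator `Q₁` between the normal fluid and the condensate (for `h = 0`); in the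
first integral `p = (v', v_*')`, in the second one `p = (v_*, v_*')`. -/
def Q1 (us : Vel N) (V1 : ℝ) (φ : Vel N → ℝ) (v : Vel N) : ℝ :=
  (∫ p : Vel N × Vel N, (φ p.1 * φ p.2 - φ v * (φ p.1 + φ p.2 + 1)) ∂(measC1 us V1 v))
    + 2 * ∫ p : Vel N × Vel N, (φ p.2 * (φ v + φ p.1 + 1) - φ v * φ p.1) ∂(measC2 us V1 v)

/-- The mass `ρ_n` of the normal fluid. -/
def rhoN (φ : Vel N → ℝ) : ℝ := ∫ v : Vel N, φ v

/-- The bulk velocity `u_n` of the normal fluid. -/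
def uN (φ : Vel N → ℝ) : Vel N := (1 / rhoN φ) • ∫ v : Vel N, φ v • v

/-- `M(v) = exp(-(|v - u_n|² - |u_s - u_n|² + V₁) / (2T))`. -/
def maxwellian (un us : Vel N) (V1 T : ℝ) (v : Vel N) : ℝ :=
  Real.exp (-(‖v - un‖ ^ 2 - ‖us - un‖ ^ 2 + V1) / (2 * T))

end BoseGas

end

/-!
The theorem is an H-theorem with equality case. Put `χ = log ((1 + φ) / φ)`, which is positive. For
a collision of two normal particles the gain is the loss times
`exp (χ + χ_* - χ' - χ'_*)`, and for a process `a ↔ b + c` involving the condensate the rate of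
`b + c → a` is the rate of `a → b + c` times `exp (χ a - χ b - χ c)`. If the kinetic equation is
multiplied by `χ` and integrated, the symmetries of the collision measures turn the result into a
sum of integrals of terms `(A - B) (x - y)` with `A = B * exp (x - y)`. These are nonnegative, so
they vanish almost everywhere and `χ` is additive on almost all collisions
(`ae_entropyVar_eq`).

*Integrability.* The decay of `φ` is only an upper bound, so a priori `χ` may grow arbitrarily fast.
Finiteness of the entropy production nevertheless follows: the kinetic equation says that gain and
loss, both nonnegative, agree almost everywhere, so only the loss multiplied by `χ` has to be
integrated. The loss is at most `φ` times a constant multiple of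
`(1 + ‖v‖) ^ (N - 2) + 1 / ‖v - us‖`, and `φ * log ((1 + φ) / φ)` is dominated by a power
`φ ^ (1 - δ)`. As `p > 2 N`, a small `δ` leaves this power a decay of order above `2 N - 1`, hence
above `N + 1` after multiplication by `(1 + ‖v‖) ^ (N - 2)`
(`lintegral_totalLoss_mul_entropyVar_lt_top`). The entropy identity itself is stated
for gain and loss separately, in integrals with values in `[0, ∞]`.

*Symmetry.* For the pair collisions it is the invariance of `dv dv_* dn` under exchange of the
colliding particles and under `(v, v_*) ↦ (v', v'_*)`. For the condensate, the measures on `C1 v`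
and `C2 v` are both slices of the measure `δ(2 ⟪b, c⟫ - s) db dc` on pairs, in the one case along
the sum `b + c`, in the other along `b`. That the two slicings describe the same measure is
`splitMeasure_eq_mergeMeasure`: Fubini's theorem in polar coordinates shows that the integrals of a
test function agree for almost every `s`, and they depend continuously on `s`.

*Equilibria.* Since `χ` is continuous and collision measures charge open sets, `χ` is a collision
invariant, hence `α + ⟪β, v⟫ + γ ‖v‖²` (`IsCollisionInvariant.exists_eq`: the even and odd parts of
`χ` are additive on orthogonal pairs). One single process with the condensate then fixes `α`,
because conservation of momentum and energy determines the rest. As `φ` vanishes at infinity,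
`γ > 0`; completing the square gives the equilibrium with some centre, and this centre is the mean
velocity because `φ` is symmetric about it. Conversely, at such an equilibrium gain and loss agree
collision by collision.
-/

noncomputable section

set_option linter.unusedSectionVars false

namespace BoseGas

/-! ### Collision invariants -/

section CollisionInvariants

variable {E : Type*} [NormedAddCommGroup E] [InnerProductSpace ℝ E]

/-- `ψ` is a collision invariant: the sum of its values at two velocities depends only on the total
momentum and the total energy of the pair. -/
def IsCollisionInvariant (ψ : E → ℝ) : Prop :=
  ∀ v w v' w' : E, v + w = v' + w' → ‖v‖ ^ 2 + ‖w‖ ^ 2 = ‖v'‖ ^ 2 + ‖w'‖ ^ 2 →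
    ψ v + ψ w = ψ v' + ψ w'

/-- The pairs `(x, y)` and `(x + y, 0)` have the same momentum, and the same energy if `x ⟂ y`. -/
theorem IsCollisionInvariant.add_of_inner_eq_zero {ψ : E → ℝ} (h : IsCollisionInvariant ψ)
    {x y : E} (hxy : inner ℝ x y = 0) : ψ (x + y) + ψ 0 = ψ x + ψ y := by
  refine h _ _ _ _ (by simp) ?_
  rw [norm_add_sq_real, hxy]
  simp

theorem exists_orthogonal_norm_eq (hE : 2 ≤ Module.finrank ℝ E) (x : E) :
    ∃ y : E, inner ℝ x y = 0 ∧ ‖y‖ = ‖x‖ := by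
  have : FiniteDimensional ℝ E := Module.finite_of_finrank_pos (by omega)
  have h1 : 0 < Module.finrank ℝ (Submodule.span ℝ {x})ᗮ := by
    have h2 := Submodule.finrank_add_finrank_orthogonal (Submodule.span ℝ {x})
    have h3 : Module.finrank ℝ (Submodule.span ℝ {x}) ≤ 1 :=
      (finrank_span_le_card _).trans (by simp)
    omega
  have : Nontrivial (Submodule.span ℝ {x})ᗮ := Module.nontrivial_of_finrank_pos h1
  obtain ⟨z, hz⟩ := exists_norm_eq (Submodule.span ℝ {x})ᗮ
    (norm_nonneg x)
  exact ⟨z, Submodule.mem_orthogonal_singleton_iff_inner_right.1 z.2, by simpa using hz⟩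

/-- For an odd orthogonally additive function the square spanned by `x` and an orthogonal `y` of
the same length has the diagonals `x + y ⟂ x - y`, whence `g (2 x) = 2 g x`; a differentiable
function with this homogeneity is linear. -/
theorem eq_fderiv_of_odd_of_orthogonallyAdditive (hE : 2 ≤ Module.finrank ℝ E) {g : E → ℝ}
    (hadd : ∀ x y, inner ℝ x y = 0 → g (x + y) = g x + g y) (hodd : ∀ x, g (-x) = -g x)
    (hd : DifferentiableAt ℝ g 0) (x : E) : g x = fderiv ℝ g 0 x := by
  have h0 : g 0 = 0 := by
    have := hodd 0
    rw [neg_zero] at this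
    linarith
  have h2 : ∀ x, g ((2 : ℝ) • x) = 2 * g x := by
    intro x
    obtain ⟨y, hy, hn⟩ := exists_orthogonal_norm_eq hE x
    have e1 : g ((x + y) + (x - y)) = g (x + y) + g (x - y) := by
      apply hadd
      rw [inner_add_left, inner_sub_right, inner_sub_right, real_inner_comm x y,
        real_inner_self_eq_norm_sq, real_inner_self_eq_norm_sq, hn]
      ring
    have e2 : g (x + -y) = g x + g (-y) := hadd _ _ (by rw [inner_neg_right, hy, neg_zero])
    rw [hadd x y hy, sub_eq_add_neg, e2, hodd] at e1
    rw [show (2 : ℝ) • x = x + y + (x + -y) by module, e1]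
    ring
  have hk : ∀ k : ℕ, (2 : ℝ) ^ k * g (((2 : ℝ) ^ k)⁻¹ • x) = g x := by
    intro k
    induction k with
    | zero => simp
    | succ k ih =>
      have h3 := h2 (((2 : ℝ) ^ (k + 1))⁻¹ • x)
      rw [smul_smul, show (2 : ℝ) * (2 ^ (k + 1))⁻¹ = (2 ^ k)⁻¹ by field_simp; ring] at h3
      rw [← ih, h3]
      ring
  have hlim := hd.hasFDerivAt.lim_real x (f := g)
  have ht : Filter.Tendsto (fun k : ℕ => (2 : ℝ) ^ k) Filter.atTop Filter.atTop :=
    tendsto_pow_atTop_atTop_of_one_lt (by norm_num)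
  have h4 := hlim.comp ht
  refine tendsto_nhds_unique ?_ h4
  refine tendsto_const_nhds.congr fun k => ?_
  simp only [Function.comp_apply, zero_add, smul_eq_mul, h0, sub_zero]
  exact (hk k).symm

/-- An even orthogonally additive function depends on the norm only, because
`x = (x + y)/2 + (x - y)/2` and `y = (x + y)/2 - (x - y)/2` are orthogonal decompositions when
`‖x‖ = ‖y‖`; as a function of the squared norm it is additive. -/
theorem eq_mul_norm_sq_of_even_of_orthogonallyAdditive (hE : 2 ≤ Module.finrank ℝ E) {g : E → ℝ}
    (hadd : ∀ x y, inner ℝ x y = 0 → g (x + y) = g x + g y) (heven : ∀ x, g (-x) = g x)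
    (hc : Continuous g) : ∃ γ : ℝ, ∀ x, g x = γ * ‖x‖ ^ 2 := by
  have hnorm : ∀ x y : E, ‖x‖ = ‖y‖ → g x = g y := by
    intro x y hxy
    have ho : inner ℝ ((1 / 2 : ℝ) • (x + y)) ((1 / 2 : ℝ) • (x - y)) = 0 := by
      rw [inner_smul_left, inner_smul_right, inner_add_left, inner_sub_right, inner_sub_right,
        real_inner_comm x y, real_inner_self_eq_norm_sq, real_inner_self_eq_norm_sq, hxy]
      simp
    have h1 := hadd _ _ ho
    have h2 := hadd _ (-((1 / 2 : ℝ) • (x - y))) (by rw [inner_neg_right, ho, neg_zero])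
    rw [heven] at h2
    rw [show (1 / 2 : ℝ) • (x + y) + (1 / 2 : ℝ) • (x - y) = x by module] at h1
    rw [show (1 / 2 : ℝ) • (x + y) + -((1 / 2 : ℝ) • (x - y)) = y by module] at h2
    rw [h1, h2]
  have : Nontrivial E := Module.nontrivial_of_finrank_pos (R := ℝ) (by omega)
  obtain ⟨e, he⟩ := exists_norm_eq E zero_le_one
  obtain ⟨e', hee, he'⟩ := exists_orthogonal_norm_eq hE e
  set h : ℝ → ℝ := fun s => g (Real.sqrt s • e) with hh
  have hgh : ∀ x, g x = h (‖x‖ ^ 2) := by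
    intro x
    apply hnorm
    rw [norm_smul, he, Real.sqrt_sq (norm_nonneg x)]
    simp
  have hhadd : ∀ s t : ℝ, 0 ≤ s → 0 ≤ t → h (s + t) = h s + h t := by
    intro s t hs ht
    have h1 : inner ℝ (Real.sqrt s • e) (Real.sqrt t • e') = 0 := by
      rw [inner_smul_left, inner_smul_right, hee]; simp
    have h2 : g (Real.sqrt t • e') = h t := hnorm _ _ (by rw [norm_smul, norm_smul, he'])
    rw [← h2, hh]
    simp only
    rw [← hadd _ _ h1]
    apply hnorm
    have h3 := norm_add_sq_real (Real.sqrt s • e) (Real.sqrt t • e')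
    rw [h1, norm_smul, norm_smul, he', he, Real.norm_of_nonneg (Real.sqrt_nonneg _),
      Real.norm_of_nonneg (Real.sqrt_nonneg _), mul_one, mul_one, Real.sq_sqrt hs,
      Real.sq_sqrt ht] at h3
    rw [← sq_eq_sq₀ (norm_nonneg _) (norm_nonneg _), h3, norm_smul, he, mul_one,
      Real.norm_of_nonneg (Real.sqrt_nonneg _), Real.sq_sqrt (add_nonneg hs ht)]
    ring
  -- the odd extension of `h` to the real line is additive
  let H : ℝ →+ ℝ := AddMonoidHom.mk' (fun s => h (max s 0) - h (max (-s) 0)) (by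
    intro s t
    have h1 : ∀ s : ℝ, max s 0 = s + max (-s) 0 := by
      intro s; rcases le_total 0 s with hs | hs
      · rw [max_eq_left hs, max_eq_right (by linarith)]; ring
      · rw [max_eq_right hs, max_eq_left (by linarith)]; ring
    have key : h (max (s + t) 0 + (max (-s) 0 + max (-t) 0))
        = h (max (-(s + t)) 0 + (max s 0 + max t 0)) := by
      congr 1
      rw [h1 (s + t), h1 s, h1 t]; ring
    rw [hhadd _ _ (le_max_right _ _) (add_nonneg (le_max_right _ _) (le_max_right _ _)),
      hhadd _ _ (le_max_right _ _) (le_max_right _ _),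
      hhadd _ _ (le_max_right _ _) (add_nonneg (le_max_right _ _) (le_max_right _ _)),
      hhadd _ _ (le_max_right _ _) (le_max_right _ _)] at key
    linarith)
  have hHc : Continuous H := by
    have : Continuous h := by
      rw [hh]; fun_prop
    change Continuous fun s => h (max s 0) - h (max (-s) 0)
    fun_prop
  have hh0 : h 0 = 0 := by
    have := hhadd 0 0 le_rfl le_rfl
    rw [add_zero] at this
    linarith
  refine ⟨H 1, fun x => ?_⟩
  have h2 := map_real_smul H hHc (‖x‖ ^ 2) 1
  have h3 : H (‖x‖ ^ 2) = g x := by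
    change h (max (‖x‖ ^ 2) 0) - h (max (-‖x‖ ^ 2) 0) = g x
    rw [max_eq_left (by positivity), max_eq_right (by simp), hh0, sub_zero, hgh]
  rw [smul_eq_mul, mul_one, h3, smul_eq_mul] at h2
  rw [h2, mul_comm]

/-- Differentiable collision invariants are combinations of mass, momentum and energy. -/
theorem IsCollisionInvariant.exists_eq [CompleteSpace E] (hE : 2 ≤ Module.finrank ℝ E)
    {ψ : E → ℝ} (h : IsCollisionInvariant ψ) (hd : Differentiable ℝ ψ) :
    ∃ (α : ℝ) (β : E) (γ : ℝ), ∀ v, ψ v = α + inner ℝ β v + γ * ‖v‖ ^ 2 := by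
  have hodd := eq_fderiv_of_odd_of_orthogonallyAdditive hE (g := fun x => (ψ x - ψ (-x)) / 2)
    (by
      intro x y hxy
      have h1 := h.add_of_inner_eq_zero hxy
      have h2 := h.add_of_inner_eq_zero (x := -x) (y := -y) (by simpa using hxy)
      rw [← neg_add] at h2
      linarith)
    (by intro x; simp only [neg_neg]; ring) (by fun_prop)
  obtain ⟨γ, hγ⟩ := eq_mul_norm_sq_of_even_of_orthogonallyAdditive hE
    (g := fun x => (ψ x + ψ (-x)) / 2 - ψ 0)
    (by
      intro x y hxy
      have h1 := h.add_of_inner_eq_zero hxy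
      have h2 := h.add_of_inner_eq_zero (x := -x) (y := -y) (by simpa using hxy)
      rw [← neg_add] at h2
      linarith)
    (by intro x; simp only [neg_neg]; ring) (by have := hd.continuous; fun_prop)
  refine ⟨ψ 0, (InnerProductSpace.toDual ℝ E).symm
    (fderiv ℝ (fun x => (ψ x - ψ (-x)) / 2) 0), γ, fun v => ?_⟩
  rw [InnerProductSpace.toDual_symm_apply, ← hγ v, ← hodd v]
  ring

end CollisionInvariants

/-! ### The surface measure of the processes `a ↔ b + c`, in two parametrizations -/

section Exchange

open Set Filter Topology Metric
open scoped ENNReal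

variable {E : Type*} [NormedAddCommGroup E] [InnerProductSpace ℝ E] [FiniteDimensional ℝ E]
  [MeasurableSpace E] [BorelSpace E]
  {H : Type*} [NormedAddCommGroup H] [InnerProductSpace ℝ H] [FiniteDimensional ℝ H]
  [MeasurableSpace H] [BorelSpace H]

theorem lintegral_eq_lintegral_polar [Nontrivial E] {f : E → ℝ≥0∞} (hf : Measurable f) :
    ∫⁻ x, f x = ∫⁻ r in Ioi (0 : ℝ), ENNReal.ofReal (r ^ (Module.finrank ℝ E - 1)) *
      ∫⁻ n : sphere (0 : E) 1, f (r • (n : E)) ∂((volume : Measure E).toSphere) := by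
  have hm := (volume : Measure E).measurePreserving_homeomorphUnitSphereProd
  have h1 : ∫⁻ x, f x = ∫⁻ x : ({(0 : E)}ᶜ : Set E), f (x : E)
      ∂(Measure.comap Subtype.val (volume : Measure E)) := by
    rw [lintegral_subtype_comap (measurableSet_singleton _).compl, restrict_compl_singleton]
  have h2 : ∫⁻ x : ({(0 : E)}ᶜ : Set E), f (x : E)
      ∂(Measure.comap Subtype.val (volume : Measure E))
      = ∫⁻ p : sphere (0 : E) 1 × Ioi (0 : ℝ), f ((p.2 : ℝ) • (p.1 : E))
        ∂((volume : Measure E).toSphere.prod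
          (Measure.volumeIoiPow (Module.finrank ℝ E - 1))) := by
    rw [← hm.lintegral_comp_emb (Homeomorph.measurableEmbedding _)]
    refine lintegral_congr fun x => ?_
    congr 1
    have hx : ‖(x : E)‖ ≠ 0 := norm_ne_zero_iff.2 x.2
    simp [smul_inv_smul₀ hx]
  have hmeas : Measurable fun p : ℝ × sphere (0 : E) 1 => f (p.1 • (p.2 : E)) :=
    hf.comp (by fun_prop)
  rw [h1, h2, lintegral_prod_symm' _ (by exact hmeas.comp (by fun_prop :
      Measurable fun p : sphere (0 : E) 1 × Ioi (0 : ℝ) => ((p.2 : ℝ), p.1))),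
    Measure.volumeIoiPow, lintegral_withDensity_eq_lintegral_mul _ (by fun_prop)
      (by exact (hmeas.lintegral_prod_right').comp measurable_subtype_coe)]
  simp only [Pi.mul_apply]
  exact lintegral_subtype_comap measurableSet_Ioi
    (fun r : ℝ => ENNReal.ofReal (r ^ (Module.finrank ℝ E - 1)) *
      ∫⁻ n : sphere (0 : E) 1, f (r • (n : E)) ∂((volume : Measure E).toSphere))

/-- Half of the relative speed `‖b - c‖` of a pair with `b + c = w` and `2 ⟪b, c⟫ = s`. -/
def splitRadius (s : ℝ) (w : E) : ℝ := Real.sqrt (‖w‖ ^ 2 / 4 - s / 2)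

open Classical in
/-- The density `r ^ (d - 1) / (4 r)` of the surface `b + c = w`, `2 ⟪b, c⟫ = s` relative to
the unit sphere. -/
def splitWeight (s : ℝ) (w : E) : ℝ :=
  if 2 * s < ‖w‖ ^ 2 then
    splitRadius s w ^ (Module.finrank ℝ E - 1) / (4 * splitRadius s w) else 0

/-- The pair `(b, c)` with sum `w` and `b - c` in the direction `n`. -/
def splitMap (s : ℝ) (p : E × sphere (0 : E) 1) : E × E :=
  ((1 / 2 : ℝ) • p.1 + splitRadius s p.1 • (p.2 : E),
    (1 / 2 : ℝ) • p.1 - splitRadius s p.1 • (p.2 : E))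

/-- The measure `δ(2 ⟪b, c⟫ - s) db dc`, parametrized by the sum of `b` and `c` and the direction of
their difference. -/
def splitMeasure (s : ℝ) : Measure (E × E) :=
  (((volume : Measure E).prod (volume : Measure E).toSphere).withDensity
    (fun p => ENNReal.ofReal (splitWeight s p.1))).map (splitMap s)

/-- The hyperplane `L (0 × H)` rotated to the orthogonal complement of `w`, by the reflection that
takes the unit vector `L (1, 0)` to `w / ‖w‖`; unlike a basis of the complement chosen for each `w`
it depends measurably on `w`. -/
def tilt (L : WithLp 2 (ℝ × H) ≃ₗᵢ[ℝ] E) (w : E) (x : E) : E :=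
  x - (2 * inner ℝ (L (WithLp.toLp 2 (1, 0)) - ‖w‖⁻¹ • w) x /
    ‖L (WithLp.toLp 2 (1, 0)) - ‖w‖⁻¹ • w‖ ^ 2) • (L (WithLp.toLp 2 (1, 0)) - ‖w‖⁻¹ • w)

/-- The pair `(b, c)` with `2 ⟪b, c⟫ = s` whose component of `c` orthogonal to `b` is
parametrized by `H`. -/
def mergeMap (L : WithLp 2 (ℝ × H) ≃ₗᵢ[ℝ] E) (s : ℝ) (p : E × H) : E × E :=
  (p.1, (s / (2 * ‖p.1‖ ^ 2)) • p.1 + tilt L p.1 (L (WithLp.toLp 2 (0, p.2))))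

/-- The measure `δ(2 ⟪b, c⟫ - s) db dc`, parametrized by `b` and the component of `c` orthogonal
to `b`. -/
def mergeMeasure (L : WithLp 2 (ℝ × H) ≃ₗᵢ[ℝ] E) (s : ℝ) : Measure (E × E) :=
  (((volume : Measure E).prod (volume : Measure H)).withDensity
    (fun p => ENNReal.ofReal (1 / (2 * ‖p.1‖)))).map (mergeMap L s)

theorem tilt_eq_reflection (L : WithLp 2 (ℝ × H) ≃ₗᵢ[ℝ] E) (w x : E) :
    tilt L w x = (Submodule.span ℝ {L (WithLp.toLp 2 (1, 0)) - ‖w‖⁻¹ • w})ᗮ.reflection x := by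
  rw [Submodule.reflection_orthogonal_apply, Submodule.reflection_singleton_apply, tilt, neg_sub]
  congr 1
  rw [two_smul, ← add_smul]
  congr 1
  simp only [RCLike.ofReal_real_eq_id, id]
  ring

theorem norm_axis (L : WithLp 2 (ℝ × H) ≃ₗᵢ[ℝ] E) : ‖L (WithLp.toLp 2 (1, 0))‖ = 1 := by
  rw [L.norm_map, WithLp.prod_norm_eq_of_L2]; simp

theorem tilt_axis (L : WithLp 2 (ℝ × H) ≃ₗᵢ[ℝ] E) {w : E} (hw : w ≠ 0) :
    tilt L w (L (WithLp.toLp 2 (1, 0))) = ‖w‖⁻¹ • w := by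
  rw [tilt_eq_reflection, Submodule.reflection_sub]
  rw [norm_axis, norm_smul, norm_inv, norm_norm, inv_mul_cancel₀ (norm_ne_zero_iff.2 hw)]

theorem inner_tilt (L : WithLp 2 (ℝ × H) ≃ₗᵢ[ℝ] E) (w : E) (z : H) :
    inner ℝ w (tilt L w (L (WithLp.toLp 2 (0, z)))) = 0 := by
  rcases eq_or_ne w 0 with rfl | hw
  · simp
  have h1 : w = ‖w‖ • tilt L w (L (WithLp.toLp 2 (1, 0))) := by
    rw [tilt_axis L hw, smul_inv_smul₀ (norm_ne_zero_iff.2 hw)]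
  nth_rewrite 1 [h1]
  rw [inner_smul_left, tilt_eq_reflection, tilt_eq_reflection, LinearIsometryEquiv.inner_map_map,
    LinearIsometryEquiv.inner_map_map]
  simp [WithLp.prod_inner_apply]

theorem norm_tilt (L : WithLp 2 (ℝ × H) ≃ₗᵢ[ℝ] E) (w x : E) : ‖tilt L w x‖ = ‖x‖ := by
  rw [tilt_eq_reflection, LinearIsometryEquiv.norm_map]

theorem tilt_add (L : WithLp 2 (ℝ × H) ≃ₗᵢ[ℝ] E) (w x y : E) :
    tilt L w (x + y) = tilt L w x + tilt L w y := by
  simp_rw [tilt_eq_reflection, map_add]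

theorem measurable_tilt (L : WithLp 2 (ℝ × H) ≃ₗᵢ[ℝ] E) :
    Measurable fun p : E × E => tilt L p.1 p.2 := by
  unfold tilt
  fun_prop

theorem measurable_hyperplane (L : WithLp 2 (ℝ × H) ≃ₗᵢ[ℝ] E) :
    Measurable fun z : H => L (WithLp.toLp 2 (0, z)) := by
  apply Continuous.measurable
  exact L.continuous.comp ((WithLp.prod_continuous_toLp 2 ℝ H).comp (by fun_prop))

theorem measurable_splitRadius :
    Measurable fun p : ℝ × E => splitRadius p.1 p.2 := by
  unfold splitRadius; fun_prop

theorem measurable_splitWeight :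
    Measurable fun p : ℝ × E => splitWeight p.1 p.2 := by
  unfold splitWeight
  have := measurable_splitRadius (E := E)
  refine Measurable.ite (measurableSet_lt (by fun_prop) (by fun_prop)) ?_ measurable_const
  exact (this.pow_const _).div (this.const_mul _)

theorem measurable_splitMap :
    Measurable fun p : ℝ × (E × sphere (0 : E) 1) => splitMap p.1 p.2 := by
  unfold splitMap splitRadius
  fun_prop

theorem measurable_mergeMap (L : WithLp 2 (ℝ × H) ≃ₗᵢ[ℝ] E) :
    Measurable fun p : ℝ × (E × H) => mergeMap L p.1 p.2 := by
  unfold mergeMap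
  have h1 := (measurable_tilt L).comp (Measurable.prodMk
    (by fun_prop : Measurable fun p : ℝ × (E × H) => p.2.1)
    ((measurable_hyperplane L).comp (by fun_prop : Measurable fun p : ℝ × (E × H) => p.2.2)))
  refine Measurable.prodMk (by fun_prop) (Measurable.add (by fun_prop) h1)

theorem lintegral_splitMeasure (s : ℝ) {F : E × E → ℝ≥0∞} (hF : Measurable F) :
    ∫⁻ p, F p ∂(splitMeasure s) = ∫⁻ w : E, ∫⁻ n : sphere (0 : E) 1,
      ENNReal.ofReal (splitWeight s w) * F (splitMap s (w, n))
        ∂((volume : Measure E).toSphere) := by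
  have h1 : Measurable (splitMap s : E × sphere (0 : E) 1 → E × E) :=
    measurable_splitMap.comp measurable_prodMk_left
  have h2 : Measurable (splitWeight s : E → ℝ) :=
    measurable_splitWeight.comp measurable_prodMk_left
  have h3 : Measurable fun p : E × sphere (0 : E) 1 => ENNReal.ofReal (splitWeight s p.1) := by
    fun_prop
  rw [splitMeasure, lintegral_map hF h1,
    lintegral_withDensity_eq_lintegral_mul _ h3 (by exact hF.comp h1)]
  exact lintegral_prod _ (h3.mul (hF.comp h1)).aemeasurable

theorem lintegral_mergeMeasure (L : WithLp 2 (ℝ × H) ≃ₗᵢ[ℝ] E) (s : ℝ) {F : E × E → ℝ≥0∞}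
    (hF : Measurable F) :
    ∫⁻ p, F p ∂(mergeMeasure L s) = ∫⁻ b : E, ∫⁻ z : H,
      ENNReal.ofReal (1 / (2 * ‖b‖)) * F (mergeMap L s (b, z)) := by
  have h1 : Measurable (mergeMap L s) :=
    (measurable_mergeMap L).comp measurable_prodMk_left
  have h3 : Measurable fun p : E × H => ENNReal.ofReal (1 / (2 * ‖p.1‖)) := by
    fun_prop
  rw [mergeMeasure, lintegral_map hF h1,
    lintegral_withDensity_eq_lintegral_mul _ h3 (by exact hF.comp h1)]
  exact lintegral_prod _ (h3.mul (hF.comp h1)).aemeasurable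

theorem inner_splitMap {s : ℝ} {w : E} (h : 2 * s < ‖w‖ ^ 2) (n : sphere (0 : E) 1) :
    2 * inner ℝ (splitMap s (w, n)).1 (splitMap s (w, n)).2 = s := by
  have hr : splitRadius s w ^ 2 = ‖w‖ ^ 2 / 4 - s / 2 := Real.sq_sqrt (by linarith)
  have hn : ‖(n : E)‖ = 1 := mem_sphere_zero_iff_norm.1 n.2
  simp only [splitMap]
  rw [inner_add_left, inner_sub_right, inner_sub_right, real_inner_self_eq_norm_sq,
    real_inner_self_eq_norm_sq, norm_smul, norm_smul, hn, mul_one, mul_pow,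
    Real.norm_eq_abs (splitRadius s w), sq_abs, hr]
  rw [real_inner_comm (splitRadius s w • (n : E))]
  norm_num
  linarith

theorem inner_mergeMap (L : WithLp 2 (ℝ × H) ≃ₗᵢ[ℝ] E) (s : ℝ) {b : E} (hb : b ≠ 0) (z : H) :
    2 * inner ℝ (mergeMap L s (b, z)).1 (mergeMap L s (b, z)).2 = s := by
  have : ‖b‖ ≠ 0 := norm_ne_zero_iff.2 hb
  simp only [mergeMap]
  rw [inner_add_right, inner_tilt, inner_smul_right, real_inner_self_eq_norm_sq]
  field_simp
  ring

theorem splitRadius_pos {s : ℝ} {w : E} (h : 2 * s < ‖w‖ ^ 2) : 0 < splitRadius s w :=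
  Real.sqrt_pos.2 (by linarith)

/-- For a fixed sum `w` the level sets of `2 ⟪b, c⟫ = ‖w‖² / 2 - 2 r²` are spheres of radius `r`. -/
theorem lintegral_lintegral_splitMap [Nontrivial E] {F : E × E → ℝ≥0∞} (hF : Measurable F)
    (w : E) :
    ∫⁻ s : ℝ, ∫⁻ n : sphere (0 : E) 1, ENNReal.ofReal (splitWeight s w) * F (splitMap s (w, n))
        ∂((volume : Measure E).toSphere) =
      ∫⁻ d : E, F ((1 / 2 : ℝ) • w + d, (1 / 2 : ℝ) • w - d) := by
  have hFd : Measurable fun d : E => F ((1 / 2 : ℝ) • w + d, (1 / 2 : ℝ) • w - d) :=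
    hF.comp (by fun_prop)
  rw [lintegral_eq_lintegral_polar hFd]
  set K : ℝ → ℝ≥0∞ := fun r => ∫⁻ n : sphere (0 : E) 1,
    F ((1 / 2 : ℝ) • w + r • (n : E), (1 / 2 : ℝ) • w - r • (n : E))
      ∂((volume : Measure E).toSphere) with hK
  set D := Module.finrank ℝ E - 1
  set G : ℝ → ℝ≥0∞ := fun s => ENNReal.ofReal (splitRadius s w ^ D / (4 * splitRadius s w)) *
    K (splitRadius s w) with hG
  have h1 : ∀ s : ℝ, (∫⁻ n : sphere (0 : E) 1,
      ENNReal.ofReal (splitWeight s w) * F (splitMap s (w, n)) ∂((volume : Measure E).toSphere))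
      = (Iio (‖w‖ ^ 2 / 2)).indicator G s := by
    intro s
    have hm : Measurable fun n : sphere (0 : E) 1 => F (splitMap s (w, n)) :=
      hF.comp (measurable_splitMap.comp (by fun_prop :
        Measurable fun n : sphere (0 : E) 1 => (s, (w, n))))
    rw [lintegral_const_mul _ hm]
    by_cases h : 2 * s < ‖w‖ ^ 2
    · rw [indicator_of_mem (by simp only [mem_Iio]; linarith), splitWeight, if_pos h]
      rfl
    · rw [indicator_of_notMem (by simp only [mem_Iio]; linarith), splitWeight, if_neg h]
      simp
  simp_rw [h1]
  rw [lintegral_indicator measurableSet_Iio]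
  have himg : Iio (‖w‖ ^ 2 / 2) = (fun r : ℝ => ‖w‖ ^ 2 / 2 - 2 * r ^ 2) '' Ioi 0 := by
    ext s
    simp only [mem_Iio, mem_image, mem_Ioi]
    constructor
    · intro hs
      refine ⟨splitRadius s w, splitRadius_pos (by linarith), ?_⟩
      rw [splitRadius, Real.sq_sqrt (by linarith)]
      ring
    · rintro ⟨r, hr, rfl⟩
      have := pow_pos hr 2
      linarith
  rw [himg, lintegral_image_eq_lintegral_abs_deriv_mul measurableSet_Ioi (f' := fun r => -(4 * r))]
  · refine setLIntegral_congr_fun measurableSet_Ioi fun r hr => ?_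
    have hr : 0 < r := hr
    have hrad : splitRadius (‖w‖ ^ 2 / 2 - 2 * r ^ 2) w = r := by
      rw [splitRadius, show ‖w‖ ^ 2 / 4 - (‖w‖ ^ 2 / 2 - 2 * r ^ 2) / 2 = r ^ 2 by ring,
        Real.sqrt_sq hr.le]
    simp only [hG, hrad]
    rw [← mul_assoc, ← ENNReal.ofReal_mul (abs_nonneg _), abs_neg, abs_of_pos (by positivity)]
    congr 2
    field_simp
  · intro r _
    have := ((hasDerivAt_pow 2 r).const_mul 2).const_sub (‖w‖ ^ 2 / 2)
    refine (this.congr_deriv ?_).hasDerivWithinAt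
    simp; ring
  · intro r hr r' hr' h
    have : r ^ 2 = r' ^ 2 := by simp only at h; linarith
    exact (pow_left_inj₀ (le_of_lt hr) (le_of_lt hr') two_ne_zero).1 this

/-- The split measures disintegrate the Lebesgue measure. -/
theorem lintegral_lintegral_splitMeasure [Nontrivial E] {F : E × E → ℝ≥0∞} (hF : Measurable F) :
    ∫⁻ s : ℝ, ∫⁻ p, F p ∂(splitMeasure s) = ∫⁻ b : E, ∫⁻ c : E, F (b, c) := by
  have hm : Measurable fun q : ℝ × E × sphere (0 : E) 1 =>
      ENNReal.ofReal (splitWeight q.1 q.2.1) * F (splitMap q.1 q.2) := by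
    refine Measurable.mul ?_ (hF.comp measurable_splitMap)
    exact (measurable_splitWeight.comp (by fun_prop :
      Measurable fun q : ℝ × E × sphere (0 : E) 1 => (q.1, q.2.1))).ennreal_ofReal
  have hm2 : Measurable fun q : ℝ × E => ∫⁻ n : sphere (0 : E) 1,
      ENNReal.ofReal (splitWeight q.1 q.2) * F (splitMap q.1 (q.2, n))
        ∂((volume : Measure E).toSphere) := by
    refine Measurable.lintegral_prod_right' (f := fun q : (ℝ × E) × sphere (0 : E) 1 =>
      ENNReal.ofReal (splitWeight q.1.1 q.1.2) * F (splitMap q.1.1 (q.1.2, q.2))) ?_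
    exact hm.comp (by fun_prop :
      Measurable fun q : (ℝ × E) × sphere (0 : E) 1 => (q.1.1, q.1.2, q.2))
  simp_rw [lintegral_splitMeasure _ hF]
  rw [lintegral_lintegral_swap hm2.aemeasurable]
  simp_rw [lintegral_lintegral_splitMap hF]
  have h1 : ∀ w : E, ∫⁻ d : E, F ((1 / 2 : ℝ) • w + d, (1 / 2 : ℝ) • w - d)
      = ∫⁻ b : E, F (b, w - b) := by
    intro w
    refine Eq.trans ?_ (lintegral_add_left_eq_self (fun b => F (b, w - b)) ((1 / 2 : ℝ) • w))
    refine lintegral_congr fun d => ?_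
    congr 2
    module
  simp_rw [h1]
  rw [lintegral_lintegral_swap
    (by exact (hF.comp (by fun_prop : Measurable fun p : E × E => (p.2, p.1 - p.2))).aemeasurable)]
  refine lintegral_congr fun b => ?_
  exact lintegral_sub_right_eq_self (fun c => F (b, c)) b

theorem measurePreserving_tilt (L : WithLp 2 (ℝ × H) ≃ₗᵢ[ℝ] E) (b : E) :
    MeasurePreserving (fun p : ℝ × H => tilt L b (L (WithLp.toLp 2 p)))
      ((volume : Measure ℝ).prod (volume : Measure H)) volume := by
  have h1 : MeasurePreserving (tilt L b) := by
    have := (Submodule.span ℝ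
      {L (WithLp.toLp 2 (1, 0)) - ‖b‖⁻¹ • b})ᗮ.reflection.measurePreserving
    convert this using 1
    ext1 x
    exact tilt_eq_reflection L b x
  exact h1.comp (L.measurePreserving.comp (WithLp.volume_preserving_toLp ℝ H))

/-- The level `s` enters `c` only through the coordinate `s / (2 ‖b‖)` along `b`, which gives the
Jacobian `1 / (2 ‖b‖)` of the disintegration. -/
theorem mergeMap_snd (L : WithLp 2 (ℝ × H) ≃ₗᵢ[ℝ] E) (s : ℝ) {b : E} (hb : b ≠ 0) (z : H) :
    (mergeMap L s (b, z)).2 = tilt L b (L (WithLp.toLp 2 (s * (1 / (2 * ‖b‖)), z))) := by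
  have hb' : ‖b‖ ≠ 0 := norm_ne_zero_iff.2 hb
  have h1 : WithLp.toLp 2 (s * (1 / (2 * ‖b‖)), z)
      = (s * (1 / (2 * ‖b‖))) • WithLp.toLp 2 ((1 : ℝ), (0 : H)) + WithLp.toLp 2 ((0 : ℝ), z) := by
    rw [← WithLp.toLp_smul, ← WithLp.toLp_add]
    simp
  have h2 : tilt L b ((s * (1 / (2 * ‖b‖))) • L (WithLp.toLp 2 (1, 0)))
      = (s * (1 / (2 * ‖b‖))) • tilt L b (L (WithLp.toLp 2 (1, 0))) := by
    simp_rw [tilt_eq_reflection, map_smul]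
  rw [h1, map_add, map_smul, tilt_add, h2, tilt_axis L hb, smul_smul, mergeMap]
  field_simp

/-- The merge measures disintegrate the Lebesgue measure. -/
theorem lintegral_lintegral_mergeMeasure [Nontrivial E] (L : WithLp 2 (ℝ × H) ≃ₗᵢ[ℝ] E)
    {F : E × E → ℝ≥0∞} (hF : Measurable F) :
    ∫⁻ s : ℝ, ∫⁻ p, F p ∂(mergeMeasure L s) = ∫⁻ b : E, ∫⁻ c : E, F (b, c) := by
  have hm2 : Measurable fun q : ℝ × E => ∫⁻ z : H,
      ENNReal.ofReal (1 / (2 * ‖q.2‖)) * F (mergeMap L q.1 (q.2, z)) := by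
    refine Measurable.lintegral_prod_right' (f := fun q : (ℝ × E) × H =>
      ENNReal.ofReal (1 / (2 * ‖q.1.2‖)) * F (mergeMap L q.1.1 (q.1.2, q.2))) ?_
    refine Measurable.mul (by fun_prop) (hF.comp ((measurable_mergeMap L).comp (by fun_prop :
      Measurable fun q : (ℝ × E) × H => (q.1.1, q.1.2, q.2))))
  simp_rw [lintegral_mergeMeasure _ _ hF]
  rw [lintegral_lintegral_swap hm2.aemeasurable]
  refine lintegral_congr_ae ?_
  have h0 : ∀ᵐ b : E, b ≠ 0 := by
    simp [ae_iff]
  filter_upwards [h0] with b hb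
  have hb' : 0 < ‖b‖ := norm_pos_iff.2 hb
  have hFb : Measurable fun c => F (b, c) := hF.comp measurable_prodMk_left
  have hmp := measurePreserving_tilt L b
  rw [← hmp.lintegral_comp hFb, lintegral_prod _ (by exact (hFb.comp hmp.measurable).aemeasurable)]
  set M : ℝ → ℝ≥0∞ := fun t => ∫⁻ z : H, F (b, tilt L b (L (WithLp.toLp 2 (t, z)))) with hM
  have hMm : Measurable M :=
    Measurable.lintegral_prod_right' (f := fun q : ℝ × H => F (b, tilt L b (L (WithLp.toLp 2 q))))
      (hFb.comp hmp.measurable)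
  have h1 : ∀ s : ℝ, (∫⁻ z : H, ENNReal.ofReal (1 / (2 * ‖b‖)) * F (mergeMap L s (b, z)))
      = ENNReal.ofReal (1 / (2 * ‖b‖)) * M (s * (1 / (2 * ‖b‖))) := by
    intro s
    rw [lintegral_const_mul _ (by exact hF.comp ((measurable_mergeMap L).comp (by fun_prop :
      Measurable fun z : H => (s, (b, z)))))]
    congr 1
    refine lintegral_congr fun z => ?_
    rw [← mergeMap_snd L s hb]
    rfl
  simp_rw [h1]
  have hpos : 0 < 1 / (2 * ‖b‖) := by positivity
  rw [lintegral_const_mul _ (by fun_prop),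
    ← lintegral_map hMm (by fun_prop : Measurable fun s : ℝ => s * (1 / (2 * ‖b‖))),
    Real.map_volume_mul_right hpos.ne', lintegral_smul_measure, smul_eq_mul, ← mul_assoc,
    ← ENNReal.ofReal_mul hpos.le, abs_of_pos (inv_pos.2 hpos), mul_inv_cancel₀ hpos.ne']
  simp

/-- Multiplying the integrand by a function of `2 ⟪b, c⟫` localizes the disintegrations, so the two
families of integrals agree at almost every level. -/
theorem lintegral_splitMeasure_ae_eq [Nontrivial E] (L : WithLp 2 (ℝ × H) ≃ₗᵢ[ℝ] E)
    {F : E × E → ℝ≥0∞} (hF : Measurable F) :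
    ∀ᵐ s : ℝ, ∫⁻ p, F p ∂(splitMeasure s) = ∫⁻ p, F p ∂(mergeMeasure L s) := by
  have hS : Measurable fun s : ℝ => ∫⁻ p, F p ∂(splitMeasure (E := E) s) := by
    simp_rw [lintegral_splitMeasure _ hF]
    have hm : Measurable fun q : (ℝ × E) × sphere (0 : E) 1 =>
        ENNReal.ofReal (splitWeight q.1.1 q.1.2) * F (splitMap q.1.1 (q.1.2, q.2)) :=
      ((measurable_splitWeight.comp measurable_fst).ennreal_ofReal).mul
        (hF.comp (measurable_splitMap.comp (by fun_prop :
          Measurable fun q : (ℝ × E) × sphere (0 : E) 1 => (q.1.1, q.1.2, q.2))))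
    exact hm.lintegral_prod_right'.lintegral_prod_right'
  have hM : Measurable fun s : ℝ => ∫⁻ p, F p ∂(mergeMeasure L s) := by
    simp_rw [lintegral_mergeMeasure _ _ hF]
    have hm : Measurable fun q : (ℝ × E) × H =>
        ENNReal.ofReal (1 / (2 * ‖q.1.2‖)) * F (mergeMap L q.1.1 (q.1.2, q.2)) :=
      Measurable.mul (by fun_prop) (hF.comp ((measurable_mergeMap L).comp (by fun_prop :
        Measurable fun q : (ℝ × E) × H => (q.1.1, q.1.2, q.2))))
    exact hm.lintegral_prod_right'.lintegral_prod_right'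
  refine ae_eq_of_forall_setLIntegral_eq_of_sigmaFinite hS hM fun A hA _ => ?_
  set FA : E × E → ℝ≥0∞ := fun p => A.indicator 1 (2 * inner ℝ p.1 p.2 : ℝ) * F p with hFA
  have hFAm : Measurable FA :=
    ((measurable_one.indicator hA).comp (by fun_prop)).mul hF
  rw [← lintegral_indicator hA, ← lintegral_indicator hA]
  have h0 : ∀ᵐ b : E, b ≠ 0 := by
    simp [ae_iff]
  have e1 : ∀ s : ℝ, A.indicator (fun s => ∫⁻ p, F p ∂(splitMeasure (E := E) s)) s
      = ∫⁻ p, FA p ∂(splitMeasure (E := E) s) := by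
    intro s
    have : A.indicator (fun s => ∫⁻ p, F p ∂(splitMeasure (E := E) s)) s
        = A.indicator 1 s * ∫⁻ p, F p ∂(splitMeasure (E := E) s) := by
      by_cases h : s ∈ A <;> simp [h]
    rw [this, ← lintegral_const_mul _ hF, lintegral_splitMeasure _ (hF.const_mul _),
      lintegral_splitMeasure _ hFAm]
    refine lintegral_congr fun w => lintegral_congr fun n => ?_
    by_cases h : 2 * s < ‖w‖ ^ 2
    · simp only [hFA, inner_splitMap h]
    · simp [splitWeight, h]
  have e2 : ∀ s : ℝ, A.indicator (fun s => ∫⁻ p, F p ∂(mergeMeasure L s)) s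
      = ∫⁻ p, FA p ∂(mergeMeasure L s) := by
    intro s
    have : A.indicator (fun s => ∫⁻ p, F p ∂(mergeMeasure L s)) s
        = A.indicator 1 s * ∫⁻ p, F p ∂(mergeMeasure L s) := by
      by_cases h : s ∈ A <;> simp [h]
    rw [this, ← lintegral_const_mul _ hF, lintegral_mergeMeasure _ _ (hF.const_mul _),
      lintegral_mergeMeasure _ _ hFAm]
    refine lintegral_congr fun b => lintegral_congr fun z => ?_
    rcases eq_or_ne b 0 with rfl | h
    · simp
    · simp only [hFA, inner_mergeMap L s h]
  simp_rw [e1, e2]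
  rw [lintegral_lintegral_splitMeasure hFAm, lintegral_lintegral_mergeMeasure L hFAm]

theorem splitWeight_nonneg (s : ℝ) (w : E) : 0 ≤ splitWeight s w := by
  rw [splitWeight]
  split_ifs with h
  · have := splitRadius_pos h
    positivity
  · exact le_rfl

theorem norm_le_of_splitMap_mem {R s : ℝ} {w : E} {n : sphere (0 : E) 1}
    (h : splitMap s (w, n) ∈ closedBall (0 : E × E) R) : ‖w‖ ≤ 2 * R := by
  rw [mem_closedBall_zero_iff, norm_prod_le_iff] at h
  have h1 : w = (splitMap s (w, n)).1 + (splitMap s (w, n)).2 := by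
    simp only [splitMap]; module
  rw [h1]
  exact (norm_add_le _ _).trans (by linarith [h.1, h.2])

theorem splitWeight_le_of_splitMap_mem (hE : 2 ≤ Module.finrank ℝ E) {R s : ℝ} {w : E}
    {n : sphere (0 : E) 1} (h : splitMap s (w, n) ∈ closedBall (0 : E × E) R) :
    splitWeight s w ≤ R ^ (Module.finrank ℝ E - 2) / 4 := by
  rw [mem_closedBall_zero_iff, norm_prod_le_iff] at h
  have hR : 0 ≤ R := (norm_nonneg _).trans h.1
  rw [splitWeight]
  split_ifs with hs
  · have hr := splitRadius_pos hs
    have hn : ‖(n : E)‖ = 1 := mem_sphere_zero_iff_norm.1 n.2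
    have h1 : (2 * splitRadius s w) • (n : E) = (splitMap s (w, n)).1 - (splitMap s (w, n)).2 := by
      simp only [splitMap]; module
    have h2 : 2 * splitRadius s w ≤ 2 * R := by
      calc 2 * splitRadius s w = ‖(2 * splitRadius s w) • (n : E)‖ := by
            rw [norm_smul, hn, mul_one, Real.norm_of_nonneg (by positivity)]
        _ ≤ 2 * R := by
            rw [h1]
            exact (norm_sub_le _ _).trans (by linarith [h.1, h.2])
    have h3 : splitRadius s w ^ (Module.finrank ℝ E - 1) / (4 * splitRadius s w)
        = splitRadius s w ^ (Module.finrank ℝ E - 2) / 4 := by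
      rw [show Module.finrank ℝ E - 1 = Module.finrank ℝ E - 2 + 1 by omega, pow_succ]
      field_simp
    rw [h3]
    have := pow_le_pow_left₀ hr.le (by linarith : splitRadius s w ≤ R) (Module.finrank ℝ E - 2)
    linarith
  · positivity

theorem mem_of_mergeMap_mem (L : WithLp 2 (ℝ × H) ≃ₗᵢ[ℝ] E) {R s : ℝ} {b : E} {z : H}
    (h : mergeMap L s (b, z) ∈ closedBall (0 : E × E) R) :
    b ∈ closedBall (0 : E) R ∧ z ∈ closedBall (0 : H) R := by
  rw [mem_closedBall_zero_iff, norm_prod_le_iff] at h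
  refine ⟨mem_closedBall_zero_iff.2 h.1, mem_closedBall_zero_iff.2 (le_trans ?_ h.2)⟩
  have h1 : ‖tilt L b (L (WithLp.toLp 2 (0, z)))‖ = ‖z‖ := by
    rw [norm_tilt, L.norm_map, WithLp.prod_norm_eq_of_L2]; simp
  have h2 := norm_add_sq_real ((s / (2 * ‖b‖ ^ 2)) • b) (tilt L b (L (WithLp.toLp 2 (0, z))))
  rw [inner_smul_left, inner_tilt, h1] at h2
  simp only [mergeMap]
  refine le_of_sq_le_sq ?_ (norm_nonneg _)
  rw [h2]
  have := sq_nonneg ‖(s / (2 * ‖b‖ ^ 2)) • b‖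
  simp only [mul_zero, add_zero]
  linarith

theorem integrable_inv_norm_indicator (hE : 2 ≤ Module.finrank ℝ E) (R : ℝ) :
    Integrable ((closedBall (0 : E) R).indicator fun b => 1 / (2 * ‖b‖)) := by
  have : Nontrivial E := Module.nontrivial_of_finrank_pos (R := ℝ) (by omega)
  rw [integrable_indicator_iff measurableSet_closedBall]
  refine IntegrableOn.mono_set ?_ (closedBall_subset_ball (lt_add_one R))
  refine (integrableOn_fun_norm_addHaar (volume : Measure E) (f := fun y => 1 / (2 * y))).2 ?_
  have h1 : IntegrableOn (fun y : ℝ => y ^ (Module.finrank ℝ E - 2) / 2) (Ioo 0 (R + 1)) :=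
    (Continuous.integrableOn_Icc (by fun_prop)).mono_set Ioo_subset_Icc_self
  refine h1.congr_fun (fun y hy => ?_) measurableSet_Ioo
  have hy0 : y ≠ 0 := hy.1.ne'
  simp only [smul_eq_mul]
  rw [show Module.finrank ℝ E - 1 = Module.finrank ℝ E - 2 + 1 by omega, pow_succ]
  field_simp

theorem integrable_splitBound (R : ℝ) (C : ℝ) :
    Integrable (((closedBall (0 : E) (2 * R)) ×ˢ (univ : Set (sphere (0 : E) 1))).indicator
      fun _ => C) ((volume : Measure E).prod (volume : Measure E).toSphere) := by
  rw [integrable_indicator_iff (measurableSet_closedBall.prod .univ)]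
  refine integrableOn_const ?_
  rw [Measure.prod_prod]
  exact (ENNReal.mul_lt_top measure_closedBall_lt_top (measure_lt_top _ _)).ne

theorem integrable_mergeBound (hE : 2 ≤ Module.finrank ℝ E) (R : ℝ) :
    Integrable (fun p : E × H => (closedBall (0 : E) R).indicator (fun b => 1 / (2 * ‖b‖)) p.1 *
      (closedBall (0 : H) R).indicator (fun _ => (1 : ℝ)) p.2)
      ((volume : Measure E).prod (volume : Measure H)) := by
  refine Integrable.mul_prod (integrable_inv_norm_indicator hE R) ?_
  rw [integrable_indicator_iff measurableSet_closedBall]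
  exact integrableOn_const measure_closedBall_lt_top.ne

theorem integral_splitMeasure (s : ℝ) {F : E × E → ℝ} (hF : Measurable F) :
    ∫ p, F p ∂(splitMeasure s) = ∫ p : E × sphere (0 : E) 1, splitWeight s p.1 * F (splitMap s p)
      ∂((volume : Measure E).prod (volume : Measure E).toSphere) := by
  have h1 : Measurable (splitMap s : E × sphere (0 : E) 1 → E × E) :=
    measurable_splitMap.comp measurable_prodMk_left
  have h2 : Measurable (splitWeight s : E → ℝ) :=
    measurable_splitWeight.comp measurable_prodMk_left
  rw [splitMeasure, integral_map h1.aemeasurable hF.aestronglyMeasurable,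
    integral_withDensity_eq_integral_toReal_smul (by fun_prop) (by simp)]
  simp [ENNReal.toReal_ofReal (splitWeight_nonneg _ _)]

theorem integral_mergeMeasure (L : WithLp 2 (ℝ × H) ≃ₗᵢ[ℝ] E) (s : ℝ) {F : E × E → ℝ}
    (hF : Measurable F) :
    ∫ p, F p ∂(mergeMeasure L s) = ∫ p : E × H, 1 / (2 * ‖p.1‖) * F (mergeMap L s p)
      ∂((volume : Measure E).prod (volume : Measure H)) := by
  have h1 : Measurable (mergeMap L s) :=
    (measurable_mergeMap L).comp measurable_prodMk_left
  rw [mergeMeasure, integral_map h1.aemeasurable hF.aestronglyMeasurable,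
    integral_withDensity_eq_integral_toReal_smul (by fun_prop)
      (Eventually.of_forall fun _ => ENNReal.ofReal_lt_top)]
  refine integral_congr_ae (Eventually.of_forall fun p => ?_)
  simp only [smul_eq_mul]
  rw [ENNReal.toReal_ofReal (by positivity)]

theorem isFiniteMeasureOnCompacts_splitMeasure (hE : 2 ≤ Module.finrank ℝ E) (s : ℝ) :
    IsFiniteMeasureOnCompacts (splitMeasure (E := E) s) := by
  refine ⟨fun K hK => ?_⟩
  obtain ⟨R, hR⟩ := hK.isBounded.subset_closedBall (0 : E × E)
  refine (measure_mono hR).trans_lt ?_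
  rw [← lintegral_indicator_one measurableSet_closedBall,
    lintegral_splitMeasure _ (measurable_one.indicator measurableSet_closedBall)]
  have h := (integrable_splitBound (E := E) R (R ^ (Module.finrank ℝ E - 2) / 4)).lintegral_lt_top
  rw [lintegral_prod _ ((measurable_const.indicator
    (measurableSet_closedBall.prod .univ)).ennreal_ofReal.aemeasurable)] at h
  refine (lintegral_mono fun w => lintegral_mono fun n => ?_).trans_lt h
  by_cases hm : splitMap s (w, n) ∈ closedBall (0 : E × E) R
  · rw [indicator_of_mem hm, indicator_of_mem (by
      simpa using norm_le_of_splitMap_mem hm), Pi.one_apply, mul_one]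
    exact ENNReal.ofReal_le_ofReal (splitWeight_le_of_splitMap_mem hE hm)
  · simp [indicator_of_notMem hm]

theorem isFiniteMeasureOnCompacts_mergeMeasure (hE : 2 ≤ Module.finrank ℝ E)
    (L : WithLp 2 (ℝ × H) ≃ₗᵢ[ℝ] E) (s : ℝ) :
    IsFiniteMeasureOnCompacts (mergeMeasure L s) := by
  refine ⟨fun K hK => ?_⟩
  obtain ⟨R, hR⟩ := hK.isBounded.subset_closedBall (0 : E × E)
  refine (measure_mono hR).trans_lt ?_
  rw [← lintegral_indicator_one measurableSet_closedBall,
    lintegral_mergeMeasure _ _ (measurable_one.indicator measurableSet_closedBall)]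
  have h := (integrable_mergeBound (E := E) (H := H) hE R)
  have h' := h.lintegral_lt_top
  rw [lintegral_prod _ h.1.aemeasurable.ennreal_ofReal] at h'
  refine (lintegral_mono fun b => lintegral_mono fun z => ?_).trans_lt h'
  by_cases hm : mergeMap L s (b, z) ∈ closedBall (0 : E × E) R
  · obtain ⟨hb, hz⟩ := mem_of_mergeMap_mem L hm
    rw [indicator_of_mem hm, indicator_of_mem hb, indicator_of_mem hz]
    simp
  · simp [indicator_of_notMem hm]

/-- The weight jumps at `‖w‖ ^ 2 = 2 s`, which is a null set of `w` for each level `s`. -/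
theorem continuous_integral_splitMeasure (hE : 2 ≤ Module.finrank ℝ E) {F : E × E → ℝ}
    (hF : Continuous F) {M R : ℝ} (hM : ∀ p, ‖F p‖ ≤ M)
    (hR : ∀ p, p ∉ closedBall (0 : E × E) R → F p = 0) :
    Continuous fun s : ℝ => ∫ p, F p ∂(splitMeasure (E := E) s) := by
  have : Nontrivial E := Module.nontrivial_of_finrank_pos (R := ℝ) (by omega)
  simp_rw [integral_splitMeasure _ hF.measurable]
  have hM0 : 0 ≤ M := (norm_nonneg _).trans (hM 0)
  refine continuous_iff_continuousAt.2 fun s₀ => continuousAt_of_dominated ?_ ?_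
    (integrable_splitBound (E := E) R (R ^ (Module.finrank ℝ E - 2) / 4 * M)) ?_
  · refine Eventually.of_forall fun s => Measurable.aestronglyMeasurable ?_
    have h1 : Measurable (splitMap s : E × sphere (0 : E) 1 → E × E) :=
      measurable_splitMap.comp measurable_prodMk_left
    have h2 : Measurable (splitWeight s : E → ℝ) :=
      measurable_splitWeight.comp measurable_prodMk_left
    exact (h2.comp measurable_fst).mul (hF.measurable.comp h1)
  · refine Eventually.of_forall fun s => Eventually.of_forall fun p => ?_
    obtain ⟨w, n⟩ := p
    by_cases hm : splitMap s (w, n) ∈ closedBall (0 : E × E) R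
    · rw [indicator_of_mem (by simpa using norm_le_of_splitMap_mem hm), norm_mul,
        Real.norm_of_nonneg (splitWeight_nonneg _ _)]
      exact mul_le_mul (splitWeight_le_of_splitMap_mem hE hm) (hM _) (norm_nonneg _)
        ((splitWeight_nonneg _ _).trans (splitWeight_le_of_splitMap_mem hE hm))
    · rw [hR _ hm, mul_zero, norm_zero]
      by_cases hw : ((w, n) : E × sphere (0 : E) 1) ∈ closedBall (0 : E) (2 * R) ×ˢ univ
      · rw [indicator_of_mem hw]
        have : 0 ≤ R := by
          have := (norm_nonneg w).trans (mem_closedBall_zero_iff.1 hw.1)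
          linarith
        positivity
      · rw [indicator_of_notMem hw]
  · have h0 : ∀ᵐ w : E, ‖w‖ ^ 2 ≠ 2 * s₀ := by
      rw [ae_iff]
      refine measure_mono_null (fun w hw => ?_)
        (Measure.addHaar_sphere (volume : Measure E) 0 (Real.sqrt (2 * s₀)))
      simp only [ne_eq, not_not, mem_ofPred_eq] at hw
      rw [mem_sphere_zero_iff_norm, ← hw, Real.sqrt_sq (norm_nonneg _)]
    filter_upwards [Measure.quasiMeasurePreserving_fst.ae h0] with p hp
    obtain ⟨w, n⟩ := p
    simp only at hp
    have hrc : Continuous fun s : ℝ => splitRadius s w := by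
      unfold splitRadius; fun_prop
    rcases lt_or_gt_of_ne hp with h | h
    · have h1 : ∀ᶠ s : ℝ in 𝓝 s₀, ‖w‖ ^ 2 < 2 * s :=
        (continuous_const.mul continuous_id).continuousAt.eventually (lt_mem_nhds h)
      refine ContinuousAt.congr (f := fun _ => (0 : ℝ)) continuousAt_const ?_
      filter_upwards [h1] with s hs
      simp [splitWeight, not_lt.2 hs.le]
    · have h1 : ∀ᶠ s : ℝ in 𝓝 s₀, 2 * s < ‖w‖ ^ 2 :=
        (continuous_const.mul continuous_id).continuousAt.eventually (gt_mem_nhds h)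
      refine ContinuousAt.congr (f := fun s : ℝ => splitRadius s w ^ (Module.finrank ℝ E - 1) /
        (4 * splitRadius s w) * F (splitMap s (w, n))) ?_ ?_
      · have h2 : splitRadius s₀ w ≠ 0 := (splitRadius_pos h).ne'
        have h3 : Continuous fun s : ℝ => F (splitMap s (w, n)) := by
          unfold splitMap; fun_prop
        exact (ContinuousAt.div (by fun_prop) (by fun_prop) (by simpa using h2)).mul
          h3.continuousAt
      · filter_upwards [h1] with s hs
        simp [splitWeight, hs]

theorem continuous_integral_mergeMeasure (hE : 2 ≤ Module.finrank ℝ E)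
    (L : WithLp 2 (ℝ × H) ≃ₗᵢ[ℝ] E) {F : E × E → ℝ}
    (hF : Continuous F) {M R : ℝ} (hM : ∀ p, ‖F p‖ ≤ M)
    (hR : ∀ p, p ∉ closedBall (0 : E × E) R → F p = 0) :
    Continuous fun s : ℝ => ∫ p, F p ∂(mergeMeasure L s) := by
  simp_rw [integral_mergeMeasure L _ hF.measurable]
  have hM0 : 0 ≤ M := (norm_nonneg _).trans (hM 0)
  refine continuous_of_dominated ?_ ?_ ((integrable_mergeBound (E := E) (H := H) hE R).mul_const M)
    ?_
  · refine fun s => Measurable.aestronglyMeasurable ?_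
    have h1 : Measurable (mergeMap L s) :=
      (measurable_mergeMap L).comp measurable_prodMk_left
    exact Measurable.mul (by fun_prop) (hF.measurable.comp h1)
  · refine fun s => Eventually.of_forall fun p => ?_
    obtain ⟨b, z⟩ := p
    by_cases hm : mergeMap L s (b, z) ∈ closedBall (0 : E × E) R
    · obtain ⟨hb, hz⟩ := mem_of_mergeMap_mem L hm
      rw [norm_mul, indicator_of_mem hb, indicator_of_mem hz, mul_one,
        Real.norm_of_nonneg (by positivity)]
      exact mul_le_mul_of_nonneg_left (hM _) (by positivity)
    · rw [hR _ hm, mul_zero, norm_zero]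
      refine mul_nonneg (mul_nonneg (indicator_nonneg (fun x _ => by positivity) _)
        (indicator_nonneg (fun x _ => zero_le_one) _)) hM0
  · refine Eventually.of_forall fun p => ?_
    unfold mergeMap
    fun_prop

/-- The split and merge parametrizations give the same measure `δ(2 ⟪b, c⟫ - s) db dc`: the
integrals of a compactly supported continuous function are continuous in the level `s`, and agree
for almost every `s`. -/
theorem splitMeasure_eq_mergeMeasure (hE : 2 ≤ Module.finrank ℝ E)
    (L : WithLp 2 (ℝ × H) ≃ₗᵢ[ℝ] E) (s : ℝ) : splitMeasure s = mergeMeasure L s := by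
  have : Nontrivial E := Module.nontrivial_of_finrank_pos (R := ℝ) (by omega)
  have := isFiniteMeasureOnCompacts_splitMeasure hE s
  have := isFiniteMeasureOnCompacts_mergeMeasure hE L s
  refine Measure.ext_of_integral_eq_on_compactlySupported_nnreal fun f => ?_
  have hc : Continuous fun p => (f p : ℝ) := by fun_prop
  have hcs : HasCompactSupport fun p => (f p : ℝ) :=
    f.hasCompactSupport.comp_left (g := NNReal.toReal) rfl
  obtain ⟨M, hM⟩ := hcs.exists_bound_of_continuous hc
  obtain ⟨R, hR⟩ := hcs.isBounded.subset_closedBall (0 : E × E)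
  have hR' : ∀ p, p ∉ closedBall (0 : E × E) R → (f p : ℝ) = 0 :=
    fun p hp => image_eq_zero_of_notMem_tsupport (f := fun p => (f p : ℝ)) fun h => hp (hR h)
  have h1 := continuous_integral_splitMeasure hE hc hM hR'
  have h2 := continuous_integral_mergeMeasure hE L hc hM hR'
  refine congrFun ((Continuous.ae_eq_iff_eq (volume : Measure ℝ) h1 h2).1 ?_) s
  filter_upwards [lintegral_splitMeasure_ae_eq L (F := fun p => ENNReal.ofReal (f p : ℝ))
    hc.measurable.ennreal_ofReal] with s hs
  rw [integral_eq_lintegral_of_nonneg_ae (Eventually.of_forall fun p => NNReal.coe_nonneg _)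
      hc.measurable.aestronglyMeasurable,
    integral_eq_lintegral_of_nonneg_ae (Eventually.of_forall fun p => NNReal.coe_nonneg _)
      hc.measurable.aestronglyMeasurable, hs]

end Exchange

/-! ### Invariance of the collision measures -/

section Invariance

open Set Filter Topology Metric
open scoped ENNReal

variable {N : ℕ}

instance instSFiniteProdToSphere :
    SFinite ((volume : Measure (Vel N)).prod (volume : Measure (Vel N)).toSphere) :=
  Measure.prod.instSFinite

instance instIsAddHaarMeasureVelProd :
    Measure.IsAddHaarMeasure (volume : Measure (Vel N × Vel N)) :=
  Measure.prod.instIsAddHaarMeasure _ _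

/-- The elastic collision with fixed impact direction `n`, as a linear map of pairs of
velocities. -/
def collisionMap (n : Vel N) : Vel N × Vel N →ₗ[ℝ] Vel N × Vel N :=
  LinearMap.prod
    (LinearMap.fst ℝ _ _ -
      ((innerₗ (Vel N) n).comp (LinearMap.fst ℝ _ _ - LinearMap.snd ℝ _ _)).smulRight n)
    (LinearMap.snd ℝ _ _ +
      ((innerₗ (Vel N) n).comp (LinearMap.fst ℝ _ _ - LinearMap.snd ℝ _ _)).smulRight n)

theorem collisionMap_apply (n : Vel N) (p : Vel N × Vel N) :
    collisionMap n p = (vPrime p.1 p.2 n, vsPrime p.1 p.2 n) := by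
  simp [collisionMap, vPrime, vsPrime, real_inner_comm]

theorem inner_vPrime_sub_vsPrime {n : Vel N} (hn : ‖n‖ = 1) (v vs : Vel N) :
    inner ℝ (vPrime v vs n - vsPrime v vs n) n = -inner ℝ (v - vs) n := by
  have h : vPrime v vs n - vsPrime v vs n = (v - vs) - (2 * inner ℝ (v - vs) n) • n := by
    simp only [vPrime, vsPrime]; module
  rw [h, inner_sub_left, inner_smul_left, real_inner_self_eq_norm_sq, hn]
  simp
  ring

theorem vPrime_vPrime {n : Vel N} (hn : ‖n‖ = 1) (v vs : Vel N) :
    vPrime (vPrime v vs n) (vsPrime v vs n) n = v := by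
  rw [vPrime, inner_vPrime_sub_vsPrime hn, vPrime]; module

theorem vsPrime_vPrime {n : Vel N} (hn : ‖n‖ = 1) (v vs : Vel N) :
    vsPrime (vPrime v vs n) (vsPrime v vs n) n = vs := by
  rw [vsPrime, inner_vPrime_sub_vsPrime hn, vsPrime]; module

theorem vPrime_swap (v vs n : Vel N) : vPrime vs v n = vsPrime v vs n := by
  rw [vPrime, vsPrime, ← neg_sub v vs, inner_neg_left]; module

theorem vsPrime_swap (v vs n : Vel N) : vsPrime vs v n = vPrime v vs n := by
  rw [vPrime, vsPrime, ← neg_sub v vs, inner_neg_left]; module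

/-- The collision map is a linear involution, so its determinant is `±1`. -/
theorem measurePreserving_collisionMap {n : Vel N} (hn : ‖n‖ = 1) :
    MeasurePreserving (collisionMap n) := by
  have hinv : (collisionMap n).comp (collisionMap n) = LinearMap.id := by
    refine LinearMap.ext fun p => ?_
    simp [collisionMap_apply, vPrime_vPrime hn, vsPrime_vPrime hn]
  have hdet : LinearMap.det (collisionMap n) * LinearMap.det (collisionMap n) = 1 := by
    rw [← LinearMap.det_comp, hinv, LinearMap.det_id]
  have h0 : LinearMap.det (collisionMap n) ≠ 0 := fun h => by simp [h] at hdet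
  refine ⟨(collisionMap n).continuous_of_finiteDimensional.measurable, ?_⟩
  rw [Measure.map_linearMap_addHaar_eq_smul_addHaar _ h0]
  have h1 : |LinearMap.det (collisionMap n)| = 1 := by
    rcases mul_self_eq_one_iff.1 hdet with h | h <;> simp [h]
  rw [abs_inv, h1]
  simp

/-- The measure `dv dv_* dn` on collisions. -/
def collisionMeasure (N : ℕ) : Measure (Vel N × Vel N × sphere (0 : Vel N) 1) :=
  (volume : Measure (Vel N)).prod
    ((volume : Measure (Vel N)).prod (volume : Measure (Vel N)).toSphere)

theorem lintegral_collisionMeasure {F : Vel N × Vel N × sphere (0 : Vel N) 1 → ℝ≥0∞}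
    (hF : Measurable F) : ∫⁻ q, F q ∂(collisionMeasure N) =
      ∫⁻ v : Vel N, ∫⁻ vs : Vel N, ∫⁻ n : sphere (0 : Vel N) 1, F (v, vs, n)
        ∂((volume : Measure (Vel N)).toSphere) := by
  rw [collisionMeasure, lintegral_prod _ hF.aemeasurable]
  refine lintegral_congr fun v => ?_
  exact lintegral_prod _ (hF.comp measurable_prodMk_left).aemeasurable

theorem lintegral_collisionMeasure_eq_lintegral_sphere
    {F : Vel N × Vel N × sphere (0 : Vel N) 1 → ℝ≥0∞} (hF : Measurable F) :
    ∫⁻ q, F q ∂(collisionMeasure N) =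
      ∫⁻ n : sphere (0 : Vel N) 1, (∫⁻ p : Vel N × Vel N, F (p.1, p.2, n))
        ∂((volume : Measure (Vel N)).toSphere) := by
  have hm : Measurable fun q : (Vel N × Vel N) × sphere (0 : Vel N) 1 => F (q.1.1, q.1.2, q.2) :=
    hF.comp (by fun_prop)
  rw [lintegral_collisionMeasure hF, ← lintegral_lintegral_swap (μ := volume)
    (f := fun p : Vel N × Vel N => fun n : sphere (0 : Vel N) 1 => F (p.1, p.2, n))
    hm.aemeasurable, Measure.volume_eq_prod,
    lintegral_prod _ hm.lintegral_prod_right'.aemeasurable]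

theorem lintegral_collisionMeasure_prime
    {F : Vel N × Vel N × sphere (0 : Vel N) 1 → ℝ≥0∞} (hF : Measurable F) :
    ∫⁻ q, F (vPrime q.1 q.2.1 q.2.2, vsPrime q.1 q.2.1 q.2.2, q.2.2) ∂(collisionMeasure N) =
      ∫⁻ q, F q ∂(collisionMeasure N) := by
  have hm : Measurable fun q : Vel N × Vel N × sphere (0 : Vel N) 1 =>
      F (vPrime q.1 q.2.1 q.2.2, vsPrime q.1 q.2.1 q.2.2, q.2.2) := by
    refine hF.comp ?_
    unfold vPrime vsPrime
    fun_prop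
  rw [lintegral_collisionMeasure_eq_lintegral_sphere hF,
    lintegral_collisionMeasure_eq_lintegral_sphere hm]
  refine lintegral_congr fun n => ?_
  have hn : ‖(n : Vel N)‖ = 1 := mem_sphere_zero_iff_norm.1 n.2
  rw [← (measurePreserving_collisionMap hn).lintegral_comp
    (f := fun p : Vel N × Vel N => F (p.1, p.2, n)) (hF.comp (by fun_prop))]
  simp only [collisionMap_apply]

theorem lintegral_collisionMeasure_swap
    {F : Vel N × Vel N × sphere (0 : Vel N) 1 → ℝ≥0∞} (hF : Measurable F) :
    ∫⁻ q, F (q.2.1, q.1, q.2.2) ∂(collisionMeasure N) = ∫⁻ q, F q ∂(collisionMeasure N) := by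
  have hm : Measurable fun q : (Vel N × Vel N) × sphere (0 : Vel N) 1 => F (q.1.1, q.1.2, q.2) :=
    hF.comp (by fun_prop)
  rw [lintegral_collisionMeasure hF, lintegral_collisionMeasure
    (F := fun q => F (q.2.1, q.1, q.2.2)) (hF.comp (by fun_prop)),
    lintegral_lintegral_swap (f := fun v vs : Vel N => ∫⁻ n : sphere (0 : Vel N) 1, F (v, vs, n)
      ∂((volume : Measure (Vel N)).toSphere)) hm.lintegral_prod_right'.aemeasurable]

/-- The exchange of `b` and `c` in `C1` reverses the direction of `b - c`. -/
theorem measurePreserving_neg_toSphere :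
    MeasurePreserving (fun n : sphere (0 : Vel N) 1 => -n)
      (volume : Measure (Vel N)).toSphere (volume : Measure (Vel N)).toSphere := by
  have hm : Measurable fun n : sphere (0 : Vel N) 1 => -n :=
    (continuous_neg : Continuous fun n : sphere (0 : Vel N) 1 => -n).measurable
  refine ⟨hm, Measure.ext fun s hs => ?_⟩
  rw [Measure.map_apply hm hs, Measure.toSphere_apply' _ hs, Measure.toSphere_apply' _ (hm hs)]
  congr 1
  rw [← Measure.measure_preimage_neg]
  congr 1
  ext x
  simp only [mem_preimage, Set.mem_smul, mem_image]
  constructor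
  · rintro ⟨r, hr, y, ⟨n, hn, rfl⟩, h⟩
    exact ⟨r, hr, _, ⟨-n, hn, rfl⟩, by rw [← neg_neg x, ← h]; simp⟩
  · rintro ⟨r, hr, y, ⟨n, hn, rfl⟩, h⟩
    exact ⟨r, hr, _, ⟨-n, by simpa using hn, rfl⟩, by rw [← h]; simp⟩

/-- An orthogonal splitting of the velocity space into a line and a hyperplane. -/
theorem exists_splitting (hN : 1 ≤ N) :
    Nonempty (WithLp 2 (ℝ × EuclideanSpace ℝ (Fin (N - 1))) ≃ₗᵢ[ℝ] Vel N) := by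
  have h : Module.finrank ℝ (WithLp 2 (ℝ × EuclideanSpace ℝ (Fin (N - 1)))) = N := by
    rw [(WithLp.linearEquiv 2 ℝ (ℝ × EuclideanSpace ℝ (Fin (N - 1)))).finrank_eq]
    simp
    omega
  exact ⟨(stdOrthonormalBasis ℝ _).repr.trans
    (LinearIsometryEquiv.piLpCongrLeft 2 ℝ ℝ (finCongr h))⟩

theorem paramC1_eq (us : Vel N) (V1 : ℝ) (v : Vel N) (n : sphere (0 : Vel N) 1) :
    paramC1 us V1 v n =
      (us + (splitMap V1 (v - us, n)).1, us + (splitMap V1 (v - us, n)).2) := by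
  simp only [paramC1, splitMap, radius, splitRadius]
  refine Prod.ext ?_ ?_ <;> simp only <;> module

theorem lintegral_measC1 (us : Vel N) (V1 : ℝ) (v : Vel N) {F : Vel N × Vel N → ℝ≥0∞}
    (hF : Measurable F) :
    ∫⁻ p, F p ∂(measC1 us V1 v) = ∫⁻ n : sphere (0 : Vel N) 1,
      ENNReal.ofReal (splitWeight V1 (v - us)) *
        F (us + (splitMap V1 (v - us, n)).1, us + (splitMap V1 (v - us, n)).2)
        ∂((volume : Measure (Vel N)).toSphere) := by
  have hm : Measurable fun n : sphere (0 : Vel N) 1 => paramC1 us V1 v n := by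
    unfold paramC1; fun_prop
  rw [measC1, splitWeight, finrank_euclideanSpace_fin]
  simp_rw [← paramC1_eq]
  split_ifs with h
  · rw [lintegral_smul_measure, lintegral_map hF hm,
      lintegral_const_mul _ (by exact hF.comp hm)]
    rfl
  · simp

/-- The isometric parametrization of the orthogonal complement of `w` by `H`. -/
theorem exists_isometry_orthogonal (hN : 1 ≤ N)
    (L : WithLp 2 (ℝ × EuclideanSpace ℝ (Fin (N - 1))) ≃ₗᵢ[ℝ] Vel N) {w : Vel N} (hw : w ≠ 0) :
    ∃ U : EuclideanSpace ℝ (Fin (N - 1)) ≃ₗᵢ[ℝ] (Submodule.span ℝ {w})ᗮ,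
      ∀ z, (U z : Vel N) = tilt L w (L (WithLp.toLp 2 (0, z))) := by
  let f : EuclideanSpace ℝ (Fin (N - 1)) →ₗ[ℝ] Vel N :=
    { toFun := fun z => tilt L w (L (WithLp.toLp 2 (0, z)))
      map_add' := fun x y => by
        have h : WithLp.toLp 2 ((0 : ℝ), x + y)
            = WithLp.toLp 2 ((0 : ℝ), x) + WithLp.toLp 2 ((0 : ℝ), y) := by
          refine (congrArg (WithLp.toLp 2) ?_).trans (WithLp.toLp_add 2 ((0 : ℝ), x) ((0 : ℝ), y))
          simp
        rw [← tilt_add, ← map_add, ← h]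
      map_smul' := fun c x => by
        have h : WithLp.toLp 2 ((0 : ℝ), c • x) = c • WithLp.toLp 2 ((0 : ℝ), x) := by
          refine (congrArg (WithLp.toLp 2) ?_).trans (WithLp.toLp_smul 2 c ((0 : ℝ), x))
          simp
        simp only [tilt_eq_reflection, RingHom.id_apply]
        rw [h, map_smul, map_smul] }
  have hf : ∀ z, f z ∈ (Submodule.span ℝ {w})ᗮ := fun z =>
    Submodule.mem_orthogonal_singleton_iff_inner_right.2 (inner_tilt L w z)
  let g : EuclideanSpace ℝ (Fin (N - 1)) →ₗᵢ[ℝ] (Submodule.span ℝ {w})ᗮ :=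
    { toLinearMap := f.codRestrict _ hf
      norm_map' := fun z => by
        rw [Submodule.coe_norm]
        change ‖tilt L w (L (WithLp.toLp 2 (0, z)))‖ = ‖z‖
        rw [norm_tilt, L.norm_map, WithLp.prod_norm_eq_of_L2]; simp }
  have hdim : Module.finrank ℝ (EuclideanSpace ℝ (Fin (N - 1)))
      = Module.finrank ℝ (Submodule.span ℝ {w})ᗮ := by
    have : Fact (Module.finrank ℝ (Vel N) = (N - 1) + 1) := ⟨by
      rw [finrank_euclideanSpace_fin]; omega⟩
    rw [Submodule.finrank_orthogonal_span_singleton (n := N - 1) hw, finrank_euclideanSpace_fin]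
  exact ⟨g.toLinearIsometryEquiv hdim, fun z => rfl⟩

theorem lintegral_measC2 (hN : 1 ≤ N)
    (L : WithLp 2 (ℝ × EuclideanSpace ℝ (Fin (N - 1))) ≃ₗᵢ[ℝ] Vel N)
    (us : Vel N) (V1 : ℝ) (v : Vel N) {F : Vel N × Vel N → ℝ≥0∞} (hF : Measurable F) :
    ∫⁻ p, F p ∂(measC2 us V1 v) = ∫⁻ z : EuclideanSpace ℝ (Fin (N - 1)),
      ENNReal.ofReal (1 / (2 * ‖v - us‖)) *
        F (us + (mergeMap L V1 (v - us, z)).2, v + (mergeMap L V1 (v - us, z)).2) := by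
  rw [measC2, lintegral_smul_measure]
  rcases eq_or_ne (v - us) 0 with h0 | h0
  · simp [show ‖v - us‖ = 0 by simpa using h0]
  obtain ⟨U, hU⟩ := exists_isometry_orthogonal hN L h0
  have hm : Measurable fun y : (Submodule.span ℝ {v - us})ᗮ => paramC2 us V1 v y := by
    unfold paramC2; fun_prop
  have hm2 : Measurable fun z => (mergeMap L V1 (v - us, z)).2 :=
    measurable_snd.comp ((measurable_mergeMap L).comp
      (by fun_prop : Measurable fun z : EuclideanSpace ℝ (Fin (N - 1)) => (V1, (v - us, z))))
  rw [lintegral_map hF hm, lintegral_const_mul _ (by exact hF.comp (by fun_prop)),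
    ← U.measurePreserving.lintegral_comp (by exact hF.comp hm)]
  simp only [hU, paramC2, mergeMap, smul_eq_mul, add_assoc]

/-- The measure `δ(us + a - b - c) δ(‖us‖² - V1 + ‖a‖² - ‖b‖² - ‖c‖²) da db dc` on the triples
`(a, b, c)` of velocities of normal particles in the processes `a ↔ b + c`. -/
def condensateMeasure (us : Vel N) (V1 : ℝ) : Measure (Vel N × Vel N × Vel N) :=
  (splitMeasure V1).map fun p => (us + (p.1 + p.2), us + p.1, us + p.2)

theorem lintegral_condensateMeasure (us : Vel N) (V1 : ℝ) {F : Vel N × Vel N × Vel N → ℝ≥0∞}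
    (hF : Measurable F) : ∫⁻ t, F t ∂(condensateMeasure us V1) =
      ∫⁻ p, F (us + (p.1 + p.2), us + p.1, us + p.2) ∂(splitMeasure (E := Vel N) V1) := by
  rw [condensateMeasure, lintegral_map hF (by fun_prop)]

theorem lintegral_lintegral_measC1 (us : Vel N) (V1 : ℝ)
    {F : Vel N × Vel N × Vel N → ℝ≥0∞} (hF : Measurable F) :
    ∫⁻ v, ∫⁻ p, F (v, p.1, p.2) ∂(measC1 us V1 v) = ∫⁻ t, F t ∂(condensateMeasure us V1) := by
  have hG : Measurable fun p : Vel N × Vel N => F (us + (p.1 + p.2), us + p.1, us + p.2) :=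
    hF.comp (by fun_prop)
  rw [lintegral_condensateMeasure us V1 hF, lintegral_splitMeasure _ hG,
    ← lintegral_add_left_eq_self _ us]
  refine lintegral_congr fun w => ?_
  rw [lintegral_measC1 us V1 _ (F := fun p => F (us + w, p.1, p.2)) (hF.comp (by fun_prop)),
    add_sub_cancel_left]
  refine lintegral_congr fun n => ?_
  congr 4
  simp only [splitMap]
  module

/-- The two collision terms with the condensate come from the same measure on triples, through its
first and second marginals. -/
theorem lintegral_lintegral_measC2 (hN : 2 ≤ N) (us : Vel N) (V1 : ℝ)
    {F : Vel N × Vel N × Vel N → ℝ≥0∞} (hF : Measurable F) :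
    ∫⁻ v, ∫⁻ p, F (p.2, v, p.1) ∂(measC2 us V1 v) = ∫⁻ t, F t ∂(condensateMeasure us V1) := by
  obtain ⟨L⟩ := exists_splitting (N := N) (by omega)
  have hG : Measurable fun p : Vel N × Vel N => F (us + (p.1 + p.2), us + p.1, us + p.2) :=
    hF.comp (by fun_prop)
  rw [lintegral_condensateMeasure us V1 hF,
    splitMeasure_eq_mergeMeasure (by rwa [finrank_euclideanSpace_fin]) L,
    lintegral_mergeMeasure _ _ hG, ← lintegral_add_left_eq_self _ us]
  refine lintegral_congr fun w => ?_
  rw [lintegral_measC2 (by omega) L us V1 _ (F := fun p => F (p.2, us + w, p.1))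
    (hF.comp (by fun_prop)), add_sub_cancel_left]
  refine lintegral_congr fun z => ?_
  congr 3
  simp only [mergeMap]
  module

theorem lintegral_measC1_swap (us : Vel N) (V1 : ℝ) (v : Vel N) {F : Vel N × Vel N → ℝ≥0∞}
    (hF : Measurable F) :
    ∫⁻ p, F (p.2, p.1) ∂(measC1 us V1 v) = ∫⁻ p, F p ∂(measC1 us V1 v) := by
  have hm : Measurable fun n : sphere (0 : Vel N) 1 => ENNReal.ofReal (splitWeight V1 (v - us)) *
        F (us + (splitMap V1 (v - us, n)).1, us + (splitMap V1 (v - us, n)).2) := by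
    refine Measurable.mul (by fun_prop) (hF.comp ?_)
    have := measurable_splitMap.comp
      (by fun_prop : Measurable fun n : sphere (0 : Vel N) 1 => (V1, (v - us, n)))
    exact (this.fst.const_add us).prodMk (this.snd.const_add us)
  rw [lintegral_measC1 us V1 v hF, lintegral_measC1 us V1 v (F := fun p => F (p.2, p.1))
    (hF.comp measurable_swap), ← measurePreserving_neg_toSphere.lintegral_comp hm]
  refine lintegral_congr fun n => ?_
  simp [splitMap, sub_eq_add_neg]

theorem lintegral_condensateMeasure_swap (us : Vel N) (V1 : ℝ)
    {F : Vel N × Vel N × Vel N → ℝ≥0∞} (hF : Measurable F) :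
    ∫⁻ t, F (t.1, t.2.2, t.2.1) ∂(condensateMeasure us V1) =
      ∫⁻ t, F t ∂(condensateMeasure us V1) := by
  rw [← lintegral_lintegral_measC1 us V1 hF, ← lintegral_lintegral_measC1 us V1
    (F := fun t => F (t.1, t.2.2, t.2.1)) (hF.comp (by fun_prop))]
  exact lintegral_congr fun v =>
    lintegral_measC1_swap us V1 v (F := fun p => F (v, p.1, p.2)) (hF.comp (by fun_prop))

theorem measurable_lintegral_measC1 (us : Vel N) (V1 : ℝ)
    {F : Vel N × Vel N × Vel N → ℝ≥0∞} (hF : Measurable F) :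
    Measurable fun v => ∫⁻ p, F (v, p.1, p.2) ∂(measC1 us V1 v) := by
  simp_rw [fun v => lintegral_measC1 us V1 v (F := fun p => F (v, p.1, p.2))
    (hF.comp (by fun_prop))]
  have h1 : Measurable fun q : Vel N × sphere (0 : Vel N) 1 => splitMap V1 (q.1 - us, q.2) :=
    measurable_splitMap.comp
      (by fun_prop : Measurable fun q : Vel N × sphere (0 : Vel N) 1 => (V1, (q.1 - us, q.2)))
  have h2 : Measurable fun q : Vel N × sphere (0 : Vel N) 1 => splitWeight V1 (q.1 - us) :=
    measurable_splitWeight.comp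
      (by fun_prop : Measurable fun q : Vel N × sphere (0 : Vel N) 1 => (V1, q.1 - us))
  exact Measurable.lintegral_prod_right' (h2.ennreal_ofReal.mul (hF.comp
    (measurable_fst.prodMk ((h1.fst.const_add us).prodMk (h1.snd.const_add us)))))

theorem measurable_lintegral_measC2 (hN : 1 ≤ N) (us : Vel N) (V1 : ℝ)
    {F : Vel N × Vel N × Vel N → ℝ≥0∞} (hF : Measurable F) :
    Measurable fun v => ∫⁻ p, F (p.2, v, p.1) ∂(measC2 us V1 v) := by
  obtain ⟨L⟩ := exists_splitting hN
  simp_rw [fun v => lintegral_measC2 hN L us V1 v (F := fun p => F (p.2, v, p.1))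
    (hF.comp (by fun_prop))]
  have h1 : Measurable fun q : Vel N × EuclideanSpace ℝ (Fin (N - 1)) =>
      (mergeMap L V1 (q.1 - us, q.2)).2 :=
    ((measurable_mergeMap L).comp (by fun_prop : Measurable
      fun q : Vel N × EuclideanSpace ℝ (Fin (N - 1)) => (V1, (q.1 - us, q.2)))).snd
  have h2 : Measurable fun q : Vel N × EuclideanSpace ℝ (Fin (N - 1)) =>
      ENNReal.ofReal (1 / (2 * ‖q.1 - us‖)) := by fun_prop
  exact Measurable.lintegral_prod_right' (h2.mul (hF.comp
    ((measurable_fst.add h1).prodMk (measurable_fst.prodMk (h1.const_add us)))))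

end Invariance

/-! ### Rates of the collisions and the entropy variable -/

section Rates

open Set Filter Topology Metric
open scoped ENNReal

variable {N : ℕ}

/-- The gain `φ' φ'_* (1 + φ) (1 + φ_*)` of a collision `(v, v_*, n)`. -/
def pairGain (φ : Vel N → ℝ) (q : Vel N × Vel N × sphere (0 : Vel N) 1) : ℝ :=
  φ (vPrime q.1 q.2.1 q.2.2) * φ (vsPrime q.1 q.2.1 q.2.2) * (1 + φ q.1) * (1 + φ q.2.1)

/-- The loss `φ φ_* (1 + φ') (1 + φ'_*)` of a collision `(v, v_*, n)`. -/
def pairLoss (φ : Vel N → ℝ) (q : Vel N × Vel N × sphere (0 : Vel N) 1) : ℝ :=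
  φ q.1 * φ q.2.1 * (1 + φ (vPrime q.1 q.2.1 q.2.2)) * (1 + φ (vsPrime q.1 q.2.1 q.2.2))

/-- The rate at `(a, b, c)` of the process `b + c → a`, whose fourth particle joins the
condensate. -/
def mergeRate (φ : Vel N → ℝ) (t : Vel N × Vel N × Vel N) : ℝ :=
  φ t.2.1 * φ t.2.2 * (1 + φ t.1)

/-- The rate at `(a, b, c)` of the process `a → b + c`, whose fourth particle comes from the
condensate. -/
def splitRate (φ : Vel N → ℝ) (t : Vel N × Vel N × Vel N) : ℝ :=
  φ t.1 * (1 + φ t.2.1) * (1 + φ t.2.2)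

/-- The derivative `log ((1 + φ) / φ)` of the entropy density of the Bose gas. -/
def entropyVar (φ : Vel N → ℝ) (v : Vel N) : ℝ := Real.log ((1 + φ v) / φ v)

variable {φ : Vel N → ℝ}

theorem entropyVar_pos (hpos : ∀ v, 0 < φ v) (v : Vel N) : 0 < entropyVar φ v := by
  have h := hpos v
  refine Real.log_pos ?_
  rw [lt_div_iff₀ h]
  linarith

theorem exp_entropyVar (hpos : ∀ v, 0 < φ v) (v : Vel N) :
    Real.exp (entropyVar φ v) = (1 + φ v) / φ v := by
  have h := hpos v
  exact Real.exp_log (by positivity)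

theorem continuous_entropyVar (hc : Continuous φ) (hpos : ∀ v, 0 < φ v) :
    Continuous (entropyVar φ) := by
  unfold entropyVar
  refine Continuous.log (Continuous.div (by fun_prop) hc fun v => (hpos v).ne') fun v => ?_
  have := hpos v
  positivity

theorem pairGain_eq (hpos : ∀ v, 0 < φ v) (q : Vel N × Vel N × sphere (0 : Vel N) 1) :
    pairGain φ q = pairLoss φ q * Real.exp (entropyVar φ q.1 + entropyVar φ q.2.1 -
      (entropyVar φ (vPrime q.1 q.2.1 q.2.2) + entropyVar φ (vsPrime q.1 q.2.1 q.2.2))) := by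
  rw [Real.exp_sub, Real.exp_add, Real.exp_add]
  simp_rw [exp_entropyVar hpos]
  have h1 := hpos q.1
  have h2 := hpos q.2.1
  have h3 := hpos (vPrime q.1 q.2.1 q.2.2)
  have h4 := hpos (vsPrime q.1 q.2.1 q.2.2)
  unfold pairGain pairLoss
  field_simp

theorem mergeRate_eq (hpos : ∀ v, 0 < φ v) (t : Vel N × Vel N × Vel N) :
    mergeRate φ t = splitRate φ t *
      Real.exp (entropyVar φ t.1 - (entropyVar φ t.2.1 + entropyVar φ t.2.2)) := by
  rw [Real.exp_sub, Real.exp_add]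
  simp_rw [exp_entropyVar hpos]
  have h1 := hpos t.1
  have h2 := hpos t.2.1
  have h3 := hpos t.2.2
  unfold mergeRate splitRate
  field_simp

theorem pairLoss_pos (hpos : ∀ v, 0 < φ v) (q : Vel N × Vel N × sphere (0 : Vel N) 1) :
    0 < pairLoss φ q := by
  have h1 := hpos q.1
  have h2 := hpos q.2.1
  have h3 := hpos (vPrime q.1 q.2.1 q.2.2)
  have h4 := hpos (vsPrime q.1 q.2.1 q.2.2)
  unfold pairLoss
  positivity

theorem splitRate_pos (hpos : ∀ v, 0 < φ v) (t : Vel N × Vel N × Vel N) : 0 < splitRate φ t := by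
  have h1 := hpos t.1
  have h2 := hpos t.2.1
  have h3 := hpos t.2.2
  unfold splitRate
  positivity

theorem pairGain_pos (hpos : ∀ v, 0 < φ v) (q : Vel N × Vel N × sphere (0 : Vel N) 1) :
    0 < pairGain φ q := by
  rw [pairGain_eq hpos]
  exact mul_pos (pairLoss_pos hpos q) (Real.exp_pos _)

theorem mergeRate_pos (hpos : ∀ v, 0 < φ v) (t : Vel N × Vel N × Vel N) : 0 < mergeRate φ t := by
  rw [mergeRate_eq hpos]
  exact mul_pos (splitRate_pos hpos t) (Real.exp_pos _)

/-- The pointwise form of the `H`-theorem: `(A - B) (x - y) ≥ 0` when `A / B = exp (x - y)`. -/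
theorem dissipation_le {A B x y : ℝ} (hB : 0 < B) (hA : A = B * Real.exp (x - y)) :
    A * y + B * x ≤ A * x + B * y := by
  have h : 0 ≤ (Real.exp (x - y) - 1) * (x - y) := by
    rcases le_total 0 (x - y) with h | h
    · exact mul_nonneg (sub_nonneg.2 (Real.one_le_exp h)) h
    · exact mul_nonneg_of_nonpos_of_nonpos (sub_nonpos.2 (Real.exp_le_one_iff.2 h)) h
  have := mul_nonneg hB.le h
  rw [hA]
  nlinarith

theorem eq_of_dissipation_eq {A B x y : ℝ} (hB : 0 < B) (hA : A = B * Real.exp (x - y))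
    (h : A * y + B * x = A * x + B * y) : x = y := by
  have h1 : B * ((Real.exp (x - y) - 1) * (x - y)) = 0 := by
    rw [hA] at h
    linear_combination -h
  rcases mul_eq_zero.1 ((mul_eq_zero.1 h1).resolve_left hB.ne') with h2 | h2
  · have := (Real.exp_eq_one_iff _).1 (sub_eq_zero.1 h2)
    linarith
  · linarith

theorem continuous_pairGain (hc : Continuous φ) : Continuous (pairGain φ) := by
  unfold pairGain vPrime vsPrime
  fun_prop

theorem continuous_pairLoss (hc : Continuous φ) : Continuous (pairLoss φ) := by
  unfold pairLoss vPrime vsPrime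
  fun_prop

theorem continuous_mergeRate (hc : Continuous φ) : Continuous (mergeRate φ) := by
  unfold mergeRate
  fun_prop

theorem continuous_splitRate (hc : Continuous φ) : Continuous (splitRate φ) := by
  unfold splitRate
  fun_prop

theorem pairGain_swap (q : Vel N × Vel N × sphere (0 : Vel N) 1) :
    pairGain φ (q.2.1, q.1, q.2.2) = pairGain φ q := by
  unfold pairGain
  rw [vPrime_swap q.1 q.2.1, vsPrime_swap q.1 q.2.1]
  ring

theorem pairLoss_swap (q : Vel N × Vel N × sphere (0 : Vel N) 1) :
    pairLoss φ (q.2.1, q.1, q.2.2) = pairLoss φ q := by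
  unfold pairLoss
  rw [vPrime_swap q.1 q.2.1, vsPrime_swap q.1 q.2.1]
  ring

theorem pairGain_prime (q : Vel N × Vel N × sphere (0 : Vel N) 1) :
    pairGain φ (vPrime q.1 q.2.1 q.2.2, vsPrime q.1 q.2.1 q.2.2, q.2.2) = pairLoss φ q := by
  have hn : ‖(q.2.2 : Vel N)‖ = 1 := mem_sphere_zero_iff_norm.1 q.2.2.2
  simp only [pairGain, pairLoss, vPrime_vPrime hn, vsPrime_vPrime hn]

theorem pairLoss_prime (q : Vel N × Vel N × sphere (0 : Vel N) 1) :
    pairLoss φ (vPrime q.1 q.2.1 q.2.2, vsPrime q.1 q.2.1 q.2.2, q.2.2) = pairGain φ q := by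
  have hn : ‖(q.2.2 : Vel N)‖ = 1 := mem_sphere_zero_iff_norm.1 q.2.2.2
  simp only [pairGain, pairLoss, vPrime_vPrime hn, vsPrime_vPrime hn]

/-- The total gain at `v`, with values in `[0, ∞]`. On `C1` the velocity `v` is the single one in
`v ↔ b + c`; on `C2`, where `p = (v_*, v_*')`, it is one of the two in `p.2 ↔ v + p.1`. -/
def totalGain (φ : Vel N → ℝ) (us : Vel N) (V1 ρs : ℝ) (v : Vel N) : ℝ≥0∞ :=
  (∫⁻ vs : Vel N, ∫⁻ n : sphere (0 : Vel N) 1, ENNReal.ofReal (pairGain φ (v, vs, n))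
      ∂((volume : Measure (Vel N)).toSphere)) +
    ENNReal.ofReal ρs * ((∫⁻ p, ENNReal.ofReal (mergeRate φ (v, p.1, p.2)) ∂(measC1 us V1 v)) +
      2 * ∫⁻ p, ENNReal.ofReal (splitRate φ (p.2, v, p.1)) ∂(measC2 us V1 v))

/-- The total loss at `v`, with values in `[0, ∞]`. -/
def totalLoss (φ : Vel N → ℝ) (us : Vel N) (V1 ρs : ℝ) (v : Vel N) : ℝ≥0∞ :=
  (∫⁻ vs : Vel N, ∫⁻ n : sphere (0 : Vel N) 1, ENNReal.ofReal (pairLoss φ (v, vs, n))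
      ∂((volume : Measure (Vel N)).toSphere)) +
    ENNReal.ofReal ρs * ((∫⁻ p, ENNReal.ofReal (splitRate φ (v, p.1, p.2)) ∂(measC1 us V1 v)) +
      2 * ∫⁻ p, ENNReal.ofReal (mergeRate φ (p.2, v, p.1)) ∂(measC2 us V1 v))

theorem integral_sub_eq_toReal_lintegral_sub {X : Type*} [MeasurableSpace X] {μ : Measure X}
    {f g : X → ℝ} (hf : Measurable f) (hg : Measurable g) (hf0 : ∀ x, 0 ≤ f x)
    (hg0 : ∀ x, 0 ≤ g x) (hf1 : ∫⁻ x, ENNReal.ofReal (f x) ∂μ ≠ ⊤)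
    (hg1 : ∫⁻ x, ENNReal.ofReal (g x) ∂μ ≠ ⊤) :
    Integrable (fun x => f x - g x) μ ∧ ∫ x, (f x - g x) ∂μ =
      (∫⁻ x, ENNReal.ofReal (f x) ∂μ).toReal - (∫⁻ x, ENNReal.ofReal (g x) ∂μ).toReal := by
  have h1 : Integrable f μ := (lintegral_ofReal_ne_top_iff_integrable hf.aestronglyMeasurable
    (Eventually.of_forall hf0)).1 hf1
  have h2 : Integrable g μ := (lintegral_ofReal_ne_top_iff_integrable hg.aestronglyMeasurable
    (Eventually.of_forall hg0)).1 hg1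
  refine ⟨h1.sub h2, ?_⟩
  rw [integral_sub h1 h2, integral_eq_lintegral_of_nonneg_ae (Eventually.of_forall hf0) h1.1,
    integral_eq_lintegral_of_nonneg_ae (Eventually.of_forall hg0) h2.1]

/-- Where gain and loss are finite, the kinetic equation says that they are equal. -/
theorem totalGain_eq_totalLoss (hc : Continuous φ) (hpos : ∀ v, 0 < φ v) {us : Vel N}
    {V1 ρs : ℝ} (hρ : 0 < ρs) {v : Vel N} (hG : totalGain φ us V1 ρs v ≠ ⊤)
    (hL : totalLoss φ us V1 ρs v ≠ ⊤) (h : Q φ v + ρs * Q1 us V1 φ v = 0) :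
    totalGain φ us V1 ρs v = totalLoss φ us V1 ρs v := by
  have hρ' : ENNReal.ofReal ρs ≠ 0 := by simpa using hρ
  have hgm := (continuous_pairGain hc).measurable
  have hlm := (continuous_pairLoss hc).measurable
  have hmm := (continuous_mergeRate hc).measurable
  have hsm := (continuous_splitRate hc).measurable
  unfold totalGain at hG ⊢
  unfold totalLoss at hL ⊢
  have eg : (∫⁻ vs : Vel N, ∫⁻ n : sphere (0 : Vel N) 1, ENNReal.ofReal (pairGain φ (v, vs, n))
      ∂((volume : Measure (Vel N)).toSphere)) = ∫⁻ q, ENNReal.ofReal (pairGain φ (v, q))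
      ∂((volume : Measure (Vel N)).prod (volume : Measure (Vel N)).toSphere) :=
    (lintegral_prod _ (hgm.comp measurable_prodMk_left).ennreal_ofReal.aemeasurable).symm
  have el : (∫⁻ vs : Vel N, ∫⁻ n : sphere (0 : Vel N) 1, ENNReal.ofReal (pairLoss φ (v, vs, n))
      ∂((volume : Measure (Vel N)).toSphere)) = ∫⁻ q, ENNReal.ofReal (pairLoss φ (v, q))
      ∂((volume : Measure (Vel N)).prod (volume : Measure (Vel N)).toSphere) :=
    (lintegral_prod _ (hlm.comp measurable_prodMk_left).ennreal_ofReal.aemeasurable).symm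
  rw [eg] at hG ⊢
  rw [el] at hL ⊢
  have hparts : ∀ a b c : ℝ≥0∞, a + ENNReal.ofReal ρs * (b + 2 * c) ≠ ⊤ →
      a ≠ ⊤ ∧ b ≠ ⊤ ∧ c ≠ ⊤ := by
    intro a b c habc
    obtain ⟨ha, hbc⟩ := ENNReal.add_ne_top.1 habc
    refine ⟨ha, ?_, ?_⟩
    · rintro rfl
      exact hbc (by rw [top_add, ENNReal.mul_top hρ'])
    · rintro rfl
      exact hbc (by rw [ENNReal.mul_top two_ne_zero, add_top, ENNReal.mul_top hρ'])
  have htoReal : ∀ a b c : ℝ≥0∞, a ≠ ⊤ → b ≠ ⊤ → c ≠ ⊤ →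
      (a + ENNReal.ofReal ρs * (b + 2 * c)).toReal
        = a.toReal + ρs * (b.toReal + 2 * c.toReal) := by
    intro a b c ha hb hc
    have h2c : 2 * c ≠ ⊤ := ENNReal.mul_ne_top (by simp) hc
    rw [ENNReal.toReal_add ha (ENNReal.mul_ne_top (by simp) (ENNReal.add_ne_top.2 ⟨hb, h2c⟩)),
      ENNReal.toReal_mul, ENNReal.toReal_ofReal hρ.le, ENNReal.toReal_add hb h2c,
      ENNReal.toReal_mul]
    simp
  obtain ⟨g0, g1, g2⟩ := hparts _ _ _ hG
  obtain ⟨l0, l1, l2⟩ := hparts _ _ _ hL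
  rw [← ENNReal.toReal_eq_toReal_iff' hG hL, htoReal _ _ _ g0 g1 g2, htoReal _ _ _ l0 l1 l2]
  have i0 := integral_sub_eq_toReal_lintegral_sub (by fun_prop) (by fun_prop)
    (fun q => (pairGain_pos hpos (v, q)).le) (fun q => (pairLoss_pos hpos (v, q)).le) g0 l0
  have i1 := (integral_sub_eq_toReal_lintegral_sub (by fun_prop) (by fun_prop)
    (fun p : Vel N × Vel N => (mergeRate_pos hpos (v, p.1, p.2)).le)
    (fun p => (splitRate_pos hpos (v, p.1, p.2)).le) g1 l1).2
  have i2 := (integral_sub_eq_toReal_lintegral_sub (by fun_prop) (by fun_prop)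
    (fun p : Vel N × Vel N => (splitRate_pos hpos (p.2, v, p.1)).le)
    (fun p => (mergeRate_pos hpos (p.2, v, p.1)).le) g2 l2).2
  have hQ : Q φ v = ∫ q, (pairGain φ (v, q) - pairLoss φ (v, q))
      ∂((volume : Measure (Vel N)).prod (volume : Measure (Vel N)).toSphere) :=
    (integral_prod _ i0.1).symm
  have e1 : ∀ p : Vel N × Vel N, φ p.1 * φ p.2 - φ v * (φ p.1 + φ p.2 + 1)
      = mergeRate φ (v, p.1, p.2) - splitRate φ (v, p.1, p.2) := by
    intro p; simp only [mergeRate, splitRate]; ring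
  have e2 : ∀ p : Vel N × Vel N, φ p.2 * (φ v + φ p.1 + 1) - φ v * φ p.1
      = splitRate φ (p.2, v, p.1) - mergeRate φ (p.2, v, p.1) := by
    intro p; simp only [mergeRate, splitRate]; ring
  unfold Q1 at h
  simp_rw [e1, e2] at h
  rw [hQ, i0.2, i1, i2] at h
  linarith

end Rates

/-! ### Finite entropy production -/

section Estimates

open Set Filter Topology Metric
open scoped ENNReal

variable {N : ℕ} {φ : Vel N → ℝ}

theorem le_const_of_decay {p C : ℝ} (hp : 0 ≤ p) (hC : 0 ≤ C)
    (hdec : ∀ v, φ v ≤ C * (1 + ‖v‖) ^ (-p)) (v : Vel N) : φ v ≤ C := by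
  refine (hdec v).trans (mul_le_of_le_one_right hC ?_)
  exact Real.rpow_le_one_of_one_le_of_nonpos (by linarith [norm_nonneg v]) (by linarith)

theorem const_pos_of_decay {p C : ℝ} (hpos : ∀ v, 0 < φ v)
    (hdec : ∀ v, φ v ≤ C * (1 + ‖v‖) ^ (-p)) : 0 < C := by
  have h := (hpos 0).trans_le (hdec 0)
  simpa using h

theorem lintegral_decay_lt_top {p C : ℝ} (hp : (N : ℝ) < p)
    (hdec : ∀ v, φ v ≤ C * (1 + ‖v‖) ^ (-p)) : ∫⁻ v, ENNReal.ofReal (φ v) < ⊤ := by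
  refine (lintegral_mono fun v => ENNReal.ofReal_le_ofReal (hdec v)).trans_lt ?_
  refine Integrable.lintegral_lt_top (Integrable.const_mul (integrable_one_add_norm ?_) C)
  rwa [finrank_euclideanSpace_fin]

theorem lintegral_pairLoss_le (hc : Continuous φ) (hpos : ∀ v, 0 < φ v) {C : ℝ}
    (hφC : ∀ v, φ v ≤ C) (v : Vel N) :
    ∫⁻ vs : Vel N, ∫⁻ n : sphere (0 : Vel N) 1, ENNReal.ofReal (pairLoss φ (v, vs, n))
      ∂((volume : Measure (Vel N)).toSphere) ≤
    ENNReal.ofReal (φ v) * (ENNReal.ofReal ((1 + C) ^ 2) *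
      (volume : Measure (Vel N)).toSphere univ * ∫⁻ v, ENNReal.ofReal (φ v)) := by
  have h1 : ∀ (vs : Vel N) (n : sphere (0 : Vel N) 1), ENNReal.ofReal (pairLoss φ (v, vs, n)) ≤
      ENNReal.ofReal (φ v) * ENNReal.ofReal ((1 + C) ^ 2) * ENNReal.ofReal (φ vs) := by
    intro vs n
    rw [← ENNReal.ofReal_mul (hpos v).le,
      ← ENNReal.ofReal_mul (mul_nonneg (hpos v).le (sq_nonneg _))]
    refine ENNReal.ofReal_le_ofReal ?_
    have a1 := hpos (vPrime v vs n)
    have a2 := hφC (vPrime v vs n)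
    have a3 := hpos (vsPrime v vs n)
    have a4 := hφC (vsPrime v vs n)
    have a5 := mul_pos (hpos v) (hpos vs)
    have h2 : (1 + φ (vPrime v vs n)) * (1 + φ (vsPrime v vs n)) ≤ (1 + C) * (1 + C) :=
      mul_le_mul (by linarith) (by linarith) (by linarith) (by linarith)
    simp only [pairLoss]
    nlinarith [mul_le_mul_of_nonneg_left h2 a5.le]
  calc _ ≤ ∫⁻ vs : Vel N, ∫⁻ _ : sphere (0 : Vel N) 1,
        ENNReal.ofReal (φ v) * ENNReal.ofReal ((1 + C) ^ 2) * ENNReal.ofReal (φ vs)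
        ∂((volume : Measure (Vel N)).toSphere) :=
      lintegral_mono fun vs => lintegral_mono fun n => h1 vs n
    _ = _ := by
      simp_rw [lintegral_const]
      rw [lintegral_mul_const _ (by fun_prop), lintegral_const_mul _ (by fun_prop)]
      ring

theorem splitWeight_le (hN : 2 ≤ N) (us : Vel N) (V1 : ℝ) :
    ∃ D : ℝ, ∀ v : Vel N, splitWeight V1 (v - us) ≤ D * (1 + ‖v‖) ^ (N - 2) := by
  set B := 1 + ‖us‖ + |V1| with hB
  have hB1 : 1 ≤ B := by have := norm_nonneg us; have := abs_nonneg V1; linarith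
  refine ⟨B ^ (N - 2) / 4, fun v => ?_⟩
  have hv := norm_nonneg v
  have hu := norm_nonneg us
  rw [splitWeight]
  split_ifs with h
  · have hr := splitRadius_pos h
    rw [finrank_euclideanSpace_fin]
    have h3 : splitRadius V1 (v - us) ^ (N - 1) / (4 * splitRadius V1 (v - us))
        = splitRadius V1 (v - us) ^ (N - 2) / 4 := by
      rw [show N - 1 = N - 2 + 1 by omega, pow_succ]
      field_simp
    have h4 : splitRadius V1 (v - us) ≤ B * (1 + ‖v‖) := by
      refine Real.sqrt_le_iff.2 ⟨by positivity, ?_⟩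
      have h5 := norm_sub_le v us
      have h6 : ‖v - us‖ ^ 2 ≤ (‖v‖ + ‖us‖) ^ 2 := pow_le_pow_left₀ (norm_nonneg _) h5 2
      have h7 : ‖v‖ + ‖us‖ + |V1| ≤ B * (1 + ‖v‖) := by nlinarith [abs_nonneg V1]
      have h8 : 1 ≤ B * (1 + ‖v‖) := by nlinarith
      have h9 := neg_abs_le V1
      have h10 := abs_nonneg V1
      have h11 : (‖v‖ + ‖us‖ + |V1|) * (B * (1 + ‖v‖)) ≤ (B * (1 + ‖v‖)) ^ 2 := by nlinarith
      have h12 : (‖v‖ + ‖us‖) * (‖v‖ + ‖us‖) ≤ (‖v‖ + ‖us‖) * (B * (1 + ‖v‖)) :=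
        mul_le_mul_of_nonneg_left (by linarith) (by positivity)
      have h13 : |V1| * 1 ≤ |V1| * (B * (1 + ‖v‖)) := mul_le_mul_of_nonneg_left h8 h10
      nlinarith [mul_nonneg (add_nonneg hv hu) (add_nonneg hv hu)]
    rw [h3]
    have := pow_le_pow_left₀ hr.le h4 (N - 2)
    rw [mul_pow] at this
    linarith
  · positivity

theorem lintegral_splitRate_le (hc : Continuous φ) (hpos : ∀ v, 0 < φ v) {C : ℝ}
    (hφC : ∀ v, φ v ≤ C) (us : Vel N) (V1 : ℝ) (v : Vel N) :
    ∫⁻ p, ENNReal.ofReal (splitRate φ (v, p.1, p.2)) ∂(measC1 us V1 v) ≤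
      ENNReal.ofReal (φ v) * (ENNReal.ofReal ((1 + C) ^ 2) *
        (volume : Measure (Vel N)).toSphere univ * ENNReal.ofReal (splitWeight V1 (v - us))) := by
  have hm := (continuous_splitRate hc).measurable
  have h1 : ∀ b c : Vel N, ENNReal.ofReal (splitRate φ (v, b, c)) ≤
      ENNReal.ofReal (φ v) * ENNReal.ofReal ((1 + C) ^ 2) := by
    intro b c
    rw [← ENNReal.ofReal_mul (hpos v).le]
    refine ENNReal.ofReal_le_ofReal ?_
    have a1 := hpos b
    have a2 := hφC b
    have a3 := hpos c
    have a4 := hφC c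
    have h2 : (1 + φ b) * (1 + φ c) ≤ (1 + C) * (1 + C) :=
      mul_le_mul (by linarith) (by linarith) (by linarith) (by linarith)
    simp only [splitRate]
    nlinarith [mul_le_mul_of_nonneg_left h2 (hpos v).le]
  rw [lintegral_measC1 us V1 v (by fun_prop)]
  calc _ ≤ ∫⁻ _ : sphere (0 : Vel N) 1, ENNReal.ofReal (splitWeight V1 (v - us)) *
        (ENNReal.ofReal (φ v) * ENNReal.ofReal ((1 + C) ^ 2))
        ∂((volume : Measure (Vel N)).toSphere) :=
      lintegral_mono fun n => mul_le_mul_right (h1 _ _) _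
    _ = _ := by
      rw [lintegral_const]
      ring

/-- The integrals of a decaying function over hyperplanes are uniformly bounded: such an integral is
dominated by the integral over the parallel hyperplane through the origin, which by rotation
invariance does not depend on the direction. -/
theorem lintegral_hyperplane_le (hpos : ∀ v, 0 < φ v) {p C : ℝ} (hp : 0 ≤ p)
    (hdec : ∀ v, φ v ≤ C * (1 + ‖v‖) ^ (-p))
    (L : WithLp 2 (ℝ × EuclideanSpace ℝ (Fin (N - 1))) ≃ₗᵢ[ℝ] Vel N) (x w : Vel N) :
    ∫⁻ z, ENNReal.ofReal (φ (x + tilt L w (L (WithLp.toLp 2 (0, z))))) ≤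
      ∫⁻ z : EuclideanSpace ℝ (Fin (N - 1)), ENNReal.ofReal (C * (1 + ‖z‖) ^ (-p)) := by
  have hC := const_pos_of_decay hpos hdec
  set y := L.symm (tilt L w x) with hy
  have hx : x = tilt L w (L y) := by
    rw [hy, L.apply_symm_apply]
    simp_rw [tilt_eq_reflection, Submodule.reflection_reflection]
  refine le_trans ?_ (lintegral_add_left_eq_self
    (fun z => ENNReal.ofReal (C * (1 + ‖z‖) ^ (-p))) y.snd).le
  refine lintegral_mono fun z => ENNReal.ofReal_le_ofReal ((hdec _).trans ?_)
  have h1 : ‖y.snd + z‖ ≤ ‖x + tilt L w (L (WithLp.toLp 2 (0, z)))‖ := by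
    have hxz : x + tilt L w (L (WithLp.toLp 2 (0, z))) =
        tilt L w (L (y + WithLp.toLp 2 (0, z))) := by
      rw [map_add, tilt_add, ← hx]
    rw [hxz, norm_tilt, L.norm_map]
    exact WithLp.norm_snd_le _ (y + WithLp.toLp 2 (0, z))
  exact mul_le_mul_of_nonneg_left (Real.rpow_le_rpow_of_nonpos (by positivity) (by linarith)
    (by linarith)) hC.le

theorem lintegral_mergeRate_le (hN : 1 ≤ N) (hc : Continuous φ) (hpos : ∀ v, 0 < φ v) {p C : ℝ}
    (hp : 0 ≤ p) (hdec : ∀ v, φ v ≤ C * (1 + ‖v‖) ^ (-p)) (us : Vel N) (V1 : ℝ) (v : Vel N) :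
    ∫⁻ q, ENNReal.ofReal (mergeRate φ (q.2, v, q.1)) ∂(measC2 us V1 v) ≤
      ENNReal.ofReal (φ v) * (ENNReal.ofReal (1 + C) *
        (∫⁻ z : EuclideanSpace ℝ (Fin (N - 1)), ENNReal.ofReal (C * (1 + ‖z‖) ^ (-p))) *
          ENNReal.ofReal (1 / (2 * ‖v - us‖))) := by
  have hm := (continuous_mergeRate hc).measurable
  have hC := const_pos_of_decay hpos hdec
  obtain ⟨L⟩ := exists_splitting hN
  have h1 : ∀ a c : Vel N, ENNReal.ofReal (mergeRate φ (a, v, c)) ≤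
      ENNReal.ofReal (φ v) * ENNReal.ofReal (1 + C) * ENNReal.ofReal (φ c) := by
    intro a c
    rw [← ENNReal.ofReal_mul (hpos v).le,
      ← ENNReal.ofReal_mul (mul_nonneg (hpos v).le (by linarith))]
    refine ENNReal.ofReal_le_ofReal ?_
    have a1 := le_const_of_decay hp hC.le hdec a
    have a2 := mul_pos (hpos v) (hpos c)
    simp only [mergeRate]
    nlinarith [mul_le_mul_of_nonneg_left a1 a2.le]
  have hm2 : Measurable fun z : EuclideanSpace ℝ (Fin (N - 1)) =>
      us + (mergeMap L V1 (v - us, z)).2 :=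
    (measurable_snd.comp ((measurable_mergeMap L).comp (by fun_prop :
      Measurable fun z : EuclideanSpace ℝ (Fin (N - 1)) => (V1, (v - us, z))))).const_add us
  rw [lintegral_measC2 hN L us V1 v (by fun_prop)]
  calc _ ≤ ∫⁻ z : EuclideanSpace ℝ (Fin (N - 1)), ENNReal.ofReal (1 / (2 * ‖v - us‖)) *
        (ENNReal.ofReal (φ v) * ENNReal.ofReal (1 + C) *
          ENNReal.ofReal (φ (us + (mergeMap L V1 (v - us, z)).2))) :=
      lintegral_mono fun z => mul_le_mul_right (h1 _ _) _
    _ = ENNReal.ofReal (1 / (2 * ‖v - us‖)) * (ENNReal.ofReal (φ v) * ENNReal.ofReal (1 + C) *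
          ∫⁻ z, ENNReal.ofReal (φ (us + (mergeMap L V1 (v - us, z)).2))) := by
      have hm3 : Measurable fun z : EuclideanSpace ℝ (Fin (N - 1)) =>
          ENNReal.ofReal (φ (us + (mergeMap L V1 (v - us, z)).2)) :=
        (hc.measurable.comp hm2).ennreal_ofReal
      rw [lintegral_const_mul _ (hm3.const_mul _), lintegral_const_mul _ hm3]
    _ ≤ ENNReal.ofReal (1 / (2 * ‖v - us‖)) * (ENNReal.ofReal (φ v) * ENNReal.ofReal (1 + C) *
          ∫⁻ z : EuclideanSpace ℝ (Fin (N - 1)), ENNReal.ofReal (C * (1 + ‖z‖) ^ (-p))) := by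
      refine mul_le_mul_right (mul_le_mul_right ?_ _) _
      simp only [mergeMap, ← add_assoc]
      exact lintegral_hyperplane_le hpos hp hdec L _ _
    _ = _ := by ring

/-- The loss is at most `φ v` times a collision frequency that grows like `(1 + ‖v‖) ^ (N - 2)` and
has an integrable singularity at `us`. -/
theorem exists_totalLoss_le (hN : 2 ≤ N) (hc : Continuous φ) (hpos : ∀ v, 0 < φ v) {p C : ℝ}
    (hp : 2 * (N : ℝ) < p) (hdec : ∀ v, φ v ≤ C * (1 + ‖v‖) ^ (-p)) (us : Vel N) (V1 ρs : ℝ) :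
    ∃ k : ℝ≥0∞, k ≠ ⊤ ∧ ∀ v, totalLoss φ us V1 ρs v ≤ ENNReal.ofReal (φ v) *
      (k * (ENNReal.ofReal ((1 + ‖v‖) ^ (N - 2)) + ENNReal.ofReal (1 / ‖v - us‖))) := by
  have hN' : (2 : ℝ) ≤ N := by exact_mod_cast hN
  have hC := const_pos_of_decay hpos hdec
  have hφC := le_const_of_decay (by linarith) hC.le hdec
  obtain ⟨D, hD⟩ := splitWeight_le hN us V1
  set S := (volume : Measure (Vel N)).toSphere univ with hS
  set I := ∫⁻ v, ENNReal.ofReal (φ v) with hI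
  set J := ∫⁻ z : EuclideanSpace ℝ (Fin (N - 1)), ENNReal.ofReal (C * (1 + ‖z‖) ^ (-p)) with hJ
  set c := ENNReal.ofReal ((1 + C) ^ 2) with hc'
  have hSt : S ≠ ⊤ := measure_ne_top _ _
  have hIt : I ≠ ⊤ := (lintegral_decay_lt_top (by linarith) hdec).ne
  have hJt : J ≠ ⊤ := by
    refine (Integrable.lintegral_lt_top (Integrable.const_mul (integrable_one_add_norm ?_) C)).ne
    rw [finrank_euclideanSpace_fin, Nat.cast_sub (by omega)]
    push_cast
    linarith
  refine ⟨c * S * I + ENNReal.ofReal ρs * (c * S * ENNReal.ofReal |D| +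
    2 * (ENNReal.ofReal (1 + C) * J)), by finiteness, fun v => ?_⟩
  set A := ENNReal.ofReal ((1 + ‖v‖) ^ (N - 2)) with hA
  set B := ENNReal.ofReal (1 / ‖v - us‖) with hB
  have hv := norm_nonneg v
  have h1A : 1 ≤ A := by
    rw [hA, ← ENNReal.ofReal_one]
    exact ENNReal.ofReal_le_ofReal (one_le_pow₀ (by linarith))
  have hwA : ENNReal.ofReal (splitWeight V1 (v - us)) ≤ ENNReal.ofReal |D| * A := by
    rw [hA, ← ENNReal.ofReal_mul (abs_nonneg _)]
    refine ENNReal.ofReal_le_ofReal ((hD v).trans ?_)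
    exact mul_le_mul_of_nonneg_right (le_abs_self _) (by positivity)
  have hwB : ENNReal.ofReal (1 / (2 * ‖v - us‖)) ≤ B := by
    refine ENNReal.ofReal_le_ofReal ?_
    rw [← one_div_mul_one_div]
    exact mul_le_of_le_one_left (by positivity) (by norm_num)
  have b0 := lintegral_pairLoss_le hc hpos hφC v
  have b1 := lintegral_splitRate_le hc hpos hφC us V1 v
  have b2 := lintegral_mergeRate_le (by omega) hc hpos (by linarith) hdec us V1 v
  have hAB : A ≤ A + B := le_self_add
  have hBA : B ≤ A + B := le_add_self
  calc totalLoss φ us V1 ρs v ≤ ENNReal.ofReal (φ v) * (c * S * I) + ENNReal.ofReal ρs *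
        (ENNReal.ofReal (φ v) * (c * S * ENNReal.ofReal (splitWeight V1 (v - us))) +
          2 * (ENNReal.ofReal (φ v) * (ENNReal.ofReal (1 + C) * J *
            ENNReal.ofReal (1 / (2 * ‖v - us‖))))) := by
        unfold totalLoss
        gcongr
    _ ≤ ENNReal.ofReal (φ v) * (c * S * I * (A + B)) + ENNReal.ofReal ρs *
        (ENNReal.ofReal (φ v) * (c * S * (ENNReal.ofReal |D| * (A + B))) +
          2 * (ENNReal.ofReal (φ v) * (ENNReal.ofReal (1 + C) * J * (A + B)))) := by
        exact add_le_add (mul_le_mul_right (le_mul_of_one_le_right' (h1A.trans hAB)) _)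
          (mul_le_mul_right (add_le_add
            (mul_le_mul_right (mul_le_mul_right (hwA.trans (mul_le_mul_right hAB _)) _) _)
            (mul_le_mul_right (mul_le_mul_right (mul_le_mul_right (hwB.trans hBA) _) _) _)) _)
    _ = _ := by ring

/-- The logarithm costs an arbitrarily small power of `φ`. -/
theorem mul_entropyVar_le (hpos : ∀ v, 0 < φ v) {C : ℝ} (hφC : ∀ v, φ v ≤ C) {δ : ℝ}
    (hδ : 0 < δ) (hδ1 : δ ≤ 1) (v : Vel N) :
    φ v * entropyVar φ v ≤ (1 + C) / δ * φ v ^ (1 - δ) := by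
  have h := hpos v
  have h1 : entropyVar φ v ≤ ((1 + φ v) / φ v) ^ δ / δ := Real.log_le_rpow_div (by positivity) hδ
  rw [Real.div_rpow (by positivity) h.le] at h1
  have h2 : (1 + φ v) ^ δ ≤ 1 + C := by
    calc (1 + φ v) ^ δ ≤ (1 + φ v) ^ (1 : ℝ) :=
          Real.rpow_le_rpow_of_exponent_le (by linarith) hδ1
      _ ≤ 1 + C := by rw [Real.rpow_one]; linarith [hφC v]
  have h3 : φ v ^ (1 - δ) = φ v / φ v ^ δ := by rw [Real.rpow_sub h, Real.rpow_one]
  have h4 : 0 < φ v ^ δ := Real.rpow_pos_of_pos h δ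
  calc φ v * entropyVar φ v ≤ φ v * ((1 + φ v) ^ δ / φ v ^ δ / δ) :=
        mul_le_mul_of_nonneg_left h1 h.le
    _ ≤ φ v * ((1 + C) / φ v ^ δ / δ) := by gcongr
    _ = _ := by rw [h3]; ring

theorem integrable_inv_norm_sub_indicator (hN : 2 ≤ N) (us : Vel N) :
    Integrable fun v : Vel N => (closedBall (0 : Vel N) 1).indicator
      (fun b => 1 / (2 * ‖b‖)) (v - us) :=
  (integrable_inv_norm_indicator (by rwa [finrank_euclideanSpace_fin]) 1).comp_sub_right us

theorem lintegral_mul_entropyVar_lt_top (hN : 2 ≤ N) (hpos : ∀ v, 0 < φ v)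
    {p C : ℝ} (hp : 2 * (N : ℝ) < p) (hdec : ∀ v, φ v ≤ C * (1 + ‖v‖) ^ (-p)) (us : Vel N) :
    ∫⁻ v, ENNReal.ofReal (φ v * entropyVar φ v) *
      (ENNReal.ofReal ((1 + ‖v‖) ^ (N - 2)) + ENNReal.ofReal (1 / ‖v - us‖)) < ⊤ := by
  have hN' : (2 : ℝ) ≤ N := by exact_mod_cast hN
  have hC := const_pos_of_decay hpos hdec
  have hφC := le_const_of_decay (by linarith) hC.le hdec
  -- this power of the decay rate leaves an exponent above `2 N - 1`
  set δ : ℝ := 1 / (2 * N) with hδ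
  have hδ0 : 0 < δ := by positivity
  have hδ1 : δ ≤ 1 / 4 := by
    rw [hδ]
    exact one_div_le_one_div_of_le (by norm_num) (by linarith)
  set q := p * (1 - δ) with hq
  have hq1 : 2 * (N : ℝ) - 1 < q := by
    have : 2 * (N : ℝ) * (1 - δ) = 2 * N - 1 := by rw [hδ]; field_simp
    rw [← this, hq]
    exact mul_lt_mul_of_pos_right hp (by linarith)
  set D := (1 + C) / δ * C ^ (1 - δ) with hD
  have hD0 : 0 ≤ D := by positivity
  have h1 : ∀ v, φ v * entropyVar φ v ≤ D * (1 + ‖v‖) ^ (-q) := by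
    intro v
    have hv : 0 ≤ 1 + ‖v‖ := by positivity
    refine (mul_entropyVar_le hpos hφC hδ0 (by linarith) v).trans ?_
    have h2 : φ v ^ (1 - δ) ≤ C ^ (1 - δ) * (1 + ‖v‖) ^ (-q) := by
      calc φ v ^ (1 - δ) ≤ (C * (1 + ‖v‖) ^ (-p)) ^ (1 - δ) :=
            Real.rpow_le_rpow (hpos v).le (hdec v) (by linarith)
        _ = _ := by
            rw [Real.mul_rpow hC.le (by positivity), ← Real.rpow_mul hv, hq, neg_mul]
    rw [hD, mul_assoc]
    exact mul_le_mul_of_nonneg_left h2 (by positivity)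
  have hbound : ∀ v, ENNReal.ofReal (φ v * entropyVar φ v) *
      (ENNReal.ofReal ((1 + ‖v‖) ^ (N - 2)) + ENNReal.ofReal (1 / ‖v - us‖)) ≤
      ENNReal.ofReal (2 * D * (1 + ‖v‖) ^ (-(q - (N - 2 : ℕ))) + 2 * D *
        (closedBall (0 : Vel N) 1).indicator (fun b => 1 / (2 * ‖b‖)) (v - us)) := by
    intro v
    have hv := norm_nonneg v
    have hind : 0 ≤ (closedBall (0 : Vel N) 1).indicator (fun b => 1 / (2 * ‖b‖)) (v - us) :=
      indicator_nonneg (fun b _ => by positivity) _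
    rw [← ENNReal.ofReal_add (by positivity) (by positivity),
      ← ENNReal.ofReal_mul (mul_nonneg (hpos v).le (entropyVar_pos hpos v).le)]
    refine ENNReal.ofReal_le_ofReal ?_
    have e1 : (1 + ‖v‖) ^ (-(q - (N - 2 : ℕ))) = (1 + ‖v‖) ^ (-q) * (1 + ‖v‖) ^ (N - 2) := by
      rw [neg_sub, sub_eq_neg_add, Real.rpow_add (by positivity), Real.rpow_natCast]
    have e2 : 1 / ‖v - us‖ ≤ (1 + ‖v‖) ^ (N - 2) +
        2 * (closedBall (0 : Vel N) 1).indicator (fun b => 1 / (2 * ‖b‖)) (v - us) := by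
      have h1p : (1 : ℝ) ≤ (1 + ‖v‖) ^ (N - 2) := one_le_pow₀ (by linarith)
      by_cases hb : v - us ∈ closedBall (0 : Vel N) 1
      · rw [indicator_of_mem hb, ← one_div_mul_one_div]
        linarith
      · rw [indicator_of_notMem hb]
        rw [mem_closedBall_zero_iff, not_le] at hb
        have := (div_le_one (by linarith)).2 hb.le
        linarith
    have e3 : (1 + ‖v‖) ^ (-q) ≤ 1 :=
      Real.rpow_le_one_of_one_le_of_nonpos (by linarith) (by linarith)
    have e4 : 0 ≤ (1 + ‖v‖) ^ (-q) := by positivity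
    calc φ v * entropyVar φ v * ((1 + ‖v‖) ^ (N - 2) + 1 / ‖v - us‖)
        ≤ D * (1 + ‖v‖) ^ (-q) * (2 * (1 + ‖v‖) ^ (N - 2) +
          2 * (closedBall (0 : Vel N) 1).indicator (fun b => 1 / (2 * ‖b‖)) (v - us)) :=
          mul_le_mul (h1 v) (by linarith) (by positivity) (by positivity)
      _ = 2 * D * (1 + ‖v‖) ^ (-(q - (N - 2 : ℕ))) + 2 * D * ((1 + ‖v‖) ^ (-q) *
          (closedBall (0 : Vel N) 1).indicator (fun b => 1 / (2 * ‖b‖)) (v - us)) := by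
          rw [e1]; ring
      _ ≤ _ := by
          gcongr
          exact mul_le_of_le_one_left hind e3
  refine (lintegral_mono hbound).trans_lt (Integrable.lintegral_lt_top ?_)
  refine Integrable.add (Integrable.const_mul (integrable_one_add_norm ?_) _)
    (Integrable.const_mul (integrable_inv_norm_sub_indicator hN us) _)
  rw [finrank_euclideanSpace_fin, Nat.cast_sub hN]
  push_cast
  linarith

/-- The loss has finite entropy production. Only an upper bound on `φ` is used: where `φ` is small
the logarithm is large, but the loss contains the factor `φ`. -/
theorem lintegral_totalLoss_mul_entropyVar_lt_top (hN : 2 ≤ N) (hc : Continuous φ)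
    (hpos : ∀ v, 0 < φ v) {p C : ℝ} (hp : 2 * (N : ℝ) < p)
    (hdec : ∀ v, φ v ≤ C * (1 + ‖v‖) ^ (-p)) (us : Vel N) (V1 ρs : ℝ) :
    ∫⁻ v, totalLoss φ us V1 ρs v * ENNReal.ofReal (entropyVar φ v) < ⊤ := by
  obtain ⟨k, hk, hle⟩ := exists_totalLoss_le hN hc hpos hp hdec us V1 ρs
  have h := lintegral_mul_entropyVar_lt_top hN hpos hp hdec us
  have h2 : ∫⁻ v, k * (ENNReal.ofReal (φ v * entropyVar φ v) *
      (ENNReal.ofReal ((1 + ‖v‖) ^ (N - 2)) + ENNReal.ofReal (1 / ‖v - us‖))) < ⊤ := by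
    rw [lintegral_const_mul' _ _ hk]
    exact ENNReal.mul_lt_top hk.lt_top h
  refine (lintegral_mono fun v => ?_).trans_lt h2
  calc totalLoss φ us V1 ρs v * ENNReal.ofReal (entropyVar φ v)
      ≤ ENNReal.ofReal (φ v) * (k * (ENNReal.ofReal ((1 + ‖v‖) ^ (N - 2)) +
        ENNReal.ofReal (1 / ‖v - us‖))) * ENNReal.ofReal (entropyVar φ v) := by
        gcongr
        exact hle v
    _ = _ := by
        rw [ENNReal.ofReal_mul (hpos v).le]
        ring

end Estimates

/-! ### The entropy identity -/

section Entropy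

open Set Filter Topology Metric
open scoped ENNReal

variable {N : ℕ} {φ : Vel N → ℝ}

/-- The integral of a gain or loss rate against a test function `X`, in terms of the measures on
collisions. The two parts with the condensate become integrals for the same measure. -/
theorem lintegral_totalRate_mul (hN : 2 ≤ N) (us : Vel N) (V1 ρs : ℝ)
    {A₀ : Vel N × Vel N × sphere (0 : Vel N) 1 → ℝ≥0∞} (hA₀ : Measurable A₀)
    {A B : Vel N × Vel N × Vel N → ℝ≥0∞} (hA : Measurable A) (hB : Measurable B)
    {X : Vel N → ℝ≥0∞} (hX : Measurable X) (hX' : ∀ v, X v ≠ ⊤) :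
    ∫⁻ v, ((∫⁻ vs : Vel N, ∫⁻ n : sphere (0 : Vel N) 1, A₀ (v, vs, n)
      ∂((volume : Measure (Vel N)).toSphere)) + ENNReal.ofReal ρs *
        ((∫⁻ p, A (v, p.1, p.2) ∂(measC1 us V1 v)) +
          2 * ∫⁻ p, B (p.2, v, p.1) ∂(measC2 us V1 v))) * X v =
      ∫⁻ q, A₀ q * X q.1 ∂(collisionMeasure N) + ENNReal.ofReal ρs *
        (∫⁻ t, A t * X t.1 ∂(condensateMeasure us V1) +
          2 * ∫⁻ t, B t * X t.2.1 ∂(condensateMeasure us V1)) := by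
  set a : Vel N → ℝ≥0∞ := fun v => ∫⁻ vs : Vel N, ∫⁻ n : sphere (0 : Vel N) 1, A₀ (v, vs, n)
      ∂((volume : Measure (Vel N)).toSphere) with ha
  set b : Vel N → ℝ≥0∞ := fun v => ∫⁻ p, A (v, p.1, p.2) ∂(measC1 us V1 v) with hb
  set c : Vel N → ℝ≥0∞ := fun v => ∫⁻ p, B (p.2, v, p.1) ∂(measC2 us V1 v) with hcdef
  have hA₁ : Measurable fun q : (Vel N × Vel N) × sphere (0 : Vel N) 1 =>
      A₀ (q.1.1, q.1.2, q.2) := hA₀.comp (by fun_prop)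
  have ham : Measurable a := hA₁.lintegral_prod_right'.lintegral_prod_right'
  have hbm : Measurable b := measurable_lintegral_measC1 us V1 hA
  have hcm : Measurable c := measurable_lintegral_measC2 (by omega) us V1 hB
  have e0 : ∫⁻ v, a v * X v = ∫⁻ q, A₀ q * X q.1 ∂(collisionMeasure N) := by
    rw [lintegral_collisionMeasure (F := fun q => A₀ q * X q.1)
      (hA₀.mul (hX.comp measurable_fst))]
    refine lintegral_congr fun v => ?_
    rw [ha, ← lintegral_mul_const' _ _ (hX' v)]
    exact lintegral_congr fun vs => (lintegral_mul_const' _ _ (hX' v)).symm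
  have e1 : ∫⁻ v, b v * X v = ∫⁻ t, A t * X t.1 ∂(condensateMeasure us V1) := by
    rw [← lintegral_lintegral_measC1 us V1 (F := fun t => A t * X t.1)
      (hA.mul (hX.comp measurable_fst))]
    exact lintegral_congr fun v => (lintegral_mul_const' _ _ (hX' v)).symm
  have e2 : ∫⁻ v, c v * X v = ∫⁻ t, B t * X t.2.1 ∂(condensateMeasure us V1) := by
    rw [← lintegral_lintegral_measC2 hN us V1 (F := fun t => B t * X t.2.1)
      (hB.mul (hX.comp (by fun_prop)))]
    exact lintegral_congr fun v => (lintegral_mul_const' _ _ (hX' v)).symm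
  have h1 : ∀ v, (a v + ENNReal.ofReal ρs * (b v + 2 * c v)) * X v
      = a v * X v + ENNReal.ofReal ρs * (b v * X v + 2 * (c v * X v)) := fun v => by ring
  refine (lintegral_congr h1).trans ?_
  rw [lintegral_add_left (by exact ham.mul hX), lintegral_const_mul _ (by fun_prop),
    lintegral_add_left (by exact hbm.mul hX), lintegral_const_mul _ (by fun_prop), e0, e1, e2]

/-- Symmetrization over the four velocities of a collision; `B` is the rate of the inverse
collision. -/
theorem lintegral_collisionMeasure_symmetrize
    {A B : Vel N × Vel N × sphere (0 : Vel N) 1 → ℝ≥0∞} (hA : Measurable A)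
    (hswap : ∀ q, A (q.2.1, q.1, q.2.2) = A q)
    (hprime : ∀ q, A (vPrime q.1 q.2.1 q.2.2, vsPrime q.1 q.2.1 q.2.2, q.2.2) = B q)
    {X : Vel N → ℝ≥0∞} (hX : Measurable X) :
    ∫⁻ q, (A q * (X q.1 + X q.2.1) + B q * (X (vPrime q.1 q.2.1 q.2.2) +
      X (vsPrime q.1 q.2.1 q.2.2))) ∂(collisionMeasure N) =
      4 * ∫⁻ q, A q * X q.1 ∂(collisionMeasure N) := by
  have hm1 : Measurable fun q : Vel N × Vel N × sphere (0 : Vel N) 1 => A q * X q.1 := by fun_prop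
  have hm2 : Measurable fun q : Vel N × Vel N × sphere (0 : Vel N) 1 => A q * X q.2.1 := by
    fun_prop
  have e1 : ∫⁻ q, A q * X q.2.1 ∂(collisionMeasure N)
      = ∫⁻ q, A q * X q.1 ∂(collisionMeasure N) := by
    rw [← lintegral_collisionMeasure_swap hm1]
    simp only [hswap]
  have e2 : ∫⁻ q, B q * X (vPrime q.1 q.2.1 q.2.2) ∂(collisionMeasure N)
      = ∫⁻ q, A q * X q.1 ∂(collisionMeasure N) := by
    rw [← lintegral_collisionMeasure_prime hm1]
    simp only [hprime]
  have e3 : ∫⁻ q, B q * X (vsPrime q.1 q.2.1 q.2.2) ∂(collisionMeasure N)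
      = ∫⁻ q, A q * X q.2.1 ∂(collisionMeasure N) := by
    rw [← lintegral_collisionMeasure_prime hm2]
    simp only [hprime]
  have hm3 : Measurable fun q : Vel N × Vel N × sphere (0 : Vel N) 1 =>
      B q * X (vPrime q.1 q.2.1 q.2.2) := by
    simp_rw [← hprime]
    unfold vPrime vsPrime
    fun_prop
  simp_rw [mul_add]
  rw [lintegral_add_left (by exact hm1.add hm2), lintegral_add_left hm1,
    lintegral_add_left hm3, e3, e2, e1]
  ring

/-- The factor `2` of the `C2` term accounts for the two velocities `b` and `c`. -/
theorem lintegral_condensateMeasure_symmetrize (us : Vel N) (V1 : ℝ)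
    {A B : Vel N × Vel N × Vel N → ℝ≥0∞} (hA : Measurable A) (hB : Measurable B)
    (hswap : ∀ t, B (t.1, t.2.2, t.2.1) = B t) {X : Vel N → ℝ≥0∞} (hX : Measurable X) :
    ∫⁻ t, (A t * X t.1 + B t * (X t.2.1 + X t.2.2)) ∂(condensateMeasure us V1) =
      ∫⁻ t, A t * X t.1 ∂(condensateMeasure us V1) +
        2 * ∫⁻ t, B t * X t.2.1 ∂(condensateMeasure us V1) := by
  have e1 : ∫⁻ t, B t * X t.2.2 ∂(condensateMeasure us V1)
      = ∫⁻ t, B t * X t.2.1 ∂(condensateMeasure us V1) := by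
    rw [← lintegral_condensateMeasure_swap us V1 (F := fun t => B t * X t.2.1) (by fun_prop)]
    simp only [hswap]
  simp_rw [mul_add]
  rw [lintegral_add_left (by fun_prop), lintegral_add_left (by fun_prop), e1]
  ring

theorem eq_and_eq_of_add_mul_eq {a b c d k : ℝ≥0∞} (hba : b ≤ a) (hdc : d ≤ c) (hk : k ≠ 0)
    (hk' : k ≠ ⊤) (hfin : b + k * d ≠ ⊤) (h : a + k * c = b + k * d) : a = b ∧ c = d := by
  obtain ⟨hb, hkd⟩ := ENNReal.add_ne_top.1 hfin
  rw [← h] at hfin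
  obtain ⟨ha, hkc⟩ := ENNReal.add_ne_top.1 hfin
  have h1 : k * d ≤ k * c := by gcongr
  constructor
  · refine le_antisymm ?_ hba
    by_contra hlt
    exact absurd h (ENNReal.add_lt_add_of_lt_of_le hkd (not_le.1 hlt) h1).ne'
  · have h2 : k * c = k * d := by
      refine le_antisymm ?_ h1
      by_contra hlt
      exact absurd h (ENNReal.add_lt_add_of_le_of_lt hb hba (not_le.1 hlt)).ne'
    exact (ENNReal.mul_right_inj hk hk').1 h2

/-- Since `φ` is bounded, `entropyVar` stays away from `0`, and a finite entropy production bounds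
the loss itself. -/
theorem exists_pos_le_entropyVar (hpos : ∀ v, 0 < φ v) {C : ℝ} (hφC : ∀ v, φ v ≤ C) :
    ∃ c : ℝ, 0 < c ∧ ∀ v, c ≤ entropyVar φ v := by
  have hC : 0 < C := (hpos 0).trans_le (hφC 0)
  refine ⟨Real.log ((1 + C) / C), Real.log_pos ?_, fun v => ?_⟩
  · rw [lt_div_iff₀ hC]; linarith
  · have h := hpos v
    refine Real.log_le_log (by positivity) ?_
    rw [div_le_div_iff₀ hC h]
    nlinarith [hφC v]

theorem measurable_totalLoss (hN : 2 ≤ N) (hc : Continuous φ) (us : Vel N) (V1 ρs : ℝ) :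
    Measurable (totalLoss φ us V1 ρs) := by
  have hl := (continuous_pairLoss hc).measurable
  have hm := (continuous_mergeRate hc).measurable
  have hs := (continuous_splitRate hc).measurable
  have hl1 : Measurable fun q : (Vel N × Vel N) × sphere (0 : Vel N) 1 =>
      ENNReal.ofReal (pairLoss φ (q.1.1, q.1.2, q.2)) := by fun_prop
  exact hl1.lintegral_prod_right'.lintegral_prod_right'.add
    (((measurable_lintegral_measC1 us V1 hs.ennreal_ofReal).add
      ((measurable_lintegral_measC2 (by omega) us V1 hm.ennreal_ofReal).const_mul _)).const_mul _)

theorem measurable_totalGain (hN : 2 ≤ N) (hc : Continuous φ) (us : Vel N) (V1 ρs : ℝ) :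
    Measurable (totalGain φ us V1 ρs) := by
  have hg := (continuous_pairGain hc).measurable
  have hm := (continuous_mergeRate hc).measurable
  have hs := (continuous_splitRate hc).measurable
  have hg1 : Measurable fun q : (Vel N × Vel N) × sphere (0 : Vel N) 1 =>
      ENNReal.ofReal (pairGain φ (q.1.1, q.1.2, q.2)) := by fun_prop
  exact hg1.lintegral_prod_right'.lintegral_prod_right'.add
    (((measurable_lintegral_measC1 us V1 hm.ennreal_ofReal).add
      ((measurable_lintegral_measC2 (by omega) us V1 hs.ennreal_ofReal).const_mul _)).const_mul _)

theorem lintegral_totalLoss_lt_top (hN : 2 ≤ N) (hc : Continuous φ)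
    (hpos : ∀ v, 0 < φ v) {p C : ℝ} (hp : 2 * (N : ℝ) < p)
    (hdec : ∀ v, φ v ≤ C * (1 + ‖v‖) ^ (-p)) (us : Vel N) (V1 ρs : ℝ) :
    ∫⁻ v, totalLoss φ us V1 ρs v < ⊤ := by
  have hN' : (2 : ℝ) ≤ N := by exact_mod_cast hN
  have hφC := le_const_of_decay (by linarith) (const_pos_of_decay hpos hdec).le hdec
  obtain ⟨c, hc0, hcle⟩ := exists_pos_le_entropyVar hpos hφC
  have h := lintegral_totalLoss_mul_entropyVar_lt_top hN hc hpos hp hdec us V1 ρs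
  have h1 : (∫⁻ v, totalLoss φ us V1 ρs v) * ENNReal.ofReal c < ⊤ := by
    rw [← lintegral_mul_const' _ _ ENNReal.ofReal_ne_top]
    exact (lintegral_mono fun v =>
      mul_le_mul_right (ENNReal.ofReal_le_ofReal (hcle v)) _).trans_lt h
  by_contra htop
  rw [not_lt, top_le_iff] at htop
  rw [htop, ENNReal.top_mul (by simpa using hc0)] at h1
  exact lt_irrefl _ h1

/-- The total gain is integrable because each of its three parts is carried by an exchange of the
variables to a part of the loss. -/
theorem lintegral_totalGain_lt_top (hN : 2 ≤ N) (hc : Continuous φ)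
    (hpos : ∀ v, 0 < φ v) {p C : ℝ} (hp : 2 * (N : ℝ) < p)
    (hdec : ∀ v, φ v ≤ C * (1 + ‖v‖) ^ (-p)) (us : Vel N) (V1 ρs : ℝ) :
    ∫⁻ v, totalGain φ us V1 ρs v < ⊤ := by
  have hg := (continuous_pairGain hc).measurable
  have hl := (continuous_pairLoss hc).measurable
  have hm := (continuous_mergeRate hc).measurable
  have hs := (continuous_splitRate hc).measurable
  have h := lintegral_totalLoss_lt_top hN hc hpos hp hdec us V1 ρs
  have e1 := lintegral_totalRate_mul hN us V1 ρs hl.ennreal_ofReal hs.ennreal_ofReal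
    hm.ennreal_ofReal (X := fun _ => 1) measurable_const (by simp)
  have e2 := lintegral_totalRate_mul hN us V1 ρs hg.ennreal_ofReal hm.ennreal_ofReal
    hs.ennreal_ofReal (X := fun _ => 1) measurable_const (by simp)
  simp only [mul_one] at e1 e2
  change ∫⁻ v, totalLoss φ us V1 ρs v = _ at e1
  change ∫⁻ v, totalGain φ us V1 ρs v = _ at e2
  have e3 : ∫⁻ q, ENNReal.ofReal (pairGain φ q) ∂(collisionMeasure N)
      = ∫⁻ q, ENNReal.ofReal (pairLoss φ q) ∂(collisionMeasure N) := by
    rw [← lintegral_collisionMeasure_prime hg.ennreal_ofReal]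
    simp only [pairGain_prime]
  rw [e1] at h
  rw [e2, e3]
  refine lt_of_le_of_lt ?_ (ENNReal.mul_lt_top (by simp : (2 : ℝ≥0∞) < ⊤) h)
  set a := ∫⁻ q, ENNReal.ofReal (pairLoss φ q) ∂(collisionMeasure N)
  set b := ∫⁻ t, ENNReal.ofReal (mergeRate φ t) ∂(condensateMeasure us V1)
  set c := ∫⁻ t, ENNReal.ofReal (splitRate φ t) ∂(condensateMeasure us V1)
  calc a + ENNReal.ofReal ρs * (b + 2 * c)
      ≤ a + ENNReal.ofReal ρs * (b + 2 * c) + (a + ENNReal.ofReal ρs * (3 * b)) := le_self_add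
    _ = _ := by ring

theorem ae_totalGain_eq_totalLoss (hN : 2 ≤ N) (hc : Continuous φ)
    (hpos : ∀ v, 0 < φ v) {p C : ℝ} (hp : 2 * (N : ℝ) < p)
    (hdec : ∀ v, φ v ≤ C * (1 + ‖v‖) ^ (-p)) {us : Vel N} {V1 ρs : ℝ} (hρ : 0 < ρs)
    (h : ∀ᵐ v ∂(volume : Measure (Vel N)), Q φ v + ρs * Q1 us V1 φ v = 0) :
    ∀ᵐ v, totalGain φ us V1 ρs v = totalLoss φ us V1 ρs v := by
  filter_upwards [h,
    ae_lt_top (measurable_totalGain hN hc us V1 ρs)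
      (lintegral_totalGain_lt_top hN hc hpos hp hdec us V1 ρs).ne,
    ae_lt_top (measurable_totalLoss hN hc us V1 ρs)
      (lintegral_totalLoss_lt_top hN hc hpos hp hdec us V1 ρs).ne] with v h1 h2 h3
  exact totalGain_eq_totalLoss hc hpos hρ h2.ne h3.ne h1

theorem ofReal_dissipation {A B x y z w : ℝ} (hA : 0 ≤ A) (hB : 0 ≤ B) (hx : 0 ≤ x) (hy : 0 ≤ y)
    (hz : 0 ≤ z) (hw : 0 ≤ w) :
    ENNReal.ofReal A * (ENNReal.ofReal x + ENNReal.ofReal y) +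
      ENNReal.ofReal B * (ENNReal.ofReal z + ENNReal.ofReal w) =
      ENNReal.ofReal (A * (x + y) + B * (z + w)) := by
  rw [← ENNReal.ofReal_add hx hy, ← ENNReal.ofReal_add hz hw, ← ENNReal.ofReal_mul hA,
    ← ENNReal.ofReal_mul hB, ← ENNReal.ofReal_add (by positivity) (by positivity)]

/-- The `H`-theorem in the equality case: a solution has no entropy dissipation, in collisions of
normal particles and in collisions with the condensate. -/
theorem ae_entropyVar_eq (hN : 2 ≤ N) (hc : Continuous φ)
    (hpos : ∀ v, 0 < φ v) {p C : ℝ} (hp : 2 * (N : ℝ) < p)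
    (hdec : ∀ v, φ v ≤ C * (1 + ‖v‖) ^ (-p)) {us : Vel N} {V1 ρs : ℝ} (hρ : 0 < ρs)
    (h : ∀ᵐ v ∂(volume : Measure (Vel N)), Q φ v + ρs * Q1 us V1 φ v = 0) :
    (∀ᵐ q ∂(collisionMeasure N), entropyVar φ q.1 + entropyVar φ q.2.1 =
      entropyVar φ (vPrime q.1 q.2.1 q.2.2) + entropyVar φ (vsPrime q.1 q.2.1 q.2.2)) ∧
    ∀ᵐ t ∂(condensateMeasure us V1), entropyVar φ t.1 =
      entropyVar φ t.2.1 + entropyVar φ t.2.2 := by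
  have hg := (continuous_pairGain hc).measurable
  have hl := (continuous_pairLoss hc).measurable
  have hm := (continuous_mergeRate hc).measurable
  have hs := (continuous_splitRate hc).measurable
  have hχ := (continuous_entropyVar hc hpos).measurable
  have hχ0 := fun v => (entropyVar_pos hpos v).le
  have hv1 : Measurable fun q : Vel N × Vel N × sphere (0 : Vel N) 1 =>
      vPrime q.1 q.2.1 q.2.2 := by unfold vPrime; fun_prop
  have hv2 : Measurable fun q : Vel N × Vel N × sphere (0 : Vel N) 1 =>
      vsPrime q.1 q.2.1 q.2.2 := by unfold vsPrime; fun_prop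
  set X : Vel N → ℝ≥0∞ := fun v => ENNReal.ofReal (entropyVar φ v) with hX
  have hXm : Measurable X := hχ.ennreal_ofReal
  have hXt : ∀ v, X v ≠ ⊤ := fun v => ENNReal.ofReal_ne_top
  have hfin := lintegral_totalLoss_mul_entropyVar_lt_top hN hc hpos hp hdec us V1 ρs
  have heq : ∫⁻ v, totalGain φ us V1 ρs v * X v = ∫⁻ v, totalLoss φ us V1 ρs v * X v := by
    refine lintegral_congr_ae ?_
    filter_upwards [ae_totalGain_eq_totalLoss hN hc hpos hp hdec hρ h] with v hv
    rw [hv]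
  have eL : ∫⁻ v, totalLoss φ us V1 ρs v * X v = _ :=
    lintegral_totalRate_mul hN us V1 ρs hl.ennreal_ofReal hs.ennreal_ofReal
      hm.ennreal_ofReal hXm hXt
  have eG : ∫⁻ v, totalGain φ us V1 ρs v * X v = _ :=
    lintegral_totalRate_mul hN us V1 ρs hg.ennreal_ofReal hm.ennreal_ofReal
      hs.ennreal_ofReal hXm hXt
  have sG := lintegral_collisionMeasure_symmetrize (A := fun q => ENNReal.ofReal (pairGain φ q))
    (B := fun q => ENNReal.ofReal (pairLoss φ q)) hg.ennreal_ofReal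
    (fun q => by simp only [pairGain_swap]) (fun q => by simp only [pairGain_prime]) hXm
  have sL := lintegral_collisionMeasure_symmetrize (A := fun q => ENNReal.ofReal (pairLoss φ q))
    (B := fun q => ENNReal.ofReal (pairGain φ q)) hl.ennreal_ofReal
    (fun q => by simp only [pairLoss_swap]) (fun q => by simp only [pairLoss_prime]) hXm
  have cG := lintegral_condensateMeasure_symmetrize us V1
    (A := fun t => ENNReal.ofReal (mergeRate φ t))
    (B := fun t => ENNReal.ofReal (splitRate φ t)) hm.ennreal_ofReal hs.ennreal_ofReal
    (fun t => by simp only [splitRate]; ring_nf) hXm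
  have cL := lintegral_condensateMeasure_symmetrize us V1
    (A := fun t => ENNReal.ofReal (splitRate φ t))
    (B := fun t => ENNReal.ofReal (mergeRate φ t)) hs.ennreal_ofReal hm.ennreal_ofReal
    (fun t => by simp only [mergeRate]; ring_nf) hXm
  rw [← cL] at eL
  rw [← cG] at eG
  have hpt1 : ∀ q : Vel N × Vel N × sphere (0 : Vel N) 1,
      ENNReal.ofReal (pairLoss φ q) * (X q.1 + X q.2.1) + ENNReal.ofReal (pairGain φ q) *
        (X (vPrime q.1 q.2.1 q.2.2) + X (vsPrime q.1 q.2.1 q.2.2)) ≤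
      ENNReal.ofReal (pairGain φ q) * (X q.1 + X q.2.1) + ENNReal.ofReal (pairLoss φ q) *
        (X (vPrime q.1 q.2.1 q.2.2) + X (vsPrime q.1 q.2.1 q.2.2)) := by
    intro q
    simp only [hX]
    rw [ofReal_dissipation (pairLoss_pos hpos q).le (pairGain_pos hpos q).le (hχ0 _) (hχ0 _)
      (hχ0 _) (hχ0 _), ofReal_dissipation (pairGain_pos hpos q).le (pairLoss_pos hpos q).le
      (hχ0 _) (hχ0 _) (hχ0 _) (hχ0 _)]
    refine ENNReal.ofReal_le_ofReal ?_
    linarith [dissipation_le (pairLoss_pos hpos q) (pairGain_eq hpos q)]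
  have hone : ∀ {A B x z w : ℝ}, 0 ≤ A → 0 ≤ B → 0 ≤ x → 0 ≤ z → 0 ≤ w →
      ENNReal.ofReal A * ENNReal.ofReal x + ENNReal.ofReal B *
        (ENNReal.ofReal z + ENNReal.ofReal w) = ENNReal.ofReal (A * x + B * (z + w)) := by
    intro A B x z w hA hB hx hz hw
    simpa using ofReal_dissipation hA hB hx le_rfl hz hw
  have hpt2 : ∀ t : Vel N × Vel N × Vel N,
      ENNReal.ofReal (splitRate φ t) * X t.1 + ENNReal.ofReal (mergeRate φ t) *
        (X t.2.1 + X t.2.2) ≤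
      ENNReal.ofReal (mergeRate φ t) * X t.1 + ENNReal.ofReal (splitRate φ t) *
        (X t.2.1 + X t.2.2) := by
    intro t
    simp only [hX]
    rw [hone (splitRate_pos hpos t).le (mergeRate_pos hpos t).le (hχ0 _) (hχ0 _) (hχ0 _),
      hone (mergeRate_pos hpos t).le (splitRate_pos hpos t).le (hχ0 _) (hχ0 _) (hχ0 _)]
    refine ENNReal.ofReal_le_ofReal ?_
    linarith [dissipation_le (splitRate_pos hpos t) (mergeRate_eq hpos t)]
  -- the symmetrized pair term is `4` times the original one, so the equation is taken `4` times
  have hkey := eq_and_eq_of_add_mul_eq (lintegral_mono (μ := collisionMeasure N) hpt1)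
    (lintegral_mono (μ := condensateMeasure us V1) hpt2) (k := 4 * ENNReal.ofReal ρs)
    (by simpa using hρ) (by finiteness)
    (by
      rw [sL, mul_assoc, ← mul_add, ← eL]
      exact ENNReal.mul_ne_top (by simp) hfin.ne)
    (by rw [sL, sG, mul_assoc, mul_assoc, ← mul_add, ← mul_add, ← eL, ← eG, heq])
  have hfin4 : 4 * ∫⁻ v, totalLoss φ us V1 ρs v * X v ≠ ⊤ := ENNReal.mul_ne_top (by simp) hfin.ne
  rw [eL, mul_add, ← sL] at hfin4
  obtain ⟨hfin1, hfin2⟩ := ENNReal.add_ne_top.1 hfin4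
  have hfin3 : ∫⁻ t, (ENNReal.ofReal (splitRate φ t) * X t.1 + ENNReal.ofReal (mergeRate φ t) *
        (X t.2.1 + X t.2.2)) ∂(condensateMeasure us V1) ≠ ⊤ := by
    intro htop
    rw [htop, ENNReal.mul_top (by simpa using hρ), ENNReal.mul_top (by simp)] at hfin2
    exact hfin2 rfl
  constructor
  · have := ae_eq_of_ae_le_of_lintegral_le (Eventually.of_forall hpt1) hfin1 (by fun_prop)
      hkey.1.le
    filter_upwards [this] with q hq
    simp only [hX] at hq
    rw [ofReal_dissipation (pairLoss_pos hpos q).le (pairGain_pos hpos q).le (hχ0 _) (hχ0 _)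
      (hχ0 _) (hχ0 _), ofReal_dissipation (pairGain_pos hpos q).le (pairLoss_pos hpos q).le
      (hχ0 _) (hχ0 _) (hχ0 _) (hχ0 _), ENNReal.ofReal_eq_ofReal_iff] at hq
    · exact eq_of_dissipation_eq (pairLoss_pos hpos q) (pairGain_eq hpos q) (by linarith)
    · exact add_nonneg (mul_nonneg (pairLoss_pos hpos q).le (add_nonneg (hχ0 _) (hχ0 _)))
        (mul_nonneg (pairGain_pos hpos q).le (add_nonneg (hχ0 _) (hχ0 _)))
    · exact add_nonneg (mul_nonneg (pairGain_pos hpos q).le (add_nonneg (hχ0 _) (hχ0 _)))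
        (mul_nonneg (pairLoss_pos hpos q).le (add_nonneg (hχ0 _) (hχ0 _)))
  · have := ae_eq_of_ae_le_of_lintegral_le (Eventually.of_forall hpt2) hfin3 (by fun_prop)
      hkey.2.le
    filter_upwards [this] with t ht
    simp only [hX] at ht
    rw [hone (splitRate_pos hpos t).le (mergeRate_pos hpos t).le (hχ0 _) (hχ0 _) (hχ0 _),
      hone (mergeRate_pos hpos t).le (splitRate_pos hpos t).le (hχ0 _) (hχ0 _) (hχ0 _),
      ENNReal.ofReal_eq_ofReal_iff] at ht
    · exact eq_of_dissipation_eq (splitRate_pos hpos t) (mergeRate_eq hpos t) (by linarith)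
    · exact add_nonneg (mul_nonneg (splitRate_pos hpos t).le (hχ0 _))
        (mul_nonneg (mergeRate_pos hpos t).le (add_nonneg (hχ0 _) (hχ0 _)))
    · exact add_nonneg (mul_nonneg (mergeRate_pos hpos t).le (hχ0 _))
        (mul_nonneg (splitRate_pos hpos t).le (add_nonneg (hχ0 _) (hχ0 _)))

end Entropy

/-! ### Equilibria -/

section Equilibria

open Set Filter Topology Metric
open scoped ENNReal

variable {N : ℕ} {φ : Vel N → ℝ}

instance instIsOpenPosMeasureCollisionMeasure : Measure.IsOpenPosMeasure (collisionMeasure N) := by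
  have : Measure.IsOpenPosMeasure
      ((volume : Measure (Vel N)).prod (volume : Measure (Vel N)).toSphere) :=
    Measure.prod.instIsOpenPosMeasure
  exact Measure.prod.instIsOpenPosMeasure

/-- A pair with given momentum and energy is reached from any other such pair by one elastic
collision, whose direction is that of `v - v'`. -/
theorem isCollisionInvariant_of_ae {ψ : Vel N → ℝ} (hψ : Continuous ψ)
    (h : ∀ᵐ q ∂(collisionMeasure N), ψ q.1 + ψ q.2.1 =
      ψ (vPrime q.1 q.2.1 q.2.2) + ψ (vsPrime q.1 q.2.1 q.2.2)) : IsCollisionInvariant ψ := by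
  have hall := (Continuous.ae_eq_iff_eq (collisionMeasure N)
    (f := fun q => ψ q.1 + ψ q.2.1)
    (g := fun q => ψ (vPrime q.1 q.2.1 q.2.2) + ψ (vsPrime q.1 q.2.1 q.2.2))
    (by fun_prop) (by unfold vPrime vsPrime; fun_prop)).1 h
  intro v w v' w' hm he
  by_cases hk : v = v'
  · subst hk
    rw [add_left_cancel hm]
  have hk0 : ‖v - v'‖ ≠ 0 := norm_ne_zero_iff.2 (sub_ne_zero.2 hk)
  have hw' : w' = w + (v - v') := by rw [← add_sub_assoc, add_comm w, hm]; abel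
  have hin : inner ℝ (v - w) (v - v') = ‖v - v'‖ ^ 2 := by
    have h1 : v' = v - (v - v') := by abel
    rw [hw'] at he
    generalize v - v' = k at *
    subst h1
    rw [norm_sub_sq_real, norm_add_sq_real] at he
    rw [inner_sub_left]
    linarith
  have hn : ‖‖v - v'‖⁻¹ • (v - v')‖ = 1 := by
    rw [norm_smul, norm_inv, norm_norm, inv_mul_cancel₀ hk0]
  have hc : inner ℝ (v - w) (‖v - v'‖⁻¹ • (v - v')) • (‖v - v'‖⁻¹ • (v - v')) = v - v' := by
    rw [inner_smul_right, hin, smul_smul]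
    rw [show ‖v - v'‖⁻¹ * ‖v - v'‖ ^ 2 * ‖v - v'‖⁻¹ = 1 by field_simp, one_smul]
  have := congrFun hall (v, w, ⟨‖v - v'‖⁻¹ • (v - v'), mem_sphere_zero_iff_norm.2 hn⟩)
  simp only [vPrime, vsPrime, hc] at this
  rw [this, sub_sub_cancel, ← hw']

/-- The condensate measure charges triples obeying the conservation laws, so what holds almost
everywhere for it holds for at least one of them. -/
theorem exists_of_ae_condensateMeasure (hN : 2 ≤ N) {us : Vel N} {V1 : ℝ}
    {P : Vel N × Vel N × Vel N → Prop} (h : ∀ᵐ t ∂(condensateMeasure us V1), P t) :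
    ∃ a b c : Vel N, us + a = b + c ∧ ‖us‖ ^ 2 - V1 + ‖a‖ ^ 2 = ‖b‖ ^ 2 + ‖c‖ ^ 2 ∧
      P (a, b, c) := by
  have : Nontrivial (Vel N) := by
    have : Nonempty (Fin N) := ⟨⟨0, by omega⟩⟩
    infer_instance
  have : Measure.IsOpenPosMeasure
      ((volume : Measure (Vel N)).prod (volume : Measure (Vel N)).toSphere) :=
    Measure.prod.instIsOpenPosMeasure
  have h1 := ae_of_ae_map (by fun_prop) h
  rw [splitMeasure] at h1
  have hmap : Measurable (splitMap V1 : Vel N × sphere (0 : Vel N) 1 → Vel N × Vel N) :=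
    measurable_splitMap.comp measurable_prodMk_left
  have hwt : Measurable fun p : Vel N × sphere (0 : Vel N) 1 =>
      ENNReal.ofReal (splitWeight V1 p.1) :=
    ((measurable_splitWeight.comp measurable_prodMk_left).comp measurable_fst).ennreal_ofReal
  have h2 := (ae_withDensity_iff hwt).1 (ae_of_ae_map hmap.aemeasurable h1)
  obtain ⟨w₀, hw₀⟩ := exists_norm_eq (Vel N) (c := |2 * V1| + 1) (by positivity)
  obtain ⟨n₀⟩ : Nonempty (sphere (0 : Vel N) 1) :=
    (NormedSpace.sphere_nonempty.2 zero_le_one).to_subtype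
  have hopen : IsOpen {p : Vel N × sphere (0 : Vel N) 1 | 2 * V1 < ‖p.1‖ ^ 2} :=
    isOpen_lt continuous_const (by fun_prop)
  have hne : (volume : Measure (Vel N)).prod (volume : Measure (Vel N)).toSphere
      {p : Vel N × sphere (0 : Vel N) 1 | 2 * V1 < ‖p.1‖ ^ 2} ≠ 0 := by
    refine hopen.measure_ne_zero _ ⟨(w₀, n₀), ?_⟩
    simp only [mem_ofPred_eq, hw₀]
    nlinarith [le_abs_self (2 * V1), abs_nonneg (2 * V1)]
  obtain ⟨⟨w, n⟩, hw, hP⟩ := ((frequently_ae_mem_iff.2 hne).and_eventually h2).exists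
  have hw' : 2 * V1 < ‖w‖ ^ 2 := hw
  have hr := splitRadius_pos hw'
  refine ⟨_, _, _, ?_, ?_, hP ?_⟩
  · module
  · have := inner_splitMap hw' n
    generalize splitMap V1 (w, n) = p at *
    rw [← add_assoc, norm_add_sq_real (us + p.1) p.2, norm_add_sq_real us p.2, inner_add_left]
    linarith
  · simp only [splitWeight, if_pos hw']
    simp only [ne_eq, ENNReal.ofReal_eq_zero, not_le]
    positivity

theorem exists_quadratic_entropyVar (hN : 2 ≤ N) (hs : ContDiff ℝ ∞ φ) (hpos : ∀ v, 0 < φ v)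
    {us : Vel N} {V1 : ℝ}
    (h₀ : ∀ᵐ q ∂(collisionMeasure N), entropyVar φ q.1 + entropyVar φ q.2.1 =
      entropyVar φ (vPrime q.1 q.2.1 q.2.2) + entropyVar φ (vsPrime q.1 q.2.1 q.2.2))
    (h₁ : ∀ᵐ t ∂(condensateMeasure us V1), entropyVar φ t.1 =
      entropyVar φ t.2.1 + entropyVar φ t.2.2) :
    ∃ (β : Vel N) (γ : ℝ), ∀ v, entropyVar φ v =
      inner ℝ β (v - us) + γ * (‖v‖ ^ 2 - ‖us‖ ^ 2 + V1) := by
  have hd : Differentiable ℝ (entropyVar φ) := by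
    have hφ : Differentiable ℝ φ := hs.differentiable (by simp)
    have hlog : entropyVar φ = fun v => Real.log (1 + φ v) - Real.log (φ v) := funext fun v =>
      Real.log_div (by linarith [hpos v]) (hpos v).ne'
    rw [hlog]
    exact ((hφ.const_add 1).log fun v => by linarith [hpos v]).sub (hφ.log fun v => (hpos v).ne')
  obtain ⟨α, β, γ, hχ⟩ := (isCollisionInvariant_of_ae (continuous_entropyVar hs.continuous hpos)
    h₀).exists_eq (by rwa [finrank_euclideanSpace_fin]) hd
  obtain ⟨a, b, c, hm, he, habc⟩ := exists_of_ae_condensateMeasure hN h₁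
  simp only [hχ] at habc
  have hin : inner ℝ β us + inner ℝ β a = inner ℝ β b + inner ℝ β c := by
    rw [← inner_add_right, ← inner_add_right, hm]
  refine ⟨β, γ, fun v => ?_⟩
  rw [hχ, inner_sub_right]
  linear_combination hin - habc + γ * he

theorem exists_decay_lt {p C : ℝ} (hp : 0 < p) (hdec : ∀ v, φ v ≤ C * (1 + ‖v‖) ^ (-p)) {ε : ℝ}
    (hε : 0 < ε) : ∃ R : ℝ, ∀ v, R ≤ ‖v‖ → φ v < ε := by
  have h : Tendsto (fun r : ℝ => C * (1 + r) ^ (-p)) atTop (𝓝 0) := by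
    simpa using ((tendsto_rpow_neg_atTop hp).comp
      (tendsto_atTop_add_const_left atTop 1 tendsto_id)).const_mul C
  obtain ⟨R, hR⟩ := eventually_atTop.1 (h.eventually_lt_const hε)
  exact ⟨R, fun v hv => (hdec v).trans_lt (hR _ hv)⟩

theorem uN_eq_of_symmetric (hc : Continuous φ) (hN : 2 ≤ N) (hpos : ∀ v, 0 < φ v) {p C : ℝ}
    (hp : 2 * (N : ℝ) < p) (hdec : ∀ v, φ v ≤ C * (1 + ‖v‖) ^ (-p)) {u : Vel N}
    (hsymm : ∀ v, φ (u + u - v) = φ v) : uN φ = u := by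
  have hN' : (2 : ℝ) ≤ N := by exact_mod_cast hN
  have hC := const_pos_of_decay hpos hdec
  have hint : Integrable φ := by
    refine ((integrable_one_add_norm (r := p) (E := Vel N) (μ := volume) ?_).const_mul C).mono'
      hc.aestronglyMeasurable (Eventually.of_forall fun v => ?_)
    · rw [finrank_euclideanSpace_fin]; linarith
    · rw [Real.norm_of_nonneg (hpos v).le]; exact hdec v
  have hmom : Integrable fun v : Vel N => φ v • v := by
    refine ((integrable_one_add_norm (r := p - 1) (E := Vel N) (μ := volume) ?_).const_mul C).mono'
      (by fun_prop) (Eventually.of_forall fun v => ?_)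
    · rw [finrank_euclideanSpace_fin]; linarith
    · have h1 : 0 < 1 + ‖v‖ := by positivity
      have h2 : (1 + ‖v‖) ^ (-(p - 1)) = (1 + ‖v‖) ^ (-p) * (1 + ‖v‖) := by
        rw [show -(p - 1) = -p + 1 by ring, Real.rpow_add h1, Real.rpow_one]
      rw [norm_smul, Real.norm_of_nonneg (hpos v).le, h2, ← mul_assoc]
      exact mul_le_mul (hdec v) (by linarith) (norm_nonneg v) (by positivity)
  have hmass : 0 < rhoN φ := by
    refine (integral_pos_iff_support_of_nonneg (fun v => (hpos v).le) hint).2 ?_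
    rw [show Function.support φ = univ from eq_univ_of_forall fun v => (hpos v).ne']
    exact isOpen_univ.measure_pos _ univ_nonempty
  have hzero : ∫ v, φ v • (v - u) = 0 := by
    have h1 : ∫ v, φ v • (v - u) = -∫ v, φ v • (v - u) := by
      rw [← integral_neg, ← integral_sub_left_eq_self _ volume (u + u)]
      refine integral_congr_ae (Eventually.of_forall fun v => ?_)
      simp only [hsymm]
      module
    have h2 : (2 : ℝ) • ∫ v, φ v • (v - u) = 0 := by
      rw [two_smul]
      exact eq_neg_iff_add_eq_zero.1 h1
    exact (smul_eq_zero.1 h2).resolve_left two_ne_zero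
  have hsplit : ∫ v, φ v • v = rhoN φ • u := by
    simp_rw [smul_sub] at hzero
    rw [integral_sub hmom (hint.smul_const u), integral_smul_const, sub_eq_zero] at hzero
    exact hzero
  rw [uN, hsplit, smul_smul, one_div_mul_cancel hmass.ne', one_smul]

/-- The entropy variable is positive and unbounded at infinity, so its quadratic part is positive;
the equilibrium is then symmetric about the centre of the quadratic, which is its mean velocity. -/
theorem eq_maxwellian_of_entropyVar_eq (hN : 2 ≤ N) (hc : Continuous φ) (hpos : ∀ v, 0 < φ v)
    {p C : ℝ} (hp : 2 * (N : ℝ) < p) (hdec : ∀ v, φ v ≤ C * (1 + ‖v‖) ^ (-p)) {us β : Vel N}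
    {V1 γ : ℝ} (hχ : ∀ v, entropyVar φ v =
      inner ℝ β (v - us) + γ * (‖v‖ ^ 2 - ‖us‖ ^ 2 + V1)) :
    ∃ T : ℝ, 0 < T ∧ ∀ v, φ v = maxwellian (uN φ) us V1 T v /
      (1 - maxwellian (uN φ) us V1 T v) := by
  have : Nontrivial (Vel N) := by
    have : Nonempty (Fin N) := ⟨⟨0, by omega⟩⟩
    infer_instance
  have hN' : (2 : ℝ) ≤ N := by exact_mod_cast hN
  have hexp : ∀ v, Real.exp (-entropyVar φ v) = φ v / (1 + φ v) := fun v => by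
    rw [Real.exp_neg, exp_entropyVar hpos, inv_div]
  have hinj : ∀ v w, entropyVar φ v = entropyVar φ w → φ v = φ w := by
    intro v w hvw
    have h1 := exp_entropyVar hpos v
    rw [hvw, exp_entropyVar hpos, div_eq_div_iff (hpos w).ne' (hpos v).ne'] at h1
    linarith
  have hγ : 0 < γ := by
    set α := inner ℝ β (0 - us) + γ * (- ‖us‖ ^ 2 + V1) with hα
    -- averaging `χ` over `v` and `-v` removes its linear part
    obtain ⟨R, hR⟩ := exists_decay_lt (p := p) (by linarith) hdec (Real.exp_pos (-α))
    obtain ⟨v, hv⟩ := exists_norm_eq (Vel N) (c := max R 0) (le_max_right _ _)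
    have hbig : ∀ w : Vel N, ‖w‖ = max R 0 → α < entropyVar φ w := by
      intro w hw
      have h1 := hR w (by rw [hw]; exact le_max_left _ _)
      have h2 := hpos w
      rw [entropyVar, Real.lt_log_iff_exp_lt (by positivity), lt_div_iff₀ h2]
      rw [Real.exp_neg, lt_inv_comm₀ h2 (Real.exp_pos _), ← one_div, lt_div_iff₀ h2] at h1
      linarith
    have h1 := hbig v hv
    have h2 := hbig (-v) (by rw [norm_neg, hv])
    rw [hχ, hα, inner_sub_right, inner_sub_right] at h1 h2
    rw [norm_neg, inner_neg_right] at h2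
    rw [inner_zero_right] at h1 h2
    have h3 : 0 < γ * ‖v‖ ^ 2 := by linarith
    exact pos_of_mul_pos_left h3 (by positivity)
  set T : ℝ := 1 / (2 * γ) with hT
  have hTpos : 0 < T := by positivity
  set u : Vel N := -(T • β) with hu
  have hβ : β = -((2 * γ) • u) := by
    rw [hu, hT, smul_neg, neg_neg, smul_smul, mul_one_div_cancel (by positivity), one_smul]
  have hquad : ∀ v, entropyVar φ v = (‖v - u‖ ^ 2 - ‖us - u‖ ^ 2 + V1) / (2 * T) := by
    intro v
    rw [hχ, norm_sub_sq_real, norm_sub_sq_real, hβ, inner_neg_left, inner_smul_left,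
      inner_sub_right, real_inner_comm u v, real_inner_comm u us, hT]
    simp only [conj_trivial]
    field_simp
    ring
  have hun : uN φ = u := by
    refine uN_eq_of_symmetric hc hN hpos hp hdec fun v => hinj _ _ ?_
    rw [hquad, hquad, show u + u - v - u = -(v - u) by abel, norm_neg]
  refine ⟨T, hTpos, fun v => ?_⟩
  have hM : maxwellian u us V1 T v = φ v / (1 + φ v) := by
    rw [maxwellian, neg_div, ← hquad, hexp]
  have := hpos v
  rw [hun, hM]
  field_simp
  ring

theorem pairGain_eq_pairLoss_of_invariant (hpos : ∀ v, 0 < φ v)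
    (h : IsCollisionInvariant (entropyVar φ)) (q : Vel N × Vel N × sphere (0 : Vel N) 1) :
    pairGain φ q = pairLoss φ q := by
  have hn : ‖(q.2.2 : Vel N)‖ = 1 := mem_sphere_zero_iff_norm.1 q.2.2.2
  rw [pairGain_eq hpos, h q.1 q.2.1 (vPrime q.1 q.2.1 q.2.2) (vsPrime q.1 q.2.1 q.2.2), sub_self,
    Real.exp_zero, mul_one]
  · simp only [vPrime, vsPrime]; abel
  · simp only [vPrime, vsPrime]
    rw [norm_sub_sq_real, norm_add_sq_real, norm_smul, hn, inner_smul_right, inner_smul_right,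
      mul_one, Real.norm_eq_abs, sq_abs, inner_sub_left]
    ring

theorem measurable_paramC1 (us : Vel N) (V1 : ℝ) (v : Vel N) :
    Measurable fun n : sphere (0 : Vel N) 1 => paramC1 us V1 v n := by
  unfold paramC1; fun_prop

theorem measurable_paramC2 (us : Vel N) (V1 : ℝ) (v : Vel N) :
    Measurable fun y : (Submodule.span ℝ {v - us})ᗮ => paramC2 us V1 v y := by
  unfold paramC2; fun_prop

theorem measurableSet_C1 (us : Vel N) (V1 : ℝ) (v : Vel N) : MeasurableSet (C1 us V1 v) :=
  ((isClosed_eq (by fun_prop) (by fun_prop)).inter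
    (isClosed_eq (by fun_prop) (by fun_prop))).measurableSet

theorem measurableSet_C2 (us : Vel N) (V1 : ℝ) (v : Vel N) : MeasurableSet (C2 us V1 v) :=
  ((isClosed_eq (by fun_prop) (by fun_prop)).inter
    (isClosed_eq (by fun_prop) (by fun_prop))).measurableSet

theorem ae_mem_C1 (us : Vel N) (V1 : ℝ) (v : Vel N) :
    ∀ᵐ p ∂(measC1 us V1 v), p ∈ C1 us V1 v := by
  unfold measC1
  split_ifs with h
  · refine Measure.ae_smul_measure ?_ _
    refine (mem_ae_map_iff (measurable_paramC1 us V1 v).aemeasurable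
      (measurableSet_C1 us V1 v)).2 (Eventually.of_forall fun n => ?_)
    rw [C1_eq_range us V1 v h]
    exact mem_range_self n
  · simp

theorem ae_mem_C2 (us : Vel N) (V1 : ℝ) (v : Vel N) :
    ∀ᵐ p ∂(measC2 us V1 v), p ∈ C2 us V1 v := by
  unfold measC2
  by_cases h : v = us
  -- the weight `1 / (2 * 0)` is `0`, so the measure vanishes
  · simp [h]
  · refine Measure.ae_smul_measure ?_ _
    refine (mem_ae_map_iff (measurable_paramC2 us V1 v).aemeasurable
      (measurableSet_C2 us V1 v)).2 (Eventually.of_forall fun y => ?_)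
    rw [C2_eq_range us V1 v h]
    exact mem_range_self y

/-- At an equilibrium every collision is in detailed balance. -/
theorem Q_add_Q1_eq_zero_of_entropyVar_eq (hpos : ∀ v, 0 < φ v) {us u : Vel N} {V1 T : ℝ}
    (hχ : ∀ v, entropyVar φ v = (‖v - u‖ ^ 2 - ‖us - u‖ ^ 2 + V1) / (2 * T)) (ρs : ℝ)
    (v : Vel N) : Q φ v + ρs * Q1 us V1 φ v = 0 := by
  have hinv : IsCollisionInvariant (entropyVar φ) := by
    intro a b a' b' hm he
    have hin : inner ℝ a u + inner ℝ b u = inner ℝ a' u + inner ℝ b' u := by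
      rw [← inner_add_left, ← inner_add_left, hm]
    simp only [hχ, norm_sub_sq_real]
    linear_combination (he - 2 * hin) / (2 * T)
  have hbal : ∀ a b c : Vel N, us + a = b + c →
      ‖us‖ ^ 2 - V1 + ‖a‖ ^ 2 = ‖b‖ ^ 2 + ‖c‖ ^ 2 →
      φ b * φ c * (1 + φ a) = φ a * (1 + φ b) * (1 + φ c) := by
    intro a b c hm he
    have hin : inner ℝ us u + inner ℝ a u = inner ℝ b u + inner ℝ c u := by
      rw [← inner_add_left, ← inner_add_left, hm]
    have hsum : entropyVar φ a - (entropyVar φ b + entropyVar φ c) = 0 := by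
      simp only [hχ, norm_sub_sq_real]
      linear_combination (he - 2 * hin) / (2 * T)
    have := mergeRate_eq hpos (a, b, c)
    simpa only [hsum, Real.exp_zero, mul_one, mergeRate, splitRate] using this
  have hQ : Q φ v = 0 := by
    have h0 : ∀ vs : Vel N, ∀ n : sphere (0 : Vel N) 1,
        φ (vPrime v vs n) * φ (vsPrime v vs n) * (1 + φ v) * (1 + φ vs)
          - φ v * φ vs * (1 + φ (vPrime v vs n)) * (1 + φ (vsPrime v vs n)) = 0 := fun vs n =>
      sub_eq_zero.2 (pairGain_eq_pairLoss_of_invariant hpos hinv (v, vs, n))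
    simp [Q, h0]
  have h1 : ∫ p : Vel N × Vel N, (φ p.1 * φ p.2 - φ v * (φ p.1 + φ p.2 + 1)) ∂(measC1 us V1 v)
      = 0 := by
    refine integral_eq_zero_of_ae ?_
    filter_upwards [ae_mem_C1 us V1 v] with p hp
    have := hbal v p.1 p.2 hp.1 hp.2
    simp only [Pi.zero_apply]
    linear_combination this
  have h2 : ∫ p : Vel N × Vel N, (φ p.2 * (φ v + φ p.1 + 1) - φ v * φ p.1) ∂(measC2 us V1 v)
      = 0 := by
    refine integral_eq_zero_of_ae ?_
    filter_upwards [ae_mem_C2 us V1 v] with p hp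
    have := hbal p.2 v p.1 hp.1 hp.2
    simp only [Pi.zero_apply]
    linear_combination -this
  rw [hQ, Q1, h1, h2]
  ring

theorem entropyVar_eq_of_eq_maxwellian (hpos : ∀ v, 0 < φ v) {us u : Vel N} {V1 T : ℝ}
    (h : ∀ v, φ v = maxwellian u us V1 T v / (1 - maxwellian u us V1 T v)) (v : Vel N) :
    entropyVar φ v = (‖v - u‖ ^ 2 - ‖us - u‖ ^ 2 + V1) / (2 * T) := by
  have hM : 0 < maxwellian u us V1 T v := Real.exp_pos _
  have h1 : 0 < 1 - maxwellian u us V1 T v := by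
    have h2 := hpos v
    rw [h v] at h2
    exact (div_pos_iff_of_pos_left hM).1 h2
  have h3 : (1 + φ v) / φ v = (maxwellian u us V1 T v)⁻¹ := by
    rw [h v]
    field_simp
    ring
  rw [entropyVar, h3, Real.log_inv, maxwellian, Real.log_exp, neg_div, neg_neg]

end Equilibria

end BoseGas

end

theorem mainTheorem4 (N : ℕ) (hN : 2 ≤ N) (φ : BoseGas.Vel N → ℝ)
    (hsmooth : ContDiff ℝ ∞ φ) (hpos : ∀ v, 0 < φ v)
    (hdecay : ∃ p : ℝ, 2 * (N : ℝ) < p ∧ ∃ C : ℝ, ∀ v, φ v ≤ C * (1 + ‖v‖) ^ (-p))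
    (us : BoseGas.Vel N) (V1 ρs : ℝ) (hρs : 0 < ρs) :
    (∀ᵐ v ∂(volume : Measure (BoseGas.Vel N)), BoseGas.Q φ v + ρs * BoseGas.Q1 us V1 φ v = 0) ↔
      ∃ T : ℝ, 0 < T ∧ ∀ v, φ v =
        BoseGas.maxwellian (BoseGas.uN φ) us V1 T v /
          (1 - BoseGas.maxwellian (BoseGas.uN φ) us V1 T v) := by
  obtain ⟨p, hp, C, hdec⟩ := hdecay
  constructor
  · intro h
    obtain ⟨h₀, h₁⟩ :=
      BoseGas.ae_entropyVar_eq hN hsmooth.continuous hpos hp hdec hρs h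
    obtain ⟨β, γ, hχ⟩ := BoseGas.exists_quadratic_entropyVar hN hsmooth hpos h₀ h₁
    exact BoseGas.eq_maxwellian_of_entropyVar_eq hN hsmooth.continuous hpos hp hdec hχ
  · rintro ⟨T, -, h⟩
    exact Filter.Eventually.of_forall fun v => BoseGas.Q_add_Q1_eq_zero_of_entropyVar_eq hpos
      (BoseGas.entropyVar_eq_of_eq_maxwellian hpos h) ρs v
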